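/- Let $\Omega\subset\mathbb R^2$ be a nonempty bounded open set and let $f:[0,2]\to[0,+\infty]$. Let $A(\Omega)$ be the set of all $m\in BV(\Omega,\mathbb R^2)$ with $|m|=1$ a.e. and $\nabla\cdot m=0$ in the sense of distributions on $\Omega$. For $m\in A(\Omega)$ let $J(m)\subset\Omega$ be the jump line of $m$, i.e. the set of approximate jump points $x$ of $m$, with one-sided traces $m_\pm(x)\in\mathbb S^1$, $m_+(x)\neq m_-(x)$, and define the line energy $$\mathcal I_f(m)=\int_{J(m)} f(|m_+-m_-|)\,\mathrm d\mathcal H^1\in[0,+\infty]$$ (if $f$ is not measurable, the integral is understood as a lower integral). Assume that $\mathcal I_f$ is lower semicontinuous with respect to weak convergence in $BV$: whenever $m_n,m\in A(\Omega)$, $m_n\to m$ in $L^1(\Omega)$ and $\sup_n|Dm_n|(\Omega)<\infty$, one has $\mathcal I_f(m)\le\liminf_{n\to\infty}\mathcal I_f(m_n)$. Then $f$ is lower semicontinuous on $(0,2]$ (hence on all of $[0,2]$ if $f(0)=0$; the value $f(0)$ does not enter $\mathcal I_f$), and $$\limsup_{t\to0^+}\frac{f(t)}{t}\;\le\;2\,\limsup_{t\to2^-}f(t).$$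 -/

import Mathlib

open MeasureTheory Filter Topology Set
open scoped ENNReal ContDiff

namespace LineEnergy

/-- The Euclidean plane. -/
abbrev Plane : Type := EuclideanSpace ℝ (Fin 2)

/-- The divergence of a differentiable vector field on the plane. -/
noncomputable def divergence (φ : Plane → Plane) (x : Plane) : ℝ :=
  ∑ j : Fin 2, (fderiv ℝ φ x (EuclideanSpace.single j 1)) j

/-- Admissible test fields for the total variation on `Ω` of a plane-valued function: pairs
`φ = (φ 0, φ 1)` of `C¹` vector fields with compact support in `Ω` such that the matrix with
rows `φ 0 x`, `φ 1 x` has Euclidean (Frobenius) norm at most `1` at every point `x`. -/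
structure IsTestField (Ω : Set Plane) (φ : Fin 2 → Plane → Plane) : Prop where
  contDiff : ∀ i, ContDiff ℝ 1 (φ i)
  hasCompactSupport : ∀ i, HasCompactSupport (φ i)
  tsupport_subset : ∀ i, tsupport (φ i) ⊆ Ω
  norm_le_one : ∀ x, ∑ i, ‖φ i x‖ ^ 2 ≤ 1

/-- The total variation `|Dm|(Ω)`, as a supremum over test fields. -/
noncomputable def totalVariation (Ω : Set Plane) (m : Plane → Plane) : ℝ≥0∞ :=
  ⨆ (φ : Fin 2 → Plane → Plane) (_ : IsTestField Ω φ),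
    ENNReal.ofReal (∑ i, ∫ x in Ω, m x i * divergence (φ i) x)

/-- `m ∈ BV(Ω, ℝ²)`. Only the values of `m` on `Ω` (up to null sets) matter. -/
def IsBV (Ω : Set Plane) (m : Plane → Plane) : Prop :=
  IntegrableOn m Ω ∧ totalVariation Ω m < ⊤

/-- `∇ · m = 0` on `Ω` in the sense of distributions. -/
def IsDivergenceFree (Ω : Set Plane) (m : Plane → Plane) : Prop :=
  ∀ φ : Plane → ℝ, ContDiff ℝ ∞ φ → HasCompactSupport φ → tsupport φ ⊆ Ω →
    ∫ x in Ω, inner ℝ (m x) (gradient φ x) = 0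

/-- The set `A(Ω)` of divergence-free vector fields in `BV(Ω, 𝕊¹)`. -/
def admissible (Ω : Set Plane) : Set (Plane → Plane) :=
  {m | IsBV Ω m ∧ (∀ᵐ x ∂(volume.restrict Ω), ‖m x‖ = 1) ∧ IsDivergenceFree Ω m}

/-- The open half ball `{y ∈ B(x, r) : (y - x) · ν > 0}`. -/
def halfBall (x ν : Plane) (r : ℝ) : Set Plane :=
  {y | y ∈ Metric.ball x r ∧ 0 < inner ℝ (y - x) ν}

/-- `x` is an (approximate) jump point of `m` with unit normal `ν`, trace `a` on the side
to which `ν` points, and trace `b ≠ a` on the other side. -/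
structure IsJumpPoint (m : Plane → Plane) (x a b ν : Plane) : Prop where
  ne : a ≠ b
  norm_normal : ‖ν‖ = 1
  tendsto_pos :
    Tendsto (fun r : ℝ => ⨍⁻ y in halfBall x ν r, ‖m y - a‖ₑ ∂volume) (𝓝[>] 0) (𝓝 0)
  tendsto_neg :
    Tendsto (fun r : ℝ => ⨍⁻ y in halfBall x (-ν) r, ‖m y - b‖ₑ ∂volume) (𝓝[>] 0) (𝓝 0)

/-- The jump line `J(m)` of `m` in `Ω`. -/
def jumpSet (Ω : Set Plane) (m : Plane → Plane) : Set Plane :=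
  {x | x ∈ Ω ∧ ∃ a b ν, IsJumpPoint m x a b ν}

/-- The jump size `|m₊ - m₋|` at `x`. At a jump point the triple `(a, b, ν)` is unique up to
the exchange `(b, a, -ν)`, so that the supremum is over a single number. -/
noncomputable def jumpSize (m : Plane → Plane) (x : Plane) : ℝ :=
  sSup {t | ∃ a b ν, IsJumpPoint m x a b ν ∧ t = ‖a - b‖}

/-- The line energy `I_f(m)`, the integral of `f(|m₊ - m₋|)` over `J(m)` with respect to the
one-dimensional Hausdorff measure. Since the traces lie on the unit circle, only the values
of `f` on `(0, 2]` matter. -/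
noncomputable def lineEnergy (f : ℝ → ℝ≥0∞) (Ω : Set Plane) (m : Plane → Plane) : ℝ≥0∞ :=
  ∫⁻ x in jumpSet Ω m, f (jumpSize m x) ∂(Measure.hausdorffMeasure 1 : Measure Plane)

/-- Weak convergence in `BV(Ω)`: convergence in `L¹(Ω)` with bounded total variations. -/
def WeakBVTendsto (Ω : Set Plane) (u : ℕ → Plane → Plane) (m : Plane → Plane) : Prop :=
  Tendsto (fun n => ∫⁻ x in Ω, ‖u n x - m x‖ₑ) atTop (𝓝 0) ∧
    (⨆ n, totalVariation Ω (u n)) < ⊤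

/-- Lower semicontinuity of `I_f` along weakly convergent sequences in `A(Ω)`. -/
def LineEnergyLSC (f : ℝ → ℝ≥0∞) (Ω : Set Plane) : Prop :=
  ∀ (u : ℕ → Plane → Plane) (m : Plane → Plane),
    (∀ n, u n ∈ admissible Ω) → m ∈ admissible Ω → WeakBVTendsto Ω u m →
      lineEnergy f Ω m ≤ liminf (fun n => lineEnergy f Ω (u n)) atTop

end LineEnergy

namespace LineEnergy

/-! Both conclusions come from testing lower semicontinuity at `outer c s y₀`, which equals (-s, c)
above and (s, c) below a horizontal line meeting Ω, with c² + s² = 1. The normal component c does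
not jump, so the field is divergence free, and its energy is f(2s) times the length of the slice of
Ω (`lineEnergy_outer`). Letting the angle vary along a sequence keeps the slice fixed; its length is
positive and finite, hence divides out, which gives lower semicontinuity of f
(`lowerSemicontinuousOn_of_lsc`).

For the inequality one builds a competitor that trades a small jump for short walls with jumps close
to 2. A segment of length ℓ of the jump line is covered by N kites of length L = ℓ / N. Write (X, Y)
for the coordinates relative to the left vertex q of a kite. The outer field has stream function c X
+ s |Y|. In the kite the stream function becomes the minimum of |p - q| (a vortex around q) and L (1
+ c) - X (the constant field (0, -1)). The two are equal on a parabola with focus q. On the two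
sides through q the vortex coincides with the outer field, and on the other two sides the affine
stream function matches the outer one. The stream function is therefore continuous everywhere, and
the jumps in a kite sit only on the parabola and on the two far sides.

There the jump size lies in [√(2 + 2c), 2), apart from countably many points, and the walls of a
kite have length at most 4 (1 + s / (1 + c)) s L (`chain_jump`, `hausdorffMeasure_walls_le`). The
kites shrink to the axis, so the fields converge in L¹, while the variation added by a kite is O(L),
so the total variation stays bounded (`weakBVTendsto_chain`). Lower semicontinuity then gives f(2s)
≤ 4 s (1 + s / (1 + c)) M for every finite bound M of f on [√(2 + 2c), 2) (`le_mul_of_lsc`).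
Dividing by t = 2s and letting s tend to 0 gives the constant 2.

The fields are shown to lie in A(Ω) by hand: the variation is bounded through L¹ estimates of
translations on horizontal and vertical slices (`totalVariation_le`), and the divergence vanishes
because the field is a.e. the rotated gradient of a Lipschitz function
(`IsDivergenceFree.of_lipschitz`). -/

/-! ### One-sided traces and jump points -/

theorem isOpen_halfBall (x ν : Plane) (r : ℝ) : IsOpen (halfBall x ν r) :=
  Metric.isOpen_ball.inter (isOpen_lt (f := fun _ : Plane => (0 : ℝ))
    (g := fun y => inner ℝ (y - x) ν) continuous_const (by fun_prop))

theorem halfBall_nonempty (x : Plane) {ν : Plane} (hν : ν ≠ 0) {r : ℝ} (hr : 0 < r) :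
    (halfBall x ν r).Nonempty := by
  have hn : 0 < ‖ν‖ := norm_pos_iff.2 hν
  refine ⟨x + (r / 2 / ‖ν‖) • ν, ?_, ?_⟩
  · rw [Metric.mem_ball, dist_eq_norm, add_sub_cancel_left, norm_smul, Real.norm_of_nonneg
      (by positivity), div_mul_cancel₀ _ hn.ne']
    linarith
  · rw [add_sub_cancel_left, real_inner_smul_left, real_inner_self_eq_norm_sq]
    positivity

theorem volume_halfBall_ne_zero (x : Plane) {ν : Plane} (hν : ν ≠ 0) {r : ℝ} (hr : 0 < r) :
    volume (halfBall x ν r) ≠ 0 :=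
  ((isOpen_halfBall x ν r).measure_pos _ (halfBall_nonempty x hν hr)).ne'

theorem volume_halfBall_ne_top (x ν : Plane) (r : ℝ) : volume (halfBall x ν r) ≠ ⊤ :=
  ((measure_mono fun _ h => h.1).trans_lt measure_ball_lt_top).ne

/-- A field which near `x` takes its values among those of two fields continuous at `x` can have
only their values at `x` as approximate one-sided limits. -/
theorem trace_mem_of_eventually {m A B : Plane → Plane} {x a ν : Plane} (hν : ν ≠ 0)
    (hA : ContinuousAt A x) (hB : ContinuousAt B x) (hm : ∀ᶠ y in 𝓝 x, m y = A y ∨ m y = B y)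
    (h : Tendsto (fun r : ℝ => ⨍⁻ y in halfBall x ν r, ‖m y - a‖ₑ ∂volume) (𝓝[>] 0) (𝓝 0)) :
    a = A x ∨ a = B x := by
  by_contra! hne
  obtain ⟨h1, h2⟩ := hne
  have p1 : 0 < ‖A x - a‖ := norm_pos_iff.2 (sub_ne_zero.2 (Ne.symm h1))
  have p2 : 0 < ‖B x - a‖ := norm_pos_iff.2 (sub_ne_zero.2 (Ne.symm h2))
  -- If `a` differs from both values, ‖m - a‖ exceeds a fixed δ near `x`, and so do its averages,
  -- which therefore cannot tend to 0.
  obtain ⟨δ, hδ, hδ'⟩ := exists_between (lt_min p1 p2)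
  have e1 : ∀ᶠ y in 𝓝 x, δ < ‖A y - a‖ :=
    (hA.sub continuousAt_const).norm.eventually_const_lt (hδ'.trans_le (min_le_left _ _))
  have e2 : ∀ᶠ y in 𝓝 x, δ < ‖B y - a‖ :=
    (hB.sub continuousAt_const).norm.eventually_const_lt (hδ'.trans_le (min_le_right _ _))
  obtain ⟨ρ, hρ, hball⟩ := Metric.eventually_nhds_iff_ball.1 ((hm.and e1).and e2)
  have hlow : ∀ᶠ r in 𝓝[>] (0 : ℝ),
      ENNReal.ofReal δ ≤ ⨍⁻ y in halfBall x ν r, ‖m y - a‖ₑ ∂volume := by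
    filter_upwards [Ioo_mem_nhdsGT hρ] with r hr
    rw [← setLAverage_const (volume_halfBall_ne_zero x hν hr.1) (volume_halfBall_ne_top x ν r)
      (ENNReal.ofReal δ)]
    refine laverage_mono_ae ?_
    filter_upwards [ae_restrict_mem (isOpen_halfBall x ν r).measurableSet] with y hy
    have hy' := hball y (Metric.ball_subset_ball hr.2.le hy.1)
    rw [← ofReal_norm]
    refine ENNReal.ofReal_le_ofReal ?_
    rcases hy'.1.1 with e | e
    · rw [e]; exact hy'.1.2.le
    · rw [e]; exact hy'.2.le
  have := ge_of_tendsto h hlow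
  simp only [nonpos_iff_eq_zero, ENNReal.ofReal_eq_zero] at this
  linarith

/-- Each trace is one of `A x`, `B x`, and the traces differ, so together they exhaust the pair.
This determines the jump size without a uniqueness theorem for the triple of traces and normal. -/
theorem IsJumpPoint.norm_sub_eq {m A B : Plane → Plane} {x a b ν : Plane}
    (h : IsJumpPoint m x a b ν) (hA : ContinuousAt A x) (hB : ContinuousAt B x)
    (hm : ∀ᶠ y in 𝓝 x, m y = A y ∨ m y = B y) :
    ‖a - b‖ = ‖A x - B x‖ := by
  have hν : ν ≠ 0 := by
    rintro rfl
    simpa using h.norm_normal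
  have h1 := trace_mem_of_eventually hν hA hB hm h.tendsto_pos
  have h2 := trace_mem_of_eventually (neg_ne_zero.2 hν) hA hB hm h.tendsto_neg
  have h3 := h.ne
  rcases h1 with h1 | h1 <;> rcases h2 with h2 | h2
  · exact absurd (h1.trans h2.symm) h3
  · rw [h1, h2]
  · rw [h1, h2, norm_sub_rev]
  · exact absurd (h1.trans h2.symm) h3

theorem not_isJumpPoint_of_eventually {m A B : Plane → Plane} {x : Plane}
    (hA : ContinuousAt A x) (hB : ContinuousAt B x) (hAB : A x = B x)
    (hm : ∀ᶠ y in 𝓝 x, m y = A y ∨ m y = B y) : ¬ ∃ a b ν, IsJumpPoint m x a b ν := by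
  rintro ⟨a, b, ν, h⟩
  have := h.norm_sub_eq hA hB hm
  rw [hAB, sub_self, norm_zero, norm_eq_zero, sub_eq_zero] at this
  exact h.ne this

theorem jumpSize_eq {m A B : Plane → Plane} {x : Plane}
    (hA : ContinuousAt A x) (hB : ContinuousAt B x)
    (hm : ∀ᶠ y in 𝓝 x, m y = A y ∨ m y = B y) (h : ∃ a b ν, IsJumpPoint m x a b ν) :
    jumpSize m x = ‖A x - B x‖ := by
  have : {t | ∃ a b ν, IsJumpPoint m x a b ν ∧ t = ‖a - b‖} = {‖A x - B x‖} := by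
    ext t
    constructor
    · rintro ⟨a, b, ν, h, rfl⟩
      exact h.norm_sub_eq hA hB hm
    · rintro rfl
      obtain ⟨a, b, ν, h⟩ := h
      exact ⟨a, b, ν, h, (h.norm_sub_eq hA hB hm).symm⟩
  rw [jumpSize, this, csSup_singleton]

theorem preimage_halfBall (x ν : Plane) {r : ℝ} (hr : 0 < r) :
    (fun z : Plane => x + r • z) ⁻¹' halfBall x ν r = halfBall 0 ν 1 := by
  ext z
  simp only [halfBall, mem_preimage, mem_ofPred_eq, Metric.mem_ball, dist_eq_norm,
    add_sub_cancel_left, sub_zero, norm_smul, Real.norm_of_nonneg hr.le, real_inner_smul_left,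
    mul_pos_iff_of_pos_left hr]
  rw [mul_lt_iff_lt_one_right hr]

theorem lintegral_comp_homothety (F : Plane → ℝ≥0∞) (hF : Measurable F) (x : Plane) {r : ℝ}
    (hr : 0 < r) (S : Set Plane) (hS : MeasurableSet S) :
    ∫⁻ y in S, F y = ENNReal.ofReal (r ^ 2) *
      ∫⁻ z in (fun z : Plane => x + r • z) ⁻¹' S, F (x + r • z) := by
  have hmeas : Measurable fun z : Plane => x + r • z := by fun_prop
  have hmap : Measure.map (fun z : Plane => x + r • z) volume
      = ENNReal.ofReal ((r ^ 2)⁻¹) • (volume : Measure Plane) := by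
    have : (fun z : Plane => x + r • z) = (fun z => x + z) ∘ fun z => r • z := rfl
    rw [this, ← Measure.map_map (by fun_prop) (by fun_prop), Measure.map_addHaar_smul _ hr.ne',
      Measure.map_smul, map_add_left_eq_self]
    simp [abs_of_pos hr]
  have h2 : ∫⁻ z in (fun z : Plane => x + r • z) ⁻¹' S, F (x + r • z)
      = ENNReal.ofReal ((r ^ 2)⁻¹) * ∫⁻ y in S, F y := by
    rw [← setLIntegral_map hS hF hmeas, hmap, Measure.restrict_smul, lintegral_smul_measure,
      smul_eq_mul]
  rw [h2, ← mul_assoc, ← ENNReal.ofReal_mul (by positivity),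
    mul_inv_cancel₀ (by positivity), ENNReal.ofReal_one, one_mul]

/-- Radial limits in all directions of a half plane give an approximate one-sided limit. -/
theorem tendsto_laverage_of_radial {m : Plane → Plane} (hm : Measurable m) {K : ℝ}
    (hK : ∀ y, ‖m y‖ ≤ K) {x a ν : Plane} (hν : ν ≠ 0)
    (h : ∀ z, 0 < inner ℝ z ν → Tendsto (fun r : ℝ => m (x + r • z)) (𝓝[>] 0) (𝓝 a)) :
    Tendsto (fun r : ℝ => ⨍⁻ y in halfBall x ν r, ‖m y - a‖ₑ ∂volume) (𝓝[>] 0) (𝓝 0) := by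
  have h0 := volume_halfBall_ne_zero 0 hν one_pos
  have hT := volume_halfBall_ne_top 0 ν 1
  have hmeas : ∀ c : Plane, Measurable fun y => ‖m y - c‖ₑ := fun c => (hm.sub_const c).enorm
  -- Rescaling turns the averages over shrinking half balls into integrals over one fixed half ball,
  -- where dominated convergence applies.
  have key : ∀ r : ℝ, 0 < r → ⨍⁻ y in halfBall x ν r, ‖m y - a‖ₑ ∂volume
      = (∫⁻ z in halfBall 0 ν 1, ‖m (x + r • z) - a‖ₑ) / volume (halfBall 0 ν 1) := by
    intro r hr
    have hS := (isOpen_halfBall x ν r).measurableSet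
    have e1 := lintegral_comp_homothety _ (hmeas a) x hr _ hS
    have e2 := lintegral_comp_homothety _ (measurable_const (a := (1 : ℝ≥0∞))) x hr _ hS
    rw [preimage_halfBall x ν hr] at e1 e2
    simp only [lintegral_const, one_mul, Measure.restrict_apply_univ] at e2
    rw [setLAverage_eq, e1, e2, ENNReal.mul_div_mul_left]
    · simpa using hr.ne'
    · exact ENNReal.ofReal_ne_top
  have lim : Tendsto (fun r : ℝ => ∫⁻ z in halfBall 0 ν 1, ‖m (x + r • z) - a‖ₑ) (𝓝[>] 0)
      (𝓝 (∫⁻ z in halfBall 0 ν 1, (0 : ℝ≥0∞))) := by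
    refine tendsto_lintegral_filter_of_dominated_convergence (fun _ => ENNReal.ofReal (K + ‖a‖))
      (Eventually.of_forall fun r => ?_) (Eventually.of_forall fun r => ?_) ?_ ?_
    · exact (hmeas a).comp (by fun_prop)
    · refine Eventually.of_forall fun z => ?_
      rw [← ofReal_norm]
      exact ENNReal.ofReal_le_ofReal ((norm_sub_le _ _).trans (by gcongr; exact hK _))
    · rw [setLIntegral_const]
      exact ENNReal.mul_ne_top ENNReal.ofReal_ne_top hT
    · filter_upwards [ae_restrict_mem (isOpen_halfBall 0 ν 1).measurableSet] with z hz
      have := h z (by simpa using hz.2)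
      have h2 := (this.sub_const a).enorm
      simpa using h2
  rw [lintegral_zero] at lim
  have := ENNReal.Tendsto.div_const lim (Or.inr h0)
  rw [ENNReal.zero_div] at this
  refine this.congr' ?_
  filter_upwards [self_mem_nhdsWithin] with r hr
  exact (key r hr).symm

theorem IsJumpPoint.of_radial {m : Plane → Plane} (hm : Measurable m) {K : ℝ}
    (hK : ∀ y, ‖m y‖ ≤ K) {x a b ν : Plane} (hab : a ≠ b) (hν : ‖ν‖ = 1)
    (hpos : ∀ z, 0 < inner ℝ z ν → Tendsto (fun r : ℝ => m (x + r • z)) (𝓝[>] 0) (𝓝 a))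
    (hneg : ∀ z, inner ℝ z ν < 0 → Tendsto (fun r : ℝ => m (x + r • z)) (𝓝[>] 0) (𝓝 b)) :
    IsJumpPoint m x a b ν := by
  have hν0 : ν ≠ 0 := by
    rintro rfl
    simp at hν
  refine ⟨hab, hν, tendsto_laverage_of_radial hm hK hν0 hpos,
    tendsto_laverage_of_radial hm hK (neg_ne_zero.2 hν0) fun z hz => hneg z ?_⟩
  rw [inner_neg_right] at hz
  linarith

/-- If near `x` the field `m` is `A` where `g > 0` and `B` where `g < 0`, for fields `A`, `B`
continuous at `x` and a function `g` with nonzero differential at its zero `x`, then `x` is a jump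
point of `m`. -/
theorem exists_isJumpPoint_of_level {m A B : Plane → Plane} (hm : Measurable m) {K : ℝ}
    (hK : ∀ y, ‖m y‖ ≤ K) {x w : Plane} {g : Plane → ℝ} (hw : w ≠ 0) (hg0 : g x = 0)
    (hg : ∀ z, HasDerivAt (fun r : ℝ => g (x + r • z)) (inner ℝ z w) 0)
    (hA : ContinuousAt A x) (hB : ContinuousAt B x) (hAB : A x ≠ B x)
    (hmA : ∀ᶠ y in 𝓝 x, 0 < g y → m y = A y) (hmB : ∀ᶠ y in 𝓝 x, g y < 0 → m y = B y) :
    ∃ a b ν, IsJumpPoint m x a b ν := by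
  have hn : 0 < ‖w‖ := norm_pos_iff.2 hw
  have cont : ∀ z : Plane, Tendsto (fun r : ℝ => x + r • z) (𝓝[>] 0) (𝓝 x) := by
    intro z
    have : Continuous fun r : ℝ => x + r • z := by fun_prop
    have h := this.tendsto 0
    simp only [zero_smul, add_zero] at h
    exact h.mono_left nhdsWithin_le_nhds
  refine ⟨A x, B x, ‖w‖⁻¹ • w, IsJumpPoint.of_radial hm hK hAB ?_ ?_ ?_⟩
  · rw [norm_smul, norm_inv, norm_norm, inv_mul_cancel₀ hn.ne']
  · intro z hz
    rw [real_inner_smul_right, mul_pos_iff_of_pos_left (by positivity)] at hz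
    refine (hA.tendsto.comp (cont z)).congr' ?_
    -- Along the ray in direction `z` the function `g` starts at 0 with positive slope, so the ray
    -- stays in {g > 0} for small `r`.
    have h1 := (hg z).tendsto_slope_zero_right.eventually_const_lt hz
    filter_upwards [h1, (cont z).eventually hmA, self_mem_nhdsWithin] with r hr hr2 (hr0 : 0 < r)
    simp only [zero_add, zero_smul, add_zero, hg0, sub_zero, smul_eq_mul] at hr
    rw [mul_pos_iff_of_pos_left (by positivity)] at hr
    exact (hr2 hr).symm
  · intro z hz
    have hz : inner ℝ z w < 0 := by
      rw [real_inner_smul_right] at hz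
      exact (pos_iff_neg_of_mul_neg hz).1 (by positivity)
    refine (hB.tendsto.comp (cont z)).congr' ?_
    have h1 := (hg z).tendsto_slope_zero_right.eventually_lt_const hz
    filter_upwards [h1, (cont z).eventually hmB, self_mem_nhdsWithin] with r hr hr2 (hr0 : 0 < r)
    simp only [zero_add, zero_smul, add_zero, hg0, sub_zero, smul_eq_mul] at hr
    exact (hr2 ((pos_iff_neg_of_mul_neg hr).1 (by positivity))).symm

/-! ### Translation estimates on the line -/

/-- A translation by `h` changes membership in an interval only near an endpoint: two points leaving
(or two entering) `S` are at distance at most `h`, so each set has diameter at most `h`. -/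
theorem volume_translate_diff_le {S : Set ℝ} (hS : S.OrdConnected) {h : ℝ}
    (hh : 0 < h) :
    volume {x | x ∈ S ∧ x + h ∉ S} ≤ ENNReal.ofReal h ∧
      volume {x | x ∉ S ∧ x + h ∈ S} ≤ ENNReal.ofReal h := by
  constructor
  · refine (Real.volume_le_diam _).trans (Metric.ediam_le ?_)
    have key : ∀ x y : ℝ, x ∈ S → y ∈ S → x + h ∉ S → y - x ≤ h := by
      intro x y hx hy hxh
      by_contra! hlt
      exact hxh (hS.out hx hy ⟨by linarith, by linarith⟩)
    rintro x ⟨hx, hx'⟩ y ⟨hy, hy'⟩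
    rw [edist_dist, Real.dist_eq]
    exact ENNReal.ofReal_le_ofReal (abs_le.2 ⟨by linarith [key x y hx hy hx'], key y x hy hx hy'⟩)
  · refine (Real.volume_le_diam _).trans (Metric.ediam_le ?_)
    have key : ∀ x y : ℝ, y ∉ S → x + h ∈ S → y + h ∈ S → y - x ≤ h := by
      intro x y hy hx hy'
      by_contra! hlt
      exact hy (hS.out hx hy' ⟨by linarith, by linarith⟩)
    rintro x ⟨hx, hx'⟩ y ⟨hy, hy'⟩
    rw [edist_dist, Real.dist_eq]
    exact ENNReal.ofReal_le_ofReal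
      (abs_le.2 ⟨by linarith [key x y hy hx' hy'], key y x hx hy' hx'⟩)

/-- `g` is measurable and its translations satisfy `∫ |g (x + h) - g x| dx ≤ C h`. -/
structure TransVar (g : ℝ → ℝ) (C : ℝ) : Prop where
  measurable : Measurable g
  bound : ∀ h, 0 < h → ∫⁻ x, ‖g (x + h) - g x‖ₑ ≤ ENNReal.ofReal (C * h)

namespace TransVar

theorem const (a : ℝ) : TransVar (fun _ => a) 0 :=
  ⟨measurable_const, fun h _ => by simp⟩

theorem mono {g : ℝ → ℝ} {C D : ℝ} (hg : TransVar g C) (h : C ≤ D) : TransVar g D :=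
  ⟨hg.1, fun h' hh => (hg.2 h' hh).trans (ENNReal.ofReal_le_ofReal (by gcongr))⟩

theorem neg {g : ℝ → ℝ} {C : ℝ} (hg : TransVar g C) : TransVar (fun x => -g x) C :=
  ⟨hg.1.neg, fun h hh => by
    refine le_trans (le_of_eq (lintegral_congr fun x => ?_)) (hg.2 h hh)
    rw [← enorm_neg]; congr 1; ring⟩

theorem add {f g : ℝ → ℝ} {C D : ℝ} (hC : 0 ≤ C) (hD : 0 ≤ D) (hf : TransVar f C)
    (hg : TransVar g D) : TransVar (fun x => f x + g x) (C + D) :=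
  ⟨hf.1.add hg.1, fun h hh => by
    calc ∫⁻ x, ‖f (x + h) + g (x + h) - (f x + g x)‖ₑ
        ≤ ∫⁻ x, (‖f (x + h) - f x‖ₑ + ‖g (x + h) - g x‖ₑ) := by
          refine lintegral_mono fun x => ?_
          rw [add_sub_add_comm]
          exact enorm_add_le _ _
      _ = (∫⁻ x, ‖f (x + h) - f x‖ₑ) + ∫⁻ x, ‖g (x + h) - g x‖ₑ :=
          lintegral_add_left (((hf.1.comp (measurable_add_const h)).sub hf.1).enorm) _
      _ ≤ ENNReal.ofReal ((C + D) * h) := by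
          rw [add_mul, ENNReal.ofReal_add (by positivity) (by positivity)]
          exact add_le_add (hf.2 h hh) (hg.2 h hh)⟩

/-- The integrand has a sign, so its integral over [-n, n] telescopes to two integrals of `g` over
intervals of length `h` at the ends, each at most `B * h`. -/
theorem of_monotone {g : ℝ → ℝ} (hg : Monotone g) {B : ℝ} (hB : ∀ x, |g x| ≤ B) :
    TransVar g (2 * B) := by
  refine ⟨hg.measurable, fun h hh => ?_⟩
  have hint : ∀ a b, IntervalIntegrable g volume a b := fun a b => hg.intervalIntegrable
  have hg' : Monotone fun x => g (x + h) := fun x y hxy => hg (by linarith)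
  have hint' : ∀ a b, IntervalIntegrable (fun x => g (x + h)) volume a b :=
    fun a b => hg'.intervalIntegrable
  have hcov : AECover (volume : Measure ℝ) atTop fun n : ℕ => Ioc (-(n : ℝ)) n :=
    aecover_Ioc (tendsto_neg_atTop_atBot.comp tendsto_natCast_atTop_atTop)
      tendsto_natCast_atTop_atTop
  have hlim := hcov.lintegral_tendsto_of_countably_generated
    (f := fun x => ‖g (x + h) - g x‖ₑ)
    ((hg'.measurable.sub hg.measurable).enorm.aemeasurable)
  refine le_of_tendsto' hlim fun n => ?_
  have hn : (-(n : ℝ)) ≤ n := by linarith [(Nat.cast_nonneg n : (0 : ℝ) ≤ n)]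
  have e : ∫⁻ x in Ioc (-(n : ℝ)) n, ‖g (x + h) - g x‖ₑ
      = ENNReal.ofReal (∫ x in (-(n : ℝ))..n, (g (x + h) - g x)) := by
    rw [intervalIntegral.integral_of_le hn, ofReal_integral_eq_lintegral_ofReal]
    · refine lintegral_congr fun x => ?_
      rw [Real.enorm_eq_ofReal]
      exact sub_nonneg.2 (hg (by linarith))
    · exact ((hint' _ _).sub (hint _ _)).1
    · exact Eventually.of_forall fun x => sub_nonneg.2 (hg (by linarith))
  rw [e]
  refine ENNReal.ofReal_le_ofReal ?_
  rw [intervalIntegral.integral_sub (hint' _ _) (hint _ _),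
    intervalIntegral.integral_comp_add_right,
    intervalIntegral.integral_interval_sub_interval_comm (hint _ _) (hint _ _) (hint _ _),
    intervalIntegral.integral_symm]
  have b1 : ∀ a, |∫ x in a..(a + h), g x| ≤ B * h := by
    intro a
    have := intervalIntegral.norm_integral_le_of_norm_le_const (a := a) (b := a + h) (f := g)
      (C := B) fun x _ => hB x
    simpa [abs_of_pos hh] using this
  have h1 := abs_le.1 (b1 (-n))
  have h2 := abs_le.1 (b1 n)
  rw [intervalIntegral.integral_symm (n : ℝ)]
  linarith [h1.1, h2.2]

theorem of_antitone {g : ℝ → ℝ} (hg : Antitone g) {B : ℝ} (hB : ∀ x, |g x| ≤ B) :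
    TransVar g (2 * B) := by
  have := (of_monotone hg.neg (B := B) fun x => by simpa using hB x).neg
  simpa using this

theorem of_monotoneOn_antitoneOn {g : ℝ → ℝ} {a : ℝ} (h1 : MonotoneOn g (Iic a))
    (h2 : AntitoneOn g (Ici a)) {B : ℝ} (hB : ∀ x, |g x| ≤ B) : TransVar g (4 * B) := by
  have hB0 : 0 ≤ B := (abs_nonneg _).trans (hB 0)
  -- A unimodal function splits as g(min x a) + g(max x a) - g(a), a monotone term plus an antitone
  -- term plus a constant.
  have m1 : Monotone fun x => g (min x a) := fun x y hxy =>
    h1 (mem_Iic.2 (min_le_right x a)) (mem_Iic.2 (min_le_right y a)) (min_le_min_right a hxy)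
  have m2 : Antitone fun x => g (max x a) := fun x y hxy =>
    h2 (mem_Ici.2 (le_max_right x a)) (mem_Ici.2 (le_max_right y a)) (max_le_max_right a hxy)
  have := ((of_monotone m1 fun x => hB _).add (by positivity) (by positivity)
    (of_antitone m2 fun x => hB _)).add (by positivity) le_rfl (const (-g a))
  have e : (fun x => g (min x a) + g (max x a) + -g a) = g := by
    ext x
    rcases le_total x a with h | h
    · simp [h]
    · simp [h]
  rw [e] at this
  exact this.mono (by linarith)

-- Switching between two functions on an interval costs at most 2B on each of the two sets of
-- measure at most `h` where a translation crosses an endpoint; this is the term `4 * B`. Iterated,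
-- it handles the piecewise defined slices of the kite fields.
open Classical in
theorem ite {f g : ℝ → ℝ} {C D B : ℝ} (hC : 0 ≤ C) (hD : 0 ≤ D) (hf : TransVar f C)
    (hg : TransVar g D) (hfB : ∀ x, |f x| ≤ B) (hgB : ∀ x, |g x| ≤ B) {S : Set ℝ}
    (hS : S.OrdConnected) :
    TransVar (fun x => if x ∈ S then f x else g x) (C + D + 4 * B) := by
  have hB0 : 0 ≤ B := (abs_nonneg _).trans (hfB 0)
  have hSm : MeasurableSet S := hS.measurableSet
  refine ⟨Measurable.ite hSm hf.1 hg.1, fun h hh => ?_⟩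
  have hmt : Measurable fun x : ℝ => x + h := measurable_add_const h
  have hm1 : MeasurableSet {x | x ∈ S ∧ x + h ∉ S} := hSm.inter (hmt hSm).compl
  have hm2 : MeasurableSet {x | x ∉ S ∧ x + h ∈ S} := hSm.compl.inter (hmt hSm)
  calc ∫⁻ x, ‖(if x + h ∈ S then f (x + h) else g (x + h)) - (if x ∈ S then f x else g x)‖ₑ
      ≤ ∫⁻ x, ((‖f (x + h) - f x‖ₑ + ‖g (x + h) - g x‖ₑ) +
          (({x | x ∈ S ∧ x + h ∉ S}.indicator (fun _ => ENNReal.ofReal (2 * B)) x) +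
          ({x | x ∉ S ∧ x + h ∈ S}.indicator (fun _ => ENNReal.ofReal (2 * B)) x))) := by
        refine lintegral_mono fun x => ?_
        have hcr : ∀ u v : ℝ, |u| ≤ B → |v| ≤ B → ‖u - v‖ₑ ≤ ENNReal.ofReal (2 * B) := by
          intro u v hu hv
          rw [← ofReal_norm, Real.norm_eq_abs]
          exact ENNReal.ofReal_le_ofReal ((abs_sub _ _).trans (by linarith))
        by_cases h1 : x ∈ S <;> by_cases h2 : x + h ∈ S
        · simp only [h1, h2, if_true]
          exact le_self_add.trans le_self_add
        · simp only [h1, h2, if_true, if_false]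
          rw [indicator_of_mem (show x ∈ {x | x ∈ S ∧ x + h ∉ S} from ⟨h1, h2⟩)]
          exact (hcr _ _ (hgB _) (hfB _)).trans (le_self_add.trans le_add_self)
        · simp only [h1, h2, if_true, if_false]
          rw [indicator_of_mem (show x ∈ {x | x ∉ S ∧ x + h ∈ S} from ⟨h1, h2⟩)]
          exact (hcr _ _ (hfB _) (hgB _)).trans (le_add_self.trans le_add_self)
        · simp only [h1, h2, if_false]
          exact le_add_self.trans le_self_add
    _ = (∫⁻ x, ‖f (x + h) - f x‖ₑ) + (∫⁻ x, ‖g (x + h) - g x‖ₑ) +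
          (ENNReal.ofReal (2 * B) * volume {x | x ∈ S ∧ x + h ∉ S} +
            ENNReal.ofReal (2 * B) * volume {x | x ∉ S ∧ x + h ∈ S}) := by
        have mf : Measurable fun x => ‖f (x + h) - f x‖ₑ := ((hf.1.comp hmt).sub hf.1).enorm
        have mg : Measurable fun x => ‖g (x + h) - g x‖ₑ := ((hg.1.comp hmt).sub hg.1).enorm
        rw [lintegral_add_left (f := fun x => ‖f (x + h) - f x‖ₑ + ‖g (x + h) - g x‖ₑ) (mf.add mg),
          lintegral_add_left mf,
          lintegral_add_left (measurable_const.indicator hm1), lintegral_indicator_const hm1,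
          lintegral_indicator_const hm2]
    _ ≤ ENNReal.ofReal (C * h) + ENNReal.ofReal (D * h) +
          (ENNReal.ofReal (2 * B) * ENNReal.ofReal h +
            ENNReal.ofReal (2 * B) * ENNReal.ofReal h) := by
        have := volume_translate_diff_le hS hh
        gcongr
        · exact hf.2 h hh
        · exact hg.2 h hh
        · exact this.1
        · exact this.2
    _ = ENNReal.ofReal ((C + D + 4 * B) * h) := by
        rw [← ENNReal.ofReal_mul (by positivity), ← ENNReal.ofReal_add (by positivity)
          (by positivity), ← ENNReal.ofReal_add (by positivity) (by positivity),
          ← ENNReal.ofReal_add (by positivity) (by positivity)]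
        congr 1
        ring

end TransVar

/-! ### Slicing the plane and bounding the total variation -/

theorem measurePreserving_coords :
    MeasurePreserving (fun z : ℝ × ℝ => (!₂[z.1, z.2] : Plane)) := by
  have h := (PiLp.volume_preserving_toLp (Fin 2)).comp (volume_preserving_finTwoArrow ℝ).symm
  have e : (fun z : ℝ × ℝ => (!₂[z.1, z.2] : Plane))
      = (WithLp.toLp 2) ∘ (MeasurableEquiv.finTwoArrow (α := ℝ)).symm := by
    ext z i
    fin_cases i <;> rfl
  rw [e]
  exact h

theorem lintegral_eq_rows {F : Plane → ℝ≥0∞} (hF : Measurable F) :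
    ∫⁻ p, F p = ∫⁻ y : ℝ, ∫⁻ x : ℝ, F !₂[x, y] := by
  rw [← measurePreserving_coords.lintegral_comp hF, Measure.volume_eq_prod,
    lintegral_prod_symm' (fun z : ℝ × ℝ => F !₂[z.1, z.2])
      (hF.comp measurePreserving_coords.measurable)]

theorem lintegral_eq_columns {F : Plane → ℝ≥0∞} (hF : Measurable F) :
    ∫⁻ p, F p = ∫⁻ x : ℝ, ∫⁻ y : ℝ, F !₂[x, y] := by
  rw [← measurePreserving_coords.lintegral_comp hF, Measure.volume_eq_prod,
    lintegral_prod (fun z : ℝ × ℝ => F !₂[z.1, z.2])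
      (hF.comp measurePreserving_coords.measurable).aemeasurable]

/-- The derivative of the test function is a limit of difference quotients, and a change of
variables moves each quotient onto `G`. The translation bound is needed only on the support of `φ`,
which matters because the fields here are not integrable on the whole plane. -/
theorem integral_mul_lineDeriv_le {G φ : Plane → ℝ} (hG : Measurable G) {B : ℝ}
    (hB : ∀ p, |G p| ≤ B) (hφ : ContDiff ℝ 1 φ) (hφc : HasCompactSupport φ)
    (hφ1 : ∀ p, |φ p| ≤ 1) (v : Plane) {C : ℝ} (hC : 0 ≤ C)
    (h : ∀ h : ℝ, 0 < h → ∫⁻ p in tsupport φ, ‖G (p - h • v) - G p‖ₑ ≤ ENNReal.ofReal (C * h)) :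
    ∫ p, G p * fderiv ℝ φ p v ≤ C := by
  obtain ⟨K, hK⟩ := hφ.lipschitzWith_of_hasCompactSupport hφc one_ne_zero
  have hφint : Integrable φ := hφ.continuous.integrable_of_hasCompactSupport hφc
  have hGφ : Integrable fun p => G p * φ p := hφint.bdd_mul hG.aestronglyMeasurable
    (Eventually.of_forall hB)
  have hGφ' : ∀ t : ℝ, Integrable fun p => G p * φ (p + t • v) := fun t =>
    (hφint.comp_add_right (t • v)).bdd_mul hG.aestronglyMeasurable (Eventually.of_forall hB)
  have lim : Tendsto (fun t : ℝ => ∫ p, G p * (t⁻¹ • (φ (p + t • v) - φ p))) (𝓝[>] 0)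
      (𝓝 (∫ p, G p * fderiv ℝ φ p v)) := by
    -- For 0 < t ≤ 1 all difference quotients vanish outside this compact set and are bounded by the
    -- Lipschitz constant of `φ` times ‖v‖, which yields a dominating function.
    let S := Metric.cthickening ‖v‖ (tsupport φ)
    have hS : IsCompact S := IsCompact.cthickening hφc
    refine tendsto_integral_filter_of_dominated_convergence
      (S.indicator fun _ => B * (K * ‖v‖)) (Eventually.of_forall fun t => ?_) ?_ ?_ ?_
    · exact hG.aestronglyMeasurable.mul (by
        have := hφ.continuous
        exact Continuous.aestronglyMeasurable (by fun_prop))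
    · filter_upwards [Ioc_mem_nhdsGT zero_lt_one] with t ht
      have t_pos : 0 < t := ht.1
      refine Eventually.of_forall fun p => ?_
      by_cases hp : p ∈ S
      · rw [indicator_of_mem hp, norm_mul]
        have h1 : ‖t⁻¹ • (φ (p + t • v) - φ p)‖ ≤ K * ‖v‖ := by
          rw [norm_smul, norm_inv, Real.norm_of_nonneg t_pos.le, inv_mul_le_iff₀ t_pos]
          refine (hK.norm_sub_le _ _).trans (le_of_eq ?_)
          rw [add_sub_cancel_left, norm_smul, Real.norm_of_nonneg t_pos.le]
          ring
        exact mul_le_mul (hB p) h1 (norm_nonneg _) ((abs_nonneg _).trans (hB p))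
      · have e1 : φ p = 0 := by
          rw [← Function.notMem_support]
          contrapose hp
          exact Metric.self_subset_cthickening _ (subset_tsupport _ hp)
        have e2 : φ (p + t • v) = 0 := by
          rw [← Function.notMem_support]
          contrapose hp
          refine Metric.mem_cthickening_of_dist_le _ _ _ (tsupport φ) (subset_tsupport _ hp) ?_
          rw [dist_eq_norm, sub_add_cancel_left, norm_neg, norm_smul,
            Real.norm_of_nonneg t_pos.le]
          exact mul_le_of_le_one_left (norm_nonneg v) ht.2
        simp [e1, e2, hp]
    · rw [integrable_indicator_iff hS.measurableSet]
      exact integrableOn_const hS.measure_lt_top.ne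
    · refine Eventually.of_forall fun p => ?_
      have hd := (hφ.differentiable one_ne_zero p).hasFDerivAt.hasLineDerivAt v
      exact (hd.tendsto_slope_zero_right).const_mul _
  refine le_of_tendsto lim ?_
  filter_upwards [self_mem_nhdsWithin] with t (ht : 0 < t)
  have e1 : ∫ p, G p * (t⁻¹ • (φ (p + t • v) - φ p))
      = t⁻¹ * ∫ p, (G (p - t • v) - G p) * φ p := by
    have : ∀ p, G p * (t⁻¹ • (φ (p + t • v) - φ p))
        = t⁻¹ * (G p * φ (p + t • v) - G p * φ p) := fun p => by
      rw [smul_eq_mul]; ring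
    simp_rw [this, integral_const_mul, sub_mul]
    have hsh : Integrable fun p => G (p - t • v) * φ p := by
      have := (hGφ' t).comp_sub_right (t • v)
      simpa using this
    rw [integral_sub (hGφ' t) hGφ, integral_sub hsh hGφ]
    congr 2
    rw [← integral_sub_right_eq_self _ (t • v)]
    simp
  rw [e1, inv_mul_le_iff₀ ht]
  refine (le_abs_self _).trans ?_
  rw [← Real.norm_eq_abs]
  have h2 : ‖∫ p, (G (p - t • v) - G p) * φ p‖ₑ ≤ ENNReal.ofReal (C * t) := by
    refine (enorm_integral_le_lintegral_enorm _).trans (le_trans ?_ (h t ht))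
    rw [← lintegral_indicator (isClosed_tsupport φ).measurableSet]
    refine lintegral_mono fun p => ?_
    by_cases hp : p ∈ tsupport φ
    · rw [indicator_of_mem hp, enorm_mul]
      refine mul_le_of_le_one_right' ?_
      rw [← ofReal_norm, ← ENNReal.ofReal_one]
      exact ENNReal.ofReal_le_ofReal (hφ1 p)
    · simp [image_eq_zero_of_notMem_tsupport hp]
  rw [← ofReal_norm, ENNReal.ofReal_le_ofReal_iff (by positivity)] at h2
  linarith [mul_comm C t]

/-- Fubini over rows. The set `A` collects the ordinates of the rows that contribute; its measure
brings in the size of the kite, respectively of the domain. -/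
theorem lintegral_translate_rows_le {G : Plane → ℝ} (hG : Measurable G) {C : ℝ}
    (hrow : ∀ y, TransVar (fun x => G !₂[x, y]) C) {T : Set Plane} (hT : MeasurableSet T)
    {A : Set ℝ} (hA : MeasurableSet A)
    (hTA : ∀ x y h, y ∉ A → !₂[x, y] ∈ T → G !₂[x - h, y] = G !₂[x, y]) {h : ℝ} (hh : 0 < h) :
    ∫⁻ p in T, ‖G (p - h • EuclideanSpace.single 0 1) - G p‖ₑ
      ≤ ENNReal.ofReal (C * h) * volume A := by
  have hm : Measurable fun p => ‖G (p - h • EuclideanSpace.single 0 1) - G p‖ₑ :=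
    ((hG.comp (measurable_id.sub_const _)).sub hG).enorm
  rw [← lintegral_indicator hT, lintegral_eq_rows (hm.indicator hT), ← setLIntegral_const,
    ← lintegral_indicator hA]
  refine lintegral_mono fun y => ?_
  have e : ∀ x : ℝ, (!₂[x, y] : Plane) - h • EuclideanSpace.single 0 1 = !₂[x - h, y] := by
    intro x
    ext i
    fin_cases i <;> simp
  by_cases hy : y ∈ A
  · rw [indicator_of_mem hy]
    calc ∫⁻ x : ℝ, T.indicator (fun p => ‖G (p - h • EuclideanSpace.single 0 1) - G p‖ₑ) !₂[x, y]
        ≤ ∫⁻ x : ℝ, ‖G !₂[x - h, y] - G !₂[x, y]‖ₑ := by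
          refine lintegral_mono fun x => ?_
          refine (indicator_le_self _ _ _).trans ?_
          rw [e]
      _ = ∫⁻ x : ℝ, ‖G !₂[x + h, y] - G !₂[x, y]‖ₑ := by
          rw [← lintegral_add_right_eq_self _ h]
          refine lintegral_congr fun x => ?_
          rw [add_sub_cancel_right, ← enorm_neg, neg_sub]
      _ ≤ _ := (hrow y).2 h hh
  · rw [indicator_of_notMem hy]
    refine le_of_eq ((lintegral_congr fun x => ?_).trans lintegral_zero)
    by_cases hx : (!₂[x, y] : Plane) ∈ T
    · rw [indicator_of_mem hx, e, hTA x y h hy hx, sub_self, enorm_zero]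
    · rw [indicator_of_notMem hx]

theorem lintegral_translate_columns_le {G : Plane → ℝ} (hG : Measurable G) {C : ℝ}
    (hcol : ∀ x, TransVar (fun y => G !₂[x, y]) C) {T : Set Plane} (hT : MeasurableSet T)
    {A : Set ℝ} (hA : MeasurableSet A)
    (hTA : ∀ x y h, x ∉ A → !₂[x, y] ∈ T → G !₂[x, y - h] = G !₂[x, y]) {h : ℝ} (hh : 0 < h) :
    ∫⁻ p in T, ‖G (p - h • EuclideanSpace.single 1 1) - G p‖ₑ
      ≤ ENNReal.ofReal (C * h) * volume A := by
  have hm : Measurable fun p => ‖G (p - h • EuclideanSpace.single 1 1) - G p‖ₑ :=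
    ((hG.comp (measurable_id.sub_const _)).sub hG).enorm
  rw [← lintegral_indicator hT, lintegral_eq_columns (hm.indicator hT), ← setLIntegral_const,
    ← lintegral_indicator hA]
  refine lintegral_mono fun x => ?_
  have e : ∀ y : ℝ, (!₂[x, y] : Plane) - h • EuclideanSpace.single 1 1 = !₂[x, y - h] := by
    intro y
    ext i
    fin_cases i <;> simp
  by_cases hx : x ∈ A
  · rw [indicator_of_mem hx]
    calc ∫⁻ y : ℝ, T.indicator (fun p => ‖G (p - h • EuclideanSpace.single 1 1) - G p‖ₑ) !₂[x, y]
        ≤ ∫⁻ y : ℝ, ‖G !₂[x, y - h] - G !₂[x, y]‖ₑ := by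
          refine lintegral_mono fun y => ?_
          refine (indicator_le_self _ _ _).trans ?_
          rw [e]
      _ = ∫⁻ y : ℝ, ‖G !₂[x, y + h] - G !₂[x, y]‖ₑ := by
          rw [← lintegral_add_right_eq_self _ h]
          refine lintegral_congr fun y => ?_
          rw [add_sub_cancel_right, ← enorm_neg, neg_sub]
      _ ≤ _ := (hcol x).2 h hh
  · rw [indicator_of_notMem hx]
    refine le_of_eq ((lintegral_congr fun y => ?_).trans lintegral_zero)
    by_cases hy : (!₂[x, y] : Plane) ∈ T
    · rw [indicator_of_mem hy, e, hTA x y h hx hy, sub_self, enorm_zero]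
    · rw [indicator_of_notMem hy]

/-- `G` is measurable and its translations along both axes satisfy
`∫_T |G (p - h eⱼ) - G p| dp ≤ D h`. -/
structure TransBound (T : Set Plane) (G : Plane → ℝ) (D : ℝ) : Prop where
  measurable : Measurable G
  bound : ∀ (j : Fin 2) (h : ℝ), 0 < h →
    ∫⁻ p in T, ‖G (p - h • EuclideanSpace.single j 1) - G p‖ₑ ≤ ENNReal.ofReal (D * h)

theorem TransBound.mono {T : Set Plane} {G : Plane → ℝ} {D E : ℝ} (hG : TransBound T G D)
    (h : D ≤ E) : TransBound T G E :=
  ⟨hG.1, fun j t ht => (hG.2 j t ht).trans (ENNReal.ofReal_le_ofReal (by gcongr))⟩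

theorem TransBound.add {T : Set Plane} {F G : Plane → ℝ} {C D : ℝ} (hC : 0 ≤ C) (hD : 0 ≤ D)
    (hF : TransBound T F C) (hG : TransBound T G D) :
    TransBound T (fun p => F p + G p) (C + D) :=
  ⟨hF.1.add hG.1, fun j h hh => by
    calc ∫⁻ p in T, ‖F (p - h • EuclideanSpace.single j 1) + G (p - h • EuclideanSpace.single j 1)
          - (F p + G p)‖ₑ
        ≤ ∫⁻ p in T, (‖F (p - h • EuclideanSpace.single j 1) - F p‖ₑ
            + ‖G (p - h • EuclideanSpace.single j 1) - G p‖ₑ) := by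
          refine lintegral_mono fun x => ?_
          rw [add_sub_add_comm]
          exact enorm_add_le _ _
      _ = _ := lintegral_add_left
          (((hF.1.comp (measurable_id.sub_const _)).sub hF.1).enorm) _
      _ ≤ ENNReal.ofReal ((C + D) * h) := by
          rw [add_mul, ENNReal.ofReal_add (by positivity) (by positivity)]
          exact add_le_add (hF.2 j h hh) (hG.2 j h hh)⟩

theorem TransBound.sum {T : Set Plane} {G : ℕ → Plane → ℝ} {D : ℝ} (hD : 0 ≤ D)
    (hG : ∀ k, TransBound T (G k) D) (N : ℕ) :
    TransBound T (fun p => ∑ k ∈ Finset.range N, G k p) (N * D) := by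
  induction N with
  | zero => exact ⟨by simp, fun j h _ => by simp⟩
  | succ n ih =>
    have := ih.add (by positivity) hD (hG n)
    simp only [Finset.sum_range_succ]
    exact this.mono (by push_cast; linarith)

theorem divergence_eq {φ : Plane → Plane} (hφ : ContDiff ℝ 1 φ) (p : Plane) :
    divergence φ p = ∑ j : Fin 2, fderiv ℝ (fun q => φ q j) p (EuclideanSpace.single j 1) := by
  refine Finset.sum_congr rfl fun j _ => ?_
  have h := (hφ.differentiable one_ne_zero p).hasFDerivAt
  have h2 := (EuclideanSpace.proj (𝕜 := ℝ) j).hasFDerivAt.comp p h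
  have h3 : HasFDerivAt (fun q => φ q j) ((EuclideanSpace.proj (𝕜 := ℝ) j).comp (fderiv ℝ φ p)) p :=
    h2
  rw [h3.fderiv]
  rfl

/-- The pairing with a test field is a sum of four terms, one for each component and each axis, and
the entries of a test field are at most 1 in absolute value; hence the factor 4. -/
theorem totalVariation_le {Ω T : Set Plane} (hΩ : Ω ⊆ T) {m : Plane → Plane} {B : ℝ}
    (hB : ∀ i p, |m p i| ≤ B) {D : ℝ} (hD : 0 ≤ D)
    (h : ∀ i, TransBound T (fun p => m p i) D) :
    totalVariation Ω m ≤ ENNReal.ofReal (4 * D) := by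
  refine iSup₂_le fun φ hφ => ENNReal.ofReal_le_ofReal ?_
  have key : ∀ i j : Fin 2,
      ∫ p, m p i * fderiv ℝ (fun q => φ i q j) p (EuclideanSpace.single j 1) ≤ D := by
    intro i j
    have hsub : tsupport (fun q => φ i q j) ⊆ tsupport (φ i) :=
      closure_mono fun q hq hq0 => hq (by simp [hq0])
    refine integral_mul_lineDeriv_le (h i).1 (hB i) ?_ ?_ ?_ _ hD fun t ht => ?_
    · have h1 := hφ.contDiff i
      fun_prop
    · exact (hφ.hasCompactSupport i).mono' ((subset_tsupport _).trans hsub)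
    · intro p
      have h1 := hφ.norm_le_one p
      have h2 : ‖φ i p‖ ^ 2 ≤ 1 :=
        (Finset.single_le_sum (f := fun i => ‖φ i p‖ ^ 2) (fun _ _ => by positivity)
          (Finset.mem_univ i)).trans h1
      have h3 : ‖φ i p‖ ≤ 1 := by
        rw [← sq_le_one_iff₀ (norm_nonneg _)]; exact h2
      exact (PiLp.norm_apply_le (φ i p) j).trans h3
    · exact (lintegral_mono_set (hsub.trans ((hφ.tsupport_subset i).trans hΩ))).trans
        ((h i).2 j t ht)
  have hint : ∀ i j : Fin 2,
      Integrable fun p => m p i * fderiv ℝ (fun q => φ i q j) p (EuclideanSpace.single j 1) := by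
    intro i j
    have h1 := hφ.contDiff i
    have h2 : ContDiff ℝ 1 fun q => φ i q j := by fun_prop
    have h3 : HasCompactSupport fun q => φ i q j :=
      (hφ.hasCompactSupport i).comp_left (g := fun v : Plane => v j) (by simp)
    have h4 : Integrable fun p => fderiv ℝ (fun q => φ i q j) p (EuclideanSpace.single j 1) := by
      refine Continuous.integrable_of_hasCompactSupport ?_ ?_
      · exact (h2.continuous_fderiv one_ne_zero).clm_apply continuous_const
      · exact (h3.fderiv (𝕜 := ℝ)).comp_left
          (g := fun l : Plane →L[ℝ] ℝ => l (EuclideanSpace.single j 1)) rfl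
    exact h4.bdd_mul (h i).1.aestronglyMeasurable (Eventually.of_forall (hB i))
  have e : ∀ i, ∫ p in Ω, m p i * divergence (φ i) p
      = ∑ j : Fin 2, ∫ p, m p i * fderiv ℝ (fun q => φ i q j) p (EuclideanSpace.single j 1) := by
    intro i
    rw [← integral_finsetSum _ fun j _ => hint i j, setIntegral_eq_integral_of_forall_compl_eq_zero]
    · refine integral_congr_ae (Eventually.of_forall fun p => ?_)
      simp only [divergence_eq (hφ.contDiff i), Finset.mul_sum]
    · intro p hp
      have hz : fderiv ℝ (φ i) p = 0 := by
        have : p ∉ tsupport (fderiv ℝ (φ i)) := fun hc =>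
          hp (hφ.tsupport_subset i (tsupport_fderiv_subset ℝ hc))
        exact image_eq_zero_of_notMem_tsupport this
      simp [divergence, hz]
  simp_rw [e, Fin.sum_univ_two]
  linarith [key 0 0, key 0 1, key 1 0, key 1 1]

/-! ### Lipschitz stream functions and vanishing divergence -/

theorem integral_lineDeriv_mul_fderiv {u φ : Plane → ℝ} {K : NNReal} (hu : LipschitzWith K u)
    (hφ : ContDiff ℝ ∞ φ) (hφc : HasCompactSupport φ) (v w : Plane) :
    ∫ p, lineDeriv ℝ u p v * fderiv ℝ φ p w = -∫ p, fderiv ℝ (fderiv ℝ φ) p v w * u p := by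
  have hd : ContDiff ℝ ∞ (fderiv ℝ φ) := hφ.fderiv_right (by norm_cast)
  have hg : ContDiff ℝ ∞ fun p => fderiv ℝ φ p w := hd.clm_apply contDiff_const
  have hgc : HasCompactSupport fun p => fderiv ℝ φ p w :=
    (hφc.fderiv (𝕜 := ℝ)).comp_left (g := fun l : Plane →L[ℝ] ℝ => l w) rfl
  obtain ⟨D, hD⟩ := hg.lipschitzWith_of_hasCompactSupport hgc (by simp)
  rw [hu.integral_lineDeriv_mul_eq hD hgc v, ← integral_neg]
  refine integral_congr_ae (Eventually.of_forall fun p => ?_)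
  have h1 : HasFDerivAt (fderiv ℝ φ) (fderiv ℝ (fderiv ℝ φ) p) p :=
    (hd.differentiable (by simp) p).hasFDerivAt
  have h2 := (h1.clm_apply (hasFDerivAt_const w p)).hasLineDerivAt (-v)
  have h3 := h2.lineDeriv
  simp only [] at h3 ⊢
  rw [h3]
  simp

/-- The rotated gradient of a Lipschitz function is divergence free. -/
theorem IsDivergenceFree.of_lipschitz {Ω : Set Plane} {m : Plane → Plane} {u : Plane → ℝ}
    {K : NNReal} (hu : LipschitzWith K u)
    (h : ∀ᵐ p, HasLineDerivAt ℝ u (m p 1) p (EuclideanSpace.single 0 1) ∧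
      HasLineDerivAt ℝ u (-m p 0) p (EuclideanSpace.single 1 1)) :
    IsDivergenceFree Ω m := by
  intro φ hφ hφc hφΩ
  have hd : ContDiff ℝ ∞ (fderiv ℝ φ) := hφ.fderiv_right (by norm_cast)
  have hint : ∀ v w : Plane, Integrable fun p => lineDeriv ℝ u p v * fderiv ℝ φ p w := by
    intro v w
    have h4 : Integrable fun p => fderiv ℝ φ p w :=
      (hd.continuous.clm_apply continuous_const).integrable_of_hasCompactSupport
        ((hφc.fderiv (𝕜 := ℝ)).comp_left (g := fun l : Plane →L[ℝ] ℝ => l w) rfl)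
    exact h4.bdd_mul (aestronglyMeasurable_lineDeriv hu.continuous _)
      (Eventually.of_forall fun p => norm_lineDeriv_le_of_lipschitz ℝ hu)
  rw [setIntegral_eq_integral_of_forall_compl_eq_zero]
  · have e : ∀ᵐ p, inner ℝ (m p) (gradient φ p)
        = lineDeriv ℝ u p (EuclideanSpace.single 0 1) * fderiv ℝ φ p (EuclideanSpace.single 1 1)
          - lineDeriv ℝ u p (EuclideanSpace.single 1 1)
            * fderiv ℝ φ p (EuclideanSpace.single 0 1) := by
      filter_upwards [h] with p hp
      rw [hp.1.lineDeriv, hp.2.lineDeriv, real_inner_comm, gradient,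
        InnerProductSpace.toDual_symm_apply]
      have : m p = m p 0 • EuclideanSpace.single 0 1 + m p 1 • EuclideanSpace.single 1 1 := by
        ext i
        fin_cases i <;> simp
      conv_lhs => rw [this]
      simp only [map_add, map_smul, smul_eq_mul]
      ring
    rw [integral_congr_ae e, integral_sub (hint _ _) (hint _ _),
      integral_lineDeriv_mul_fderiv hu hφ hφc, integral_lineDeriv_mul_fderiv hu hφ hφc, sub_eq_zero]
    congr 1
    refine integral_congr_ae (Eventually.of_forall fun p => ?_)
    -- After integrating by parts both terms contain a mixed second derivative of `φ`; the symmetry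
    -- of the second derivative makes them cancel.
    have hs : IsSymmSndFDerivAt ℝ φ p := hφ.contDiffAt.isSymmSndFDerivAt (by simpa using ENat.LEInfty.out)
    simp only []
    rw [hs]
  · intro p hp
    have hz : fderiv ℝ φ p = 0 := by
      have : p ∉ tsupport (fderiv ℝ φ) := fun hc => hp (hφΩ (tsupport_fderiv_subset ℝ hc))
      exact image_eq_zero_of_notMem_tsupport this
    simp [gradient, hz]

/-! ### The field in a single kite and its variation -/

section Kite

/-- The field with the constant values `(∓s, c)` above and below the line `{p 1 = y₀}`. -/
noncomputable def outer (c s y₀ : ℝ) (p : Plane) : Plane := !₂[if y₀ < p 1 then -s else s, c]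

/-- The open kite with vertices `q`, `q + (L, 0)` and `q + (L c, ± L s)`. -/
def kite (c s L : ℝ) (q : Plane) : Set Plane :=
  {p | |p 1 - q 1| * c < (p 0 - q 0) * s ∧ (p 0 - q 0) * (1 + c) + |p 1 - q 1| * s < L * (1 + c)}

/-- The vortex centred at `q`. -/
noncomputable def fan (q p : Plane) : Plane :=
  !₂[-(p 1 - q 1) / ‖p - q‖, (p 0 - q 0) / ‖p - q‖]

open Classical in
/-- The field filling the kite: a vortex up to an arc of parabola, a constant beyond it. -/
noncomputable def core (c L : ℝ) (q p : Plane) : Plane :=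
  if ‖p - q‖ + (p 0 - q 0) < L * (1 + c) then fan q p else !₂[0, -1]

open Classical in
/-- The difference, supported in the kite, between the filled and the outer field. -/
noncomputable def bump (c s L : ℝ) (q p : Plane) : Plane :=
  if p ∈ kite c s L q then core c L q p - outer c s (q 1) p else 0

theorem norm_plane_eq (v : Plane) : ‖v‖ = √(v 0 ^ 2 + v 1 ^ 2) := by
  rw [EuclideanSpace.norm_eq]; simp

theorem norm_sq_plane_eq (v : Plane) : ‖v‖ ^ 2 = v 0 ^ 2 + v 1 ^ 2 := by
  rw [norm_plane_eq, Real.sq_sqrt (by positivity)]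

theorem norm_fan {q p : Plane} (h : p ≠ q) : ‖fan q p‖ = 1 := by
  have hn : ‖p - q‖ ≠ 0 := norm_ne_zero_iff.2 (sub_ne_zero.2 h)
  have h2 := norm_sq_plane_eq (p - q)
  rw [norm_plane_eq, Real.sqrt_eq_one]
  simp only [fan, PiLp.sub_apply] at *
  simp
  field_simp
  linarith

theorem abs_fan_le (q p : Plane) (i : Fin 2) : |fan q p i| ≤ 1 := by
  by_cases h : p = q
  · subst h; fin_cases i <;> simp [fan]
  · exact (PiLp.norm_apply_le (fan q p) i).trans (norm_fan h).le

theorem norm_outer {c s : ℝ} (hcs : c ^ 2 + s ^ 2 = 1) (y₀ : ℝ) (p : Plane) :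
    ‖outer c s y₀ p‖ = 1 := by
  rw [norm_plane_eq, Real.sqrt_eq_one]
  simp only [outer]
  split_ifs <;> simp <;> linarith

theorem abs_outer_le {c s : ℝ} (hcs : c ^ 2 + s ^ 2 = 1) (y₀ : ℝ) (p : Plane) (i : Fin 2) :
    |outer c s y₀ p i| ≤ 1 :=
  (PiLp.norm_apply_le _ i).trans (norm_outer hcs y₀ p).le

theorem measurable_plane {f g : Plane → ℝ} (hf : Measurable f) (hg : Measurable g) :
    Measurable fun p => (!₂[f p, g p] : Plane) := by
  have : Measurable fun p => ((f p, g p) : ℝ × ℝ) := hf.prodMk hg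
  exact measurePreserving_coords.measurable.comp this

theorem isOpen_kite (c s L : ℝ) (q : Plane) : IsOpen (kite c s L q) :=
  (isOpen_lt (f := fun p : Plane => |p 1 - q 1| * c) (g := fun p => (p 0 - q 0) * s)
    (by fun_prop) (by fun_prop)).inter
  (isOpen_lt (f := fun p : Plane => (p 0 - q 0) * (1 + c) + |p 1 - q 1| * s)
    (g := fun _ => L * (1 + c)) (by fun_prop) (by fun_prop))

theorem measurable_outer (c s y₀ : ℝ) : Measurable (outer c s y₀) := by
  refine measurable_plane (Measurable.ite ?_ measurable_const measurable_const) measurable_const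
  exact (isOpen_lt (f := fun _ : Plane => y₀) (g := fun p : Plane => p 1)
    continuous_const (by fun_prop)).measurableSet

theorem measurable_fan (q : Plane) : Measurable (fan q) :=
  measurable_plane
    (Measurable.div (Continuous.measurable (by fun_prop)) (Continuous.measurable (by fun_prop)))
    (Measurable.div (Continuous.measurable (by fun_prop)) (Continuous.measurable (by fun_prop)))

theorem measurable_core (c L : ℝ) (q : Plane) : Measurable (core c L q) := by
  refine Measurable.ite ?_ (measurable_fan q) measurable_const
  exact (isOpen_lt (f := fun p : Plane => ‖p - q‖ + (p 0 - q 0)) (g := fun _ => L * (1 + c))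
    (by fun_prop) continuous_const).measurableSet

theorem measurable_bump (c s L : ℝ) (q : Plane) : Measurable (bump c s L q) :=
  Measurable.ite (isOpen_kite c s L q).measurableSet
    ((measurable_core c L q).sub (measurable_outer c s _)) measurable_const

theorem TransVar.comp_sub {g : ℝ → ℝ} {C : ℝ} (hg : TransVar g C) (a : ℝ) :
    TransVar (fun x => g (x - a)) C :=
  ⟨hg.1.comp (measurable_sub_const a), fun h hh => by
    refine le_trans (le_of_eq ?_) (hg.2 h hh)
    rw [← lintegral_sub_right_eq_self (fun x => ‖g (x + h) - g x‖ₑ) a]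
    refine lintegral_congr fun x => ?_
    rw [sub_add_eq_add_sub]⟩

theorem abs_div_sqrt_le (t a : ℝ) : |t / √(t ^ 2 + a ^ 2)| ≤ 1 := by
  rw [abs_div, abs_of_nonneg (Real.sqrt_nonneg _)]
  refine div_le_one_of_le₀ ?_ (Real.sqrt_nonneg _)
  exact Real.abs_le_sqrt (by nlinarith [sq_nonneg a])

theorem monotone_div_sqrt (a : ℝ) : Monotone fun t : ℝ => t / √(t ^ 2 + a ^ 2) := by
  have key : ∀ x y : ℝ, 0 ≤ x → x ≤ y → x / √(x ^ 2 + a ^ 2) ≤ y / √(y ^ 2 + a ^ 2) := by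
    intro x y hx hxy
    rcases hx.eq_or_lt with rfl | hx
    · rw [zero_div]; positivity
    have hy : 0 < y := hx.trans_le hxy
    rw [div_le_div_iff₀ (by positivity) (by positivity)]
    refine abs_le_of_sq_le_sq' ?_ (by positivity) |>.2
    rw [mul_pow, mul_pow, Real.sq_sqrt (by positivity), Real.sq_sqrt (by positivity)]
    have : x ^ 2 ≤ y ^ 2 := by gcongr
    nlinarith [sq_nonneg a]
  intro x y hxy
  simp only []
  rcases le_total 0 x with hx | hx
  · exact key x y hx hxy
  · rcases le_total 0 y with hy | hy
    · exact (div_nonpos_of_nonpos_of_nonneg hx (Real.sqrt_nonneg _)).trans (by positivity)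
    · have := key (-y) (-x) (by linarith) (by linarith)
      rw [neg_sq, neg_sq, neg_div, neg_div] at this
      linarith

theorem transVar_div_sqrt (a : ℝ) : TransVar (fun t : ℝ => t / √(t ^ 2 + a ^ 2)) 4 :=
  (TransVar.of_monotone (monotone_div_sqrt a) fun t => abs_div_sqrt_le t a).mono (by norm_num)

theorem transVar_const_div_sqrt (a : ℝ) : TransVar (fun t : ℝ => a / √(t ^ 2 + a ^ 2)) 4 := by
  have key : ∀ b : ℝ, 0 ≤ b → TransVar (fun t : ℝ => b / √(t ^ 2 + b ^ 2)) 4 := by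
    intro b hb
    rcases hb.eq_or_lt with rfl | hb
    · simpa using (TransVar.const 0).mono (by norm_num : (0 : ℝ) ≤ 4)
    have := TransVar.of_monotoneOn_antitoneOn (g := fun t : ℝ => b / √(t ^ 2 + b ^ 2)) (a := 0)
      (B := 1) ?_ ?_ ?_
    · simpa using this
    · intro x hx y hy hxy
      simp only [mem_Iic] at hx hy
      have : y ^ 2 ≤ x ^ 2 := by nlinarith
      simp only []
      gcongr
    · intro x hx y hy hxy
      simp only [mem_Ici] at hx hy
      simp only []
      gcongr
    · intro x
      rw [add_comm]
      exact abs_div_sqrt_le b x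
  rcases le_total 0 a with ha | ha
  · exact key a ha
  · have := (key (-a) (by linarith)).neg
    simpa [neg_div] using this

/-- Vertical slices of the kite and of the vortex region are of this kind: by reflection symmetry
they depend only on the distance to the axis, and their conditions become harder to satisfy as it
grows. -/
theorem ordConnected_abs {P : ℝ → Prop} (hP : ∀ u v, 0 ≤ u → u ≤ v → P v → P u) (a : ℝ) :
    {y : ℝ | P |y - a|}.OrdConnected := by
  refine ⟨fun x hx y hy z hz => ?_⟩
  simp only [mem_ofPred_eq] at *
  rcases le_total |x - a| |y - a| with h | h
  · refine hP _ _ (abs_nonneg _) (abs_le.2 ⟨?_, ?_⟩) hy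
    · linarith [hz.1, (abs_le.1 h).1]
    · linarith [hz.2, le_abs_self (y - a)]
  · refine hP _ _ (abs_nonneg _) (abs_le.2 ⟨?_, ?_⟩) hx
    · linarith [hz.1, neg_abs_le (x - a)]
    · linarith [hz.2, (abs_le.1 h).2]

theorem norm_coords_sub (x y : ℝ) (q : Plane) :
    ‖(!₂[x, y] : Plane) - q‖ = √((x - q 0) ^ 2 + (y - q 1) ^ 2) := by
  rw [norm_plane_eq]; simp

theorem norm_coords_sub_le (x x' y : ℝ) (q : Plane) :
    ‖(!₂[x, y] : Plane) - q‖ ≤ ‖(!₂[x', y] : Plane) - q‖ + |x - x'| := by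
  have : (!₂[x, y] : Plane) - q = (!₂[x', y] - q) + !₂[x - x', 0] := by
    ext i; fin_cases i <;> simp
  rw [this]
  refine (norm_add_le _ _).trans (le_of_eq ?_)
  congr 1
  rw [norm_plane_eq]
  simp [Real.sqrt_sq_eq_abs]

variable {c s L : ℝ}

open Classical in
theorem bump_apply_eq (q p : Plane) (i : Fin 2) :
    bump c s L q p i = (if p ∈ kite c s L q then
      (if ‖p - q‖ + (p 0 - q 0) < L * (1 + c) then fan q p i else (!₂[0, -1] : Plane) i)
        else outer c s (q 1) p i) + -outer c s (q 1) p i := by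
  rw [bump, core]
  split_ifs <;> simp <;> ring

/-- On a row the outer field is constant, each vortex component costs 4, and the two switches (at
the parabola and at the boundary of the kite) cost 4 each. -/
theorem transVar_bump_row (hc : 0 < c) (hs : 0 < s) (hcs : c ^ 2 + s ^ 2 = 1) (q : Plane)
    (i : Fin 2) (y : ℝ) : TransVar (fun x => bump c s L q !₂[x, y] i) 12 := by
  have ho : ∀ x, outer c s (q 1) !₂[x, y] i = outer c s (q 1) !₂[0, y] i := fun x => by
    simp [outer]
  simp_rw [bump_apply_eq, ho]
  have hF : TransVar (fun x => fan q !₂[x, y] i) 4 := by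
    fin_cases i
    · have := ((transVar_const_div_sqrt (y - q 1)).comp_sub (q 0)).neg
      simpa [fan, norm_coords_sub, ← neg_div] using this
    · have := (transVar_div_sqrt (y - q 1)).comp_sub (q 0)
      simpa [fan, norm_coords_sub] using this
  have hd : |(!₂[0, -1] : Plane) i| ≤ 1 := by fin_cases i <;> simp
  have h1 := TransVar.ite (by norm_num) le_rfl hF (TransVar.const ((!₂[0, -1] : Plane) i))
    (B := 1) (fun x => abs_fan_le _ _ _) (fun _ => hd)
    (S := {x | ‖(!₂[x, y] : Plane) - q‖ + (x - q 0) < L * (1 + c)})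
    ⟨fun x hx z hz w hw => by
      simp only [mem_ofPred_eq] at *
      -- The distance to `q` is 1-Lipschitz, so adding the abscissa makes it nondecreasing along a
      -- row, and the vortex region cuts the row in a left half line.
      have := norm_coords_sub_le w z y q
      rw [abs_of_nonpos (by linarith [hw.2])] at this
      linarith⟩
  have h2 := TransVar.ite (by norm_num) le_rfl h1
    (TransVar.const (outer c s (q 1) !₂[0, y] i)) (B := 1)
    (fun x => by
      split_ifs
      · exact abs_fan_le _ _ _
      · exact hd) (fun _ => abs_outer_le hcs _ _ _)
    (S := {x | |y - q 1| * c < (x - q 0) * s ∧ (x - q 0) * (1 + c) + |y - q 1| * s < L * (1 + c)})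
    ⟨fun x hx z hz w hw => by
      simp only [mem_ofPred_eq] at *
      constructor
      · exact hx.1.trans_le (by have := hw.1; gcongr)
      · refine lt_of_le_of_lt ?_ hz.2
        have := hw.2
        gcongr⟩
  have h3 := h2.add (by norm_num) le_rfl (TransVar.const (-outer c s (q 1) !₂[0, y] i))
  have h4 := h3.mono (by norm_num : _ ≤ (12 : ℝ))
  convert h4 using 5
  · simp [kite]
  · simp

theorem transVar_outer_column (hcs : c ^ 2 + s ^ 2 = 1) (y₀ : ℝ) (i : Fin 2) (x : ℝ) :
    TransVar (fun y => outer c s y₀ !₂[x, y] i) 4 := by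
  have hs : |s| ≤ 1 := abs_le_one_iff_mul_self_le_one.2 (by nlinarith [sq_nonneg c])
  fin_cases i
  · have := TransVar.ite le_rfl le_rfl (TransVar.const (-s)) (TransVar.const s) (B := 1)
      (fun _ => by simpa using hs) (fun _ => hs) (S := Ioi y₀) ordConnected_Ioi
    simpa [outer] using this
  · simpa [outer] using (TransVar.const c).mono (by norm_num : (0 : ℝ) ≤ 4)

/-- Compared with rows, the outer field now jumps by `2 * s` across the axis. It enters both as the
alternative outside the kite and as the subtracted term, adding 4 each time. -/
theorem transVar_bump_column (hc : 0 < c) (hs : 0 < s) (hcs : c ^ 2 + s ^ 2 = 1) (q : Plane)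
    (i : Fin 2) (x : ℝ) : TransVar (fun y => bump c s L q !₂[x, y] i) 20 := by
  simp_rw [bump_apply_eq]
  have hF : TransVar (fun y => fan q !₂[x, y] i) 4 := by
    fin_cases i
    · have := ((transVar_div_sqrt (x - q 0)).comp_sub (q 1)).neg
      simpa [fan, norm_coords_sub, ← neg_div, add_comm] using this
    · have := (transVar_const_div_sqrt (x - q 0)).comp_sub (q 1)
      simpa [fan, norm_coords_sub, add_comm] using this
  have hd : |(!₂[0, -1] : Plane) i| ≤ 1 := by fin_cases i <;> simp
  have h1 := TransVar.ite (by norm_num) le_rfl hF (TransVar.const ((!₂[0, -1] : Plane) i))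
    (B := 1) (fun x => abs_fan_le _ _ _) (fun _ => hd)
    (S := {y | √((x - q 0) ^ 2 + |y - q 1| ^ 2) + (x - q 0) < L * (1 + c)})
    (ordConnected_abs (P := fun u => √((x - q 0) ^ 2 + u ^ 2) + (x - q 0) < L * (1 + c))
      (fun u v hu huv hv => lt_of_le_of_lt (by gcongr) hv) (q 1))
  have h2 := TransVar.ite (by norm_num) (by norm_num) h1
    (transVar_outer_column hcs (q 1) i x) (B := 1)
    (fun x => by
      split_ifs
      · exact abs_fan_le _ _ _
      · exact hd) (fun _ => abs_outer_le hcs _ _ _)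
    (S := {y | |y - q 1| * c < (x - q 0) * s ∧ (x - q 0) * (1 + c) + |y - q 1| * s < L * (1 + c)})
    (ordConnected_abs (P := fun u => u * c < (x - q 0) * s ∧
        (x - q 0) * (1 + c) + u * s < L * (1 + c)) (fun u v _ huv hv =>
        ⟨lt_of_le_of_lt (by gcongr) hv.1, lt_of_le_of_lt (by gcongr) hv.2⟩) (q 1))
  have h3 := h2.add (by norm_num) (by norm_num) (transVar_outer_column hcs (q 1) i x).neg
  have h4 := h3.mono (by norm_num : _ ≤ (20 : ℝ))
  convert h4 using 5
  · simp [kite]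
  · simp [norm_coords_sub]

theorem abs_lt_of_mem_kite (hc : 0 < c) (hs : 0 < s) (hcs : c ^ 2 + s ^ 2 = 1) {q p : Plane}
    (h : p ∈ kite c s L q) : |p 1 - q 1| < L * s ∧ 0 < p 0 - q 0 ∧ p 0 - q 0 < L := by
  obtain ⟨h1, h2⟩ := h
  have h0 := abs_nonneg (p 1 - q 1)
  refine ⟨?_, ?_, ?_⟩
  -- Multiplying the two kite inequalities by 1 + c and s eliminates the abscissa; c² + s² = 1 then
  -- leaves a common factor 1 + c.
  · have h3 : |p 1 - q 1| * c * (1 + c) < (p 0 - q 0) * s * (1 + c) := by gcongr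
    have h4 : ((p 0 - q 0) * (1 + c) + |p 1 - q 1| * s) * s < L * (1 + c) * s := by gcongr
    have h5 : |p 1 - q 1| * (1 + c) < L * s * (1 + c) := by nlinarith
    exact lt_of_mul_lt_mul_right h5 (by positivity)
  · exact pos_of_mul_pos_left (lt_of_le_of_lt (by positivity) h1) hs.le
  · exact lt_of_mul_lt_mul_right (a := 1 + c)
      (lt_of_le_of_lt (le_add_of_nonneg_right (by positivity)) h2) (by positivity)

theorem bump_of_notMem {q p : Plane} (h : p ∉ kite c s L q) : bump c s L q p = 0 := by
  rw [bump, if_neg h]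

/-- Only rows and columns meeting the kite contribute: 12 times a height 2 L s, and 20 times a width
L. Being of order L, the contributions of ℓ / L kites sum to a bound independent of L. -/
theorem transBound_bump (hc : 0 < c) (hs : 0 < s) (hcs : c ^ 2 + s ^ 2 = 1) (hL : 0 < L)
    (q : Plane) (i : Fin 2) {T : Set Plane} (hT : MeasurableSet T) :
    TransBound T (fun p => bump c s L q p i) (24 * L) := by
  have hm : Measurable fun p => bump c s L q p i :=
    (EuclideanSpace.proj (𝕜 := ℝ) i).continuous.measurable.comp (measurable_bump c s L q)
  have hs1 : s ≤ 1 := by nlinarith [sq_nonneg c]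
  refine ⟨hm, fun j h hh => ?_⟩
  fin_cases j
  · refine (lintegral_translate_rows_le hm (transVar_bump_row hc hs hcs q i) hT
      (A := Ioo (q 1 - L * s) (q 1 + L * s)) measurableSet_Ioo ?_ hh).trans ?_
    · intro x y h hy _
      have : ∀ x', bump c s L q !₂[x', y] = 0 := fun x' => bump_of_notMem fun hk => hy (by
        have := abs_lt.1 (abs_lt_of_mem_kite hc hs hcs hk).1
        simp at this
        constructor <;> linarith)
      simp [this]
    · rw [Real.volume_Ioo, ← ENNReal.ofReal_mul (by positivity)]
      refine ENNReal.ofReal_le_ofReal ?_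
      have : L * s * h ≤ L * 1 * h := by gcongr
      linarith
  · refine (lintegral_translate_columns_le hm (transVar_bump_column hc hs hcs q i) hT
      (A := Ioo (q 0) (q 0 + L)) measurableSet_Ioo ?_ hh).trans ?_
    · intro x y h hx _
      have : ∀ y', bump c s L q !₂[x, y'] = 0 := fun x' => bump_of_notMem fun hk => hx (by
        have := (abs_lt_of_mem_kite hc hs hcs hk).2
        simp at this
        constructor <;> linarith)
      simp [this]
    · rw [Real.volume_Ioo, ← ENNReal.ofReal_mul (by positivity)]
      refine ENNReal.ofReal_le_ofReal ?_
      nlinarith [mul_pos hL hh]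

theorem transBound_outer (hcs : c ^ 2 + s ^ 2 = 1) (y₀ : ℝ) (i : Fin 2) (R : ℝ) :
    TransBound (Metric.closedBall 0 R) (fun p => outer c s y₀ p i) (8 * R) := by
  have hm : Measurable fun p => outer c s y₀ p i :=
    (EuclideanSpace.proj (𝕜 := ℝ) i).continuous.measurable.comp (measurable_outer c s y₀)
  refine ⟨hm, fun j h hh => ?_⟩
  fin_cases j
  · refine (lintegral_translate_rows_le hm (C := 0) (A := ∅) (fun y => ?_)
      measurableSet_closedBall MeasurableSet.empty (fun x y h _ _ => by simp [outer]) hh).trans ?_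
    · simpa [outer] using TransVar.const (outer c s y₀ !₂[0, y] i)
    · simp
  · refine (lintegral_translate_columns_le hm (transVar_outer_column hcs y₀ i)
      measurableSet_closedBall (A := Icc (-R) R) measurableSet_Icc ?_ hh).trans ?_
    · intro x y h hx hxy
      refine absurd ?_ hx
      have h1 := PiLp.norm_apply_le (!₂[x, y] : Plane) 0
      have h2 := mem_closedBall_zero_iff.1 hxy
      exact abs_le.1 (h1.trans h2)
    · rw [Real.volume_Icc, ← ENNReal.ofReal_mul (by positivity)]
      refine ENNReal.ofReal_le_ofReal ?_
      linarith

end Kite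

/-! ### Stream functions of the outer field and of the kite -/

section StreamFunction

theorem mul_add_mul_le_sqrt {e₁ e₂ : ℝ} (he : e₁ ^ 2 + e₂ ^ 2 = 1) (a b : ℝ) :
    e₁ * a + e₂ * b ≤ √(a ^ 2 + b ^ 2) := by
  refine Real.le_sqrt_of_sq_le ?_
  nlinarith [sq_nonneg (e₁ * b - e₂ * a)]

/-- The supremum of `⟨e, p - q⟩` over the unit vectors `e` with `e 0 ≥ c`. -/
noncomputable def cone (c s : ℝ) (q p : Plane) : ℝ :=
  if |p 1 - q 1| * c < (p 0 - q 0) * s then ‖p - q‖ else (p 0 - q 0) * c + |p 1 - q 1| * s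

variable {c s L : ℝ}

/-- Inside the sector this is Cauchy–Schwarz. Outside it the extremal vectors are (c, ±s): moving
`e₁` above c gains less than what is lost in `e₂`, by e₁ c + |e₂| s ≤ 1 combined with X s ≤ |Y| c.
-/
theorem mul_add_mul_le_cone (hc : 0 < c) (hs : 0 < s) (hcs : c ^ 2 + s ^ 2 = 1) {e₁ e₂ : ℝ}
    (he : e₁ ^ 2 + e₂ ^ 2 = 1) (hce : c ≤ e₁) (q p : Plane) :
    e₁ * (p 0 - q 0) + e₂ * (p 1 - q 1) ≤ cone c s q p := by
  rw [cone]
  split_ifs with h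
  · rw [norm_plane_eq]
    exact mul_add_mul_le_sqrt he _ _
  · set X := p 0 - q 0
    set Y := p 1 - q 1
    rw [not_lt] at h
    have he2 : |e₂| ≤ s := by
      refine abs_le_of_sq_le_sq ?_ hs.le
      nlinarith
    have h1 : e₂ * Y ≤ |e₂| * |Y| := by rw [← abs_mul]; exact le_abs_self _
    rcases le_total X 0 with hX | hX
    · have h2 : e₁ * X ≤ c * X := mul_le_mul_of_nonpos_right hce hX
      have h3 : |e₂| * |Y| ≤ s * |Y| := by gcongr
      linarith
    · have h4 : (e₁ - c) * X * s ≤ (e₁ - c) * (|Y| * c) := by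
        rw [mul_assoc]
        exact mul_le_mul_of_nonneg_left h (by linarith)
      have h5 : e₁ * c + |e₂| * s ≤ 1 := by
        nlinarith [sq_nonneg (e₁ - c), sq_nonneg (|e₂| - s), sq_abs e₂]
      have h6 : (e₁ - c) * (|Y| * c) ≤ (s - |e₂|) * |Y| * s := by
        have h8 : (e₁ * c + |e₂| * s) * |Y| ≤ 1 * |Y| := by gcongr
        have h9 : (s - |e₂|) * |Y| * s - (e₁ - c) * (|Y| * c)
            = |Y| * (c ^ 2 + s ^ 2) - (e₁ * c + |e₂| * s) * |Y| := by ring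
        rw [hcs] at h9
        linarith
      have h7 : (e₁ - c) * X ≤ (s - |e₂|) * |Y| := le_of_mul_le_mul_right (h4.trans h6) hs
      nlinarith

theorem mul_norm_le_of_fan (hcs : c ^ 2 + s ^ 2 = 1) {q p : Plane}
    (hX : 0 ≤ p 0 - q 0) (h : |p 1 - q 1| * c ≤ (p 0 - q 0) * s) (hc : 0 ≤ c) :
    c * ‖p - q‖ ≤ p 0 - q 0 := by
  refine abs_le_of_sq_le_sq' ?_ hX |>.2
  have h2 : (|p 1 - q 1| * c) ^ 2 ≤ ((p 0 - q 0) * s) ^ 2 := by gcongr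
  rw [mul_pow, sq_abs] at h2
  rw [mul_pow, norm_sq_plane_eq]
  simp only [PiLp.sub_apply]
  nlinarith

theorem exists_cone_eq (hc : 0 < c) (hs : 0 < s) (hcs : c ^ 2 + s ^ 2 = 1) (q p : Plane) :
    ∃ e₁ e₂ : ℝ, e₁ ^ 2 + e₂ ^ 2 = 1 ∧ c ≤ e₁ ∧
      cone c s q p = e₁ * (p 0 - q 0) + e₂ * (p 1 - q 1) := by
  rw [cone]
  split_ifs with h
  · have hX : 0 < p 0 - q 0 := pos_of_mul_pos_left (lt_of_le_of_lt (by positivity) h) hs.le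
    have hpq : 0 < ‖p - q‖ := by
      rw [norm_plane_eq]
      refine Real.sqrt_pos.2 ?_
      simp only [PiLp.sub_apply]
      positivity
    have h2 := norm_sq_plane_eq (p - q)
    simp only [PiLp.sub_apply] at h2
    refine ⟨(p 0 - q 0) / ‖p - q‖, (p 1 - q 1) / ‖p - q‖, ?_, ?_, ?_⟩
    · field_simp
      linarith
    · rw [le_div_iff₀ hpq]
      exact mul_norm_le_of_fan hcs hX.le h.le hc.le
    · field_simp
      linarith
  · rcases le_total 0 (p 1 - q 1) with hY | hY
    · exact ⟨c, s, hcs, le_rfl, by rw [abs_of_nonneg hY]; ring⟩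
    · exact ⟨c, -s, by rw [neg_sq]; exact hcs, le_rfl, by rw [abs_of_nonpos hY]; ring⟩

/-- `cone` is an attained supremum of linear functionals of norm 1. This representation replaces a
gluing argument across the sides of the sector. -/
theorem lipschitzWith_cone (hc : 0 < c) (hs : 0 < s) (hcs : c ^ 2 + s ^ 2 = 1) (q : Plane) :
    LipschitzWith 1 (cone c s q) := by
  refine LipschitzWith.of_le_add fun p p' => ?_
  obtain ⟨e₁, e₂, he, hce, h⟩ := exists_cone_eq hc hs hcs q p
  have h1 := mul_add_mul_le_cone hc hs hcs he hce q p'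
  have h2 := mul_add_mul_le_sqrt he ((p - p') 0) ((p - p') 1)
  rw [← norm_plane_eq, ← dist_eq_norm] at h2
  simp only [PiLp.sub_apply] at h2
  rw [h]
  linarith

/-- A Lipschitz stream function of the outer field. -/
noncomputable def outerPot (c s y₀ : ℝ) (p : Plane) : ℝ := p 0 * c + |p 1 - y₀| * s

/-- A Lipschitz stream function of `bump`. -/
noncomputable def bumpPot (c s L : ℝ) (q p : Plane) : ℝ :=
  max 0 (min (cone c s q p - ((p 0 - q 0) * c + |p 1 - q 1| * s))
    (L * (1 + c) - (p 0 - q 0) - ((p 0 - q 0) * c + |p 1 - q 1| * s)))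

theorem lipschitzWith_apply (i : Fin 2) : LipschitzWith 1 fun p : Plane => p i :=
  LipschitzWith.mk_one fun p q => by
    rw [dist_eq_norm, dist_eq_norm]
    exact PiLp.norm_apply_le (p - q) i

theorem exists_lipschitzWith_sub_mul (i : Fin 2) (a b : ℝ) :
    ∃ K, LipschitzWith K fun p : Plane => (p i - a) * b :=
  ⟨_, (lipschitzWith_smul b).comp ((lipschitzWith_apply i).sub (LipschitzWith.const a)) |> fun h => by
      simpa [Function.comp_def, mul_comm] using h⟩

theorem exists_lipschitzWith_abs_sub_mul (i : Fin 2) (a b : ℝ) :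
    ∃ K, LipschitzWith K fun p : Plane => |p i - a| * b :=
  ⟨_, (lipschitzWith_smul b).comp (lipschitzWith_one_norm.comp
    ((lipschitzWith_apply i).sub (LipschitzWith.const a))) |> fun h => by
      simpa [Function.comp_def, mul_comm] using h⟩

theorem exists_lipschitzWith_outerPot (c s y₀ : ℝ) : ∃ K, LipschitzWith K (outerPot c s y₀) := by
  obtain ⟨K₁, h₁⟩ := exists_lipschitzWith_sub_mul 0 0 c
  obtain ⟨K₂, h₂⟩ := exists_lipschitzWith_abs_sub_mul 1 y₀ s
  have h₃ : LipschitzWith K₁ fun p : Plane => p 0 * c := by simpa using h₁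
  exact ⟨_, h₃.add h₂⟩

theorem exists_lipschitzWith_bumpPot (hc : 0 < c) (hs : 0 < s) (hcs : c ^ 2 + s ^ 2 = 1) (L : ℝ)
    (q : Plane) : ∃ K, LipschitzWith K (bumpPot c s L q) := by
  obtain ⟨K₁, h₁⟩ := exists_lipschitzWith_sub_mul 0 (q 0) c
  obtain ⟨K₂, h₂⟩ := exists_lipschitzWith_abs_sub_mul 1 (q 1) s
  have h₃ := (LipschitzWith.const (α := Plane) (L * (1 + c))).sub
    ((lipschitzWith_apply 0).sub (LipschitzWith.const (q 0)))
  have h₄ := ((lipschitzWith_cone hc hs hcs q).sub (h₁.add h₂)).min (h₃.sub (h₁.add h₂))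
  exact ⟨_, (h₄.const_max 0)⟩

/-- In the kite both candidates dominate the outer stream function, one by Cauchy–Schwarz and the
other by the second kite inequality, so the maximum with 0 is inactive. -/
theorem bumpPot_of_mem (hcs : c ^ 2 + s ^ 2 = 1) {q p : Plane}
    (h : p ∈ kite c s L q) : bumpPot c s L q p =
      min ‖p - q‖ (L * (1 + c) - (p 0 - q 0)) - ((p 0 - q 0) * c + |p 1 - q 1| * s) := by
  rw [bumpPot, cone, if_pos h.1, min_sub_sub_right, max_eq_right]
  rw [sub_nonneg]
  refine le_min ?_ ?_
  · rw [norm_plane_eq]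
    have := mul_add_mul_le_sqrt hcs (p 0 - q 0) (|p 1 - q 1|)
    rw [sq_abs] at this
    simp only [PiLp.sub_apply]
    linarith
  · linarith [h.2]

/-- Outside the sector `cone` is the outer stream function itself; past the far sides the affine
candidate lies below it. Either way the minimum is at most 0. -/
theorem bumpPot_of_notMem {q p : Plane} (h : p ∉ kite c s L q) : bumpPot c s L q p = 0 := by
  rw [bumpPot, max_eq_left]
  by_cases h1 : |p 1 - q 1| * c < (p 0 - q 0) * s
  · have h2 : L * (1 + c) ≤ (p 0 - q 0) * (1 + c) + |p 1 - q 1| * s := by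
      by_contra! h2
      exact h ⟨h1, h2⟩
    exact (min_le_right _ _).trans (by linarith)
  · refine (min_le_left _ _).trans ?_
    rw [cone, if_neg h1, sub_self]

theorem hasLineDerivAt_sub {f g : Plane → ℝ} {f' g' : ℝ} {p v : Plane}
    (hf : HasLineDerivAt ℝ f f' p v) (hg : HasLineDerivAt ℝ g g' p v) :
    HasLineDerivAt ℝ (fun x => f x - g x) (f' - g') p v :=
  HasDerivAt.sub hf hg

theorem hasLineDerivAt_const (a : ℝ) (p v : Plane) :
    HasLineDerivAt ℝ (fun _ => a) 0 p v :=
  hasDerivAt_const _ _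

theorem hasLineDerivAt_apply_sub (i j : Fin 2) (a : ℝ) (p : Plane) :
    HasLineDerivAt ℝ (fun p : Plane => p i - a) (if i = j then 1 else 0) p
      (EuclideanSpace.single j 1) := by
  have h := (((EuclideanSpace.proj (𝕜 := ℝ) i).hasFDerivAt (x := p)).sub_const a).hasLineDerivAt
    (EuclideanSpace.single j 1)
  simpa [PiLp.single_apply] using h

theorem hasLineDerivAt_abs_sub (i j : Fin 2) (a : ℝ) {p : Plane} (h : p i ≠ a) :
    HasLineDerivAt ℝ (fun p : Plane => |p i - a|)
      (if i = j then (SignType.sign (p i - a) : ℝ) else 0) p (EuclideanSpace.single j 1) := by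
  have h1 : HasFDerivAt (fun p : Plane => p i - a) (EuclideanSpace.proj (𝕜 := ℝ) i) p :=
    ((EuclideanSpace.proj (𝕜 := ℝ) i).hasFDerivAt (x := p)).sub_const a
  have h2 := ((hasDerivAt_abs (sub_ne_zero.2 h)).comp_hasFDerivAt p h1).hasLineDerivAt
    (EuclideanSpace.single j 1)
  simpa [PiLp.single_apply, Function.comp_def] using h2

theorem hasLineDerivAt_norm_sub (j : Fin 2) {q p : Plane} (h : p ≠ q) :
    HasLineDerivAt ℝ (fun p : Plane => ‖p - q‖) ((p j - q j) / ‖p - q‖) p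
      (EuclideanSpace.single j 1) := by
  have hn : 0 < ‖p - q‖ := norm_pos_iff.2 (sub_ne_zero.2 h)
  have h1 := (((hasFDerivAt_id p).sub_const q).norm_sq.sqrt (by positivity)).hasLineDerivAt
    (EuclideanSpace.single j 1)
  simp only [id, Real.sqrt_sq (norm_nonneg _)] at h1
  have e : ((1 / (2 * ‖p - q‖)) • 2 • (innerSL ℝ (p - q)).comp (ContinuousLinearMap.id ℝ Plane))
      (EuclideanSpace.single j 1) = (p j - q j) / ‖p - q‖ := by
    simp [EuclideanSpace.inner_single_right]
    field_simp
  rw [← e]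
  exact h1

/-- The lines where the stream function of the filled kite need not be differentiable. -/
def creases (c s L : ℝ) (q : Plane) : Set Plane :=
  {p | p 1 = q 1 ∨ |p 1 - q 1| * c = (p 0 - q 0) * s ∨
    (p 0 - q 0) * (1 + c) + |p 1 - q 1| * s = L * (1 + c) ∨
    ‖p - q‖ + (p 0 - q 0) = L * (1 + c)}

theorem isClosed_creases (c s L : ℝ) (q : Plane) : IsClosed (creases c s L q) := by
  refine (isClosed_eq (f := fun p : Plane => p 1) (g := fun _ => q 1) (by fun_prop)
    (by fun_prop)).union ?_
  refine (isClosed_eq (f := fun p : Plane => |p 1 - q 1| * c) (g := fun p => (p 0 - q 0) * s)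
    (by fun_prop) (by fun_prop)).union ?_
  exact (isClosed_eq (f := fun p : Plane => (p 0 - q 0) * (1 + c) + |p 1 - q 1| * s)
    (g := fun _ => L * (1 + c)) (by fun_prop) (by fun_prop)).union
    (isClosed_eq (f := fun p : Plane => ‖p - q‖ + (p 0 - q 0)) (g := fun _ => L * (1 + c))
      (by fun_prop) (by fun_prop))

/-- One row is exempt because the creases contain the whole axis. -/
theorem volume_eq_zero_of_rows {A : Set Plane} (hA : MeasurableSet A) (y₀ : ℝ)
    (h : ∀ y, y ≠ y₀ → {x : ℝ | (!₂[x, y] : Plane) ∈ A}.Finite) : volume A = 0 := by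
  rw [← lintegral_indicator_one hA, lintegral_eq_rows 
    (show Measurable (A.indicator (1 : Plane → ℝ≥0∞)) from measurable_one.indicator hA)]
  refine (lintegral_congr_ae ?_).trans lintegral_zero
  filter_upwards [compl_mem_ae_iff.2 (measure_singleton y₀)] with y hy
  have hnull := (h y hy).measure_zero volume
  refine (lintegral_congr_ae ?_).trans lintegral_zero
  filter_upwards [compl_mem_ae_iff.2 hnull] with x hx
  exact indicator_of_notMem (s := A) hx (1 : Plane → ℝ≥0∞)

/-- The arc of parabola `{‖p - q‖ + (p 0 - q 0) = C}` as a graph over the second coordinate. -/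
theorem eq_of_norm_add_eq {q p : Plane} {C : ℝ} (hC : 0 < C) (h : ‖p - q‖ + (p 0 - q 0) = C) :
    p 0 - q 0 = (C ^ 2 - (p 1 - q 1) ^ 2) / (2 * C) := by
  have h2 := norm_sq_plane_eq (p - q)
  simp only [PiLp.sub_apply] at h2
  have h3 : ‖p - q‖ = C - (p 0 - q 0) := by linarith
  rw [h3] at h2
  rw [eq_div_iff (by positivity)]
  linarith

theorem volume_creases (hc : 0 < c) (hs : 0 < s) (hL : 0 < L) (q : Plane) :
    volume (creases c s L q) = 0 := by
  refine volume_eq_zero_of_rows (isClosed_creases c s L q).measurableSet (q 1) fun y hy => ?_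
  have hfin : ({|y - q 1| * c / s + q 0, (L * (1 + c) - |y - q 1| * s) / (1 + c) + q 0,
    ((L * (1 + c)) ^ 2 - (y - q 1) ^ 2) / (2 * (L * (1 + c))) + q 0} : Set ℝ).Finite := by simp
  refine hfin.subset fun x hx => ?_
  rcases hx with h | h | h | h
  · exact absurd (by simpa using h) hy
  · left
    simp at h
    field_simp
    linarith
  · right; left
    simp at h
    field_simp
    linarith
  · right; right
    have := eq_of_norm_add_eq (by positivity) h
    simp at this ⊢
    linarith

theorem hasLineDerivAt_outerPot (c s : ℝ) {y₀ : ℝ} {p : Plane} (h : p 1 ≠ y₀) :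
    HasLineDerivAt ℝ (outerPot c s y₀) (outer c s y₀ p 1) p (EuclideanSpace.single 0 1) ∧
    HasLineDerivAt ℝ (outerPot c s y₀) (-outer c s y₀ p 0) p (EuclideanSpace.single 1 1) := by
  have key : ∀ j : Fin 2, HasLineDerivAt ℝ (outerPot c s y₀)
      ((if 0 = j then 1 else 0) * c + (if 1 = j then (SignType.sign (p 1 - y₀) : ℝ) else 0) * s) p
      (EuclideanSpace.single j 1) := by
    intro j
    have h1 := hasLineDerivAt_apply_sub 0 j 0 p
    have h2 := hasLineDerivAt_abs_sub 1 j y₀ h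
    simp only [sub_zero] at h1
    exact (HasDerivAt.mul_const h1 c).add (HasDerivAt.mul_const h2 s)
  constructor
  · simpa [outer] using key 0
  · have := key 1
    rcases lt_or_gt_of_ne h with h | h
    · simpa [outer, not_lt.2 h.le, sign_neg (sub_neg.2 h)] using this
    · simpa [outer, h, sign_pos (sub_pos.2 h)] using this

/-- Off the creases a neighbourhood of `p` lies in one of three regions (vortex, constant field,
exterior), and on each of them the potential has a single smooth formula near `p`. -/
theorem hasLineDerivAt_bumpPot (hcs : c ^ 2 + s ^ 2 = 1) {q p : Plane}
    (h : p ∉ creases c s L q) :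
    HasLineDerivAt ℝ (bumpPot c s L q) (bump c s L q p 1) p (EuclideanSpace.single 0 1) ∧
    HasLineDerivAt ℝ (bumpPot c s L q) (-bump c s L q p 0) p (EuclideanSpace.single 1 1) := by
  simp only [creases, mem_ofPred_eq, not_or] at h
  obtain ⟨hY, h1, h2, h3⟩ := h
  by_cases hk : p ∈ kite c s L q
  · have hout : ∀ i, HasLineDerivAt ℝ (fun p : Plane => (p 0 - q 0) * c + |p 1 - q 1| * s)
        ((if 0 = i then 1 else 0) * c + (if 1 = i then (SignType.sign (p 1 - q 1) : ℝ) else 0) * s)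
        p (EuclideanSpace.single i 1) := fun i =>
      (HasDerivAt.mul_const (hasLineDerivAt_apply_sub 0 i (q 0) p) c).add
        (HasDerivAt.mul_const (hasLineDerivAt_abs_sub 1 i (q 1) hY) s)
    have hk' := (isOpen_kite c s L q).mem_nhds hk
    have hsig : (SignType.sign (p 1 - q 1) : ℝ) * s = -outer c s (q 1) p 0 := by
      rcases lt_or_gt_of_ne hY with h | h
      · simp [outer, not_lt.2 h.le, sign_neg (sub_neg.2 h)]
      · simp [outer, h, sign_pos (sub_pos.2 h)]
    rcases lt_or_gt_of_ne h3 with h3 | h3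
    · have hpq : p ≠ q := by
        rintro rfl
        exact hY rfl
      have hev : bumpPot c s L q =ᶠ[𝓝 p]
          fun p => ‖p - q‖ - ((p 0 - q 0) * c + |p 1 - q 1| * s) := by
        have : ∀ᶠ p' : Plane in 𝓝 p, ‖p' - q‖ + (p' 0 - q 0) < L * (1 + c) :=
          (show ContinuousAt (fun p' : Plane => ‖p' - q‖ + (p' 0 - q 0)) p by
            fun_prop).tendsto.eventually_lt_const h3
        filter_upwards [hk', this] with p' hp' hp2
        rw [bumpPot_of_mem hcs hp', min_eq_left (by linarith)]
      have hb : bump c s L q p = fan q p - outer c s (q 1) p := by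
        rw [bump, if_pos hk, core, if_pos h3]
      constructor
      · refine HasLineDerivAt.congr_of_eventuallyEq ?_ hev
        have := hasLineDerivAt_sub (hasLineDerivAt_norm_sub 0 hpq) (hout 0)
        rw [hb]
        simpa [fan, outer] using this
      · refine HasLineDerivAt.congr_of_eventuallyEq ?_ hev
        have := hasLineDerivAt_sub (hasLineDerivAt_norm_sub 1 hpq) (hout 1)
        simp only [zero_ne_one, if_true, if_false, zero_mul, zero_add, hsig] at this
        have e : -(bump c s L q p 0) = (p 1 - q 1) / ‖p - q‖ - -(outer c s (q 1) p 0) := by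
          rw [hb]
          simp [fan]
          ring
        rw [e]
        exact this
    · have hev : bumpPot c s L q =ᶠ[𝓝 p]
          fun p => (L * (1 + c) - (p 0 - q 0)) - ((p 0 - q 0) * c + |p 1 - q 1| * s) := by
        have : ∀ᶠ p' : Plane in 𝓝 p, L * (1 + c) < ‖p' - q‖ + (p' 0 - q 0) :=
          (show ContinuousAt (fun p' : Plane => ‖p' - q‖ + (p' 0 - q 0)) p by
            fun_prop).tendsto.eventually_const_lt h3
        filter_upwards [hk', this] with p' hp' hp2
        rw [bumpPot_of_mem hcs hp', min_eq_right (by linarith)]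
      have hb : bump c s L q p = !₂[0, -1] - outer c s (q 1) p := by
        rw [bump, if_pos hk, core, if_neg (not_lt.2 h3.le)]
      have hlin := fun i => hasLineDerivAt_sub (hasLineDerivAt_const (L * (1 + c)) p _)
        (hasLineDerivAt_apply_sub 0 i (q 0) p)
      constructor
      · refine HasLineDerivAt.congr_of_eventuallyEq ?_ hev
        have := hasLineDerivAt_sub (hlin 0) (hout 0)
        rw [hb]
        simpa [outer] using this
      · refine HasLineDerivAt.congr_of_eventuallyEq ?_ hev
        have := hasLineDerivAt_sub (hlin 1) (hout 1)
        simp only [zero_ne_one, if_true, if_false, zero_mul, zero_add, hsig] at this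
        have e : -(bump c s L q p 0) = 0 - 0 - -(outer c s (q 1) p 0) := by
          rw [hb]
          simp
        rw [e]
        exact this
  · have hev : bumpPot c s L q =ᶠ[𝓝 p] fun _ => 0 := by
      have : ∀ᶠ p' in 𝓝 p, p' ∉ kite c s L q := by
        rcases lt_or_gt_of_ne h1 with h1 | h1
        · have h2' : L * (1 + c) < (p 0 - q 0) * (1 + c) + |p 1 - q 1| * s :=
            lt_of_le_of_ne (not_lt.1 fun h => hk ⟨h1, h⟩) (Ne.symm h2)
          have := (show ContinuousAt (fun p : Plane => (p 0 - q 0) * (1 + c) + |p 1 - q 1| * s) p by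
            fun_prop).tendsto.eventually_const_lt h2'
          filter_upwards [this] with p' hp' hp2
          exact lt_asymm hp' hp2.2
        · have := ContinuousAt.eventually_lt (x₀ := p) (f := fun p : Plane => (p 0 - q 0) * s)
            (g := fun p : Plane => |p 1 - q 1| * c) (by fun_prop) (by fun_prop) h1
          filter_upwards [this] with p' hp' hp2
          exact lt_asymm hp' hp2.1
      filter_upwards [this] with p' hp'
      exact bumpPot_of_notMem hp'
    rw [bump_of_notMem hk]
    constructor
    · refine HasLineDerivAt.congr_of_eventuallyEq ?_ hev
      exact hasLineDerivAt_const _ _ _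
    · refine HasLineDerivAt.congr_of_eventuallyEq ?_ hev
      simpa using hasLineDerivAt_const 0 p _

end StreamFunction

/-! ### Rows of kites as admissible competitors -/

section Chain

/-- The base points of a row of kites of length `L` starting at `(a, y₀)`. -/
noncomputable def node (L a y₀ : ℝ) (k : ℕ) : Plane := !₂[a + k * L, y₀]

/-- The outer field with a row of `N` consecutive filled kites along its jump line. -/
noncomputable def chain (c s L a y₀ : ℝ) (N : ℕ) (p : Plane) : Plane :=
  outer c s y₀ p + ∑ k ∈ Finset.range N, bump c s L (node L a y₀ k) p

@[simp] theorem node_zero (L a y₀ : ℝ) (k : ℕ) : node L a y₀ k 0 = a + k * L := rfl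
@[simp] theorem node_one (L a y₀ : ℝ) (k : ℕ) : node L a y₀ k 1 = y₀ := rfl

variable {c s L a y₀ : ℝ} {N : ℕ}

theorem chain_eq_outer {p : Plane} (h : ∀ k < N, p ∉ kite c s L (node L a y₀ k)) :
    chain c s L a y₀ N p = outer c s y₀ p := by
  rw [chain, Finset.sum_eq_zero, add_zero]
  exact fun k hk => bump_of_notMem (h k (Finset.mem_range.1 hk))

theorem chain_eq_outer_add_bump {p : Plane} {k : ℕ} (hk : k < N)
    (h : ∀ j < N, j ≠ k → p ∉ kite c s L (node L a y₀ j)) :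
    chain c s L a y₀ N p = outer c s y₀ p + bump c s L (node L a y₀ k) p := by
  rw [chain, Finset.sum_eq_single k]
  · exact fun j hj hjk => bump_of_notMem (h j (Finset.mem_range.1 hj) hjk)
  · exact fun h => absurd (Finset.mem_range.2 hk) h

/-- The kites lie in consecutive disjoint vertical strips of width L, so at most one term of the sum
defining `chain` is nonzero at a point. -/
theorem eq_of_mem_kite (hc : 0 < c) (hs : 0 < s) (hcs : c ^ 2 + s ^ 2 = 1) {p : Plane} {j k : ℕ}
    (hj : p ∈ kite c s L (node L a y₀ j)) (hk : p ∈ kite c s L (node L a y₀ k)) : j = k := by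
  have h1 := (abs_lt_of_mem_kite hc hs hcs hj).2
  have h2 := (abs_lt_of_mem_kite hc hs hcs hk).2
  simp only [node_zero] at h1 h2
  have hL : 0 < L := h1.1.trans h1.2
  by_contra hne
  rcases Nat.lt_or_gt_of_ne hne with h | h
  · have : (j : ℝ) + 1 ≤ k := by exact_mod_cast h
    nlinarith
  · have : (k : ℝ) + 1 ≤ j := by exact_mod_cast h
    nlinarith

theorem chain_eq_core (hc : 0 < c) (hs : 0 < s) (hcs : c ^ 2 + s ^ 2 = 1) {p : Plane} {k : ℕ}
    (hk : k < N) (h : p ∈ kite c s L (node L a y₀ k)) :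
    chain c s L a y₀ N p = core c L (node L a y₀ k) p := by
  rw [chain_eq_outer_add_bump hk fun j _ hjk hj => hjk (eq_of_mem_kite hc hs hcs hj h), bump,
    if_pos h, node_one, add_sub_cancel]

theorem norm_core {q p : Plane} (h : p ≠ q) : ‖core c L q p‖ = 1 := by
  rw [core]
  split_ifs
  · exact norm_fan h
  · rw [norm_plane_eq]; simp

theorem ne_of_mem_kite (hc : 0 < c) (hs : 0 < s) (hcs : c ^ 2 + s ^ 2 = 1) {q p : Plane}
    (h : p ∈ kite c s L q) : p ≠ q := by
  rintro rfl
  simpa using (abs_lt_of_mem_kite hc hs hcs h).2.1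

theorem norm_chain (hc : 0 < c) (hs : 0 < s) (hcs : c ^ 2 + s ^ 2 = 1) (p : Plane) :
    ‖chain c s L a y₀ N p‖ = 1 := by
  by_cases h : ∃ k < N, p ∈ kite c s L (node L a y₀ k)
  · obtain ⟨k, hk, hp⟩ := h
    rw [chain_eq_core hc hs hcs hk hp, norm_core (ne_of_mem_kite hc hs hcs hp)]
  · push Not at h
    rw [chain_eq_outer h, norm_outer hcs]

theorem measurable_chain (c s L a y₀ : ℝ) (N : ℕ) : Measurable (chain c s L a y₀ N) :=
  (measurable_outer c s y₀).add (Finset.measurable_fun_sum _ fun _ _ => measurable_bump _ _ _ _)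

theorem totalVariation_outer_le (hcs : c ^ 2 + s ^ 2 = 1) (y₀ : ℝ) {Ω : Set Plane} {R : ℝ}
    (hR : 0 < R) (hΩ : Ω ⊆ Metric.closedBall 0 R) :
    totalVariation Ω (outer c s y₀) ≤ ENNReal.ofReal (4 * (8 * R)) :=
  totalVariation_le hΩ (fun i p => abs_outer_le hcs y₀ p i) (by positivity)
    fun i => transBound_outer hcs y₀ i R

theorem totalVariation_chain_le (hc : 0 < c) (hs : 0 < s) (hcs : c ^ 2 + s ^ 2 = 1) (hL : 0 < L)
    (a y₀ : ℝ) (N : ℕ) {Ω : Set Plane} {R : ℝ} (hR : 0 < R) (hΩ : Ω ⊆ Metric.closedBall 0 R) :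
    totalVariation Ω (chain c s L a y₀ N) ≤ ENNReal.ofReal (4 * (8 * R + N * (24 * L))) := by
  refine totalVariation_le hΩ (B := 1) (fun i p => ?_) (by positivity) fun i => ?_
  · exact (PiLp.norm_apply_le _ i).trans (norm_chain hc hs hcs p).le
  · have h := (transBound_outer hcs y₀ i R).add (by positivity) (by positivity)
      (TransBound.sum (by positivity) (fun k => transBound_bump hc hs hcs hL (node L a y₀ k) i
        (measurableSet_closedBall (x := (0 : Plane)) (ε := R))) N)
    simpa [chain] using h

theorem isDivergenceFree_outer (c s y₀ : ℝ) (Ω : Set Plane) :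
    IsDivergenceFree Ω (outer c s y₀) := by
  obtain ⟨K, hK⟩ := exists_lipschitzWith_outerPot c s y₀
  refine IsDivergenceFree.of_lipschitz hK ?_
  have hnull : volume {p : Plane | p 1 = y₀} = 0 := by
    refine volume_eq_zero_of_rows ?_ y₀ fun y hy => ?_
    · exact (isClosed_eq (f := fun p : Plane => p 1) (g := fun _ => y₀) (by fun_prop)
        (by fun_prop)).measurableSet
    · convert finite_empty
      ext x
      simpa using hy
  filter_upwards [compl_mem_ae_iff.2 hnull] with p hp
  exact hasLineDerivAt_outerPot c s hp

theorem hasLineDerivAt_sum {f : ℕ → Plane → ℝ} {f' : ℕ → ℝ} {p v : Plane}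
    (h : ∀ k, HasLineDerivAt ℝ (f k) (f' k) p v) (N : ℕ) :
    HasLineDerivAt ℝ (fun x => ∑ k ∈ Finset.range N, f k x) (∑ k ∈ Finset.range N, f' k) p v := by
  simp only [HasLineDerivAt] at h ⊢
  exact HasDerivAt.fun_sum fun k _ => h k

theorem exists_lipschitzWith_sum {f : ℕ → Plane → ℝ} (h : ∀ k, ∃ K, LipschitzWith K (f k))
    (N : ℕ) : ∃ K, LipschitzWith K fun p => ∑ k ∈ Finset.range N, f k p := by
  induction N with
  | zero => exact ⟨0, LipschitzWith.const (0 : ℝ)⟩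
  | succ n ih =>
    obtain ⟨K₁, h₁⟩ := ih
    obtain ⟨K₂, h₂⟩ := h n
    simp only [Finset.sum_range_succ]
    exact ⟨_, h₁.add h₂⟩

theorem isDivergenceFree_chain (hc : 0 < c) (hs : 0 < s) (hcs : c ^ 2 + s ^ 2 = 1) (hL : 0 < L)
    (a y₀ : ℝ) (N : ℕ) (Ω : Set Plane) : IsDivergenceFree Ω (chain c s L a y₀ N) := by
  obtain ⟨K₁, h₁⟩ := exists_lipschitzWith_outerPot c s y₀
  obtain ⟨K₂, h₂⟩ := exists_lipschitzWith_sum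
    (fun k => exists_lipschitzWith_bumpPot hc hs hcs L (node L a y₀ k)) N
  refine IsDivergenceFree.of_lipschitz (h₁.add h₂) ?_
  have hae : ∀ᵐ p : Plane, ∀ k : ℕ, p ∉ creases c s L (node L a y₀ k) :=
    ae_all_iff.2 fun k => compl_mem_ae_iff.2 (volume_creases hc hs hL _)
  filter_upwards [hae] with p hp
  have hY : p 1 ≠ y₀ := fun h => hp 0 (Or.inl h)
  have e0 := hasLineDerivAt_outerPot c s hY
  have e1 := fun k => hasLineDerivAt_bumpPot (s := s) hcs (hp k)
  constructor
  · have h := HasDerivAt.add e0.1 (hasLineDerivAt_sum (fun k => (e1 k).1) N)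
    have e : chain c s L a y₀ N p 1
        = outer c s y₀ p 1 + ∑ k ∈ Finset.range N, bump c s L (node L a y₀ k) p 1 := by
      simp [chain]
    rw [e]
    exact h
  · have h := HasDerivAt.add e0.2 (hasLineDerivAt_sum (fun k => (e1 k).2) N)
    have e : -(chain c s L a y₀ N p 0)
        = -(outer c s y₀ p 0) + ∑ k ∈ Finset.range N, -(bump c s L (node L a y₀ k) p 0) := by
      simp [chain]
      ring
    rw [e]
    exact h

theorem integrableOn_of_norm_le {Ω : Set Plane} (hΩ : Bornology.IsBounded Ω) {m : Plane → Plane}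
    (hm : Measurable m) (h : ∀ p, ‖m p‖ = 1) : IntegrableOn m Ω :=
  Measure.integrableOn_of_bounded (M := 1) hΩ.measure_lt_top.ne hm.aestronglyMeasurable
    (Eventually.of_forall fun p => (h p).le)

theorem outer_mem_admissible (hcs : c ^ 2 + s ^ 2 = 1) (y₀ : ℝ) {Ω : Set Plane}
    (hΩ : Bornology.IsBounded Ω) : outer c s y₀ ∈ admissible Ω := by
  obtain ⟨R, hR, hΩR⟩ := hΩ.subset_closedBall_lt 0 (0 : Plane)
  exact ⟨⟨integrableOn_of_norm_le hΩ (measurable_outer c s y₀) (norm_outer hcs y₀),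
    (totalVariation_outer_le hcs y₀ hR hΩR).trans_lt ENNReal.ofReal_lt_top⟩,
    Eventually.of_forall (norm_outer hcs y₀), isDivergenceFree_outer c s y₀ Ω⟩

theorem chain_mem_admissible (hc : 0 < c) (hs : 0 < s) (hcs : c ^ 2 + s ^ 2 = 1) (hL : 0 < L)
    (a y₀ : ℝ) (N : ℕ) {Ω : Set Plane} (hΩ : Bornology.IsBounded Ω) :
    chain c s L a y₀ N ∈ admissible Ω := by
  obtain ⟨R, hR, hΩR⟩ := hΩ.subset_closedBall_lt 0 (0 : Plane)
  exact ⟨⟨integrableOn_of_norm_le hΩ (measurable_chain c s L a y₀ N) (norm_chain hc hs hcs),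
    (totalVariation_chain_le hc hs hcs hL a y₀ N hR hΩR).trans_lt ENNReal.ofReal_lt_top⟩,
    Eventually.of_forall (norm_chain hc hs hcs), isDivergenceFree_chain hc hs hcs hL a y₀ N Ω⟩

/-- The two unit fields differ by at most 2, and only in the strip of height 2 L s around the axis,
whatever the number of kites. -/
theorem lintegral_chain_sub_outer_le (hc : 0 < c) (hs : 0 < s) (hcs : c ^ 2 + s ^ 2 = 1)
    (hL : 0 < L) (a y₀ : ℝ) (N : ℕ) {Ω : Set Plane} {R : ℝ} (hR : 0 < R)
    (hΩ : Ω ⊆ Metric.closedBall 0 R) :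
    ∫⁻ p in Ω, ‖chain c s L a y₀ N p - outer c s y₀ p‖ₑ ≤ ENNReal.ofReal (8 * R * L) := by
  set B : Set Plane := {p | p 0 ∈ Icc (-R) R ∧ p 1 ∈ Ioo (y₀ - L * s) (y₀ + L * s)} with hB
  have hBm : MeasurableSet B := by
    refine MeasurableSet.inter ?_ ?_
    · exact (isClosed_Icc.preimage (f := fun p : Plane => p 0) (by fun_prop)).measurableSet
    · exact (isOpen_Ioo.preimage (f := fun p : Plane => p 1) (by fun_prop)).measurableSet
  have hBv : volume B = ENNReal.ofReal (2 * R) * ENNReal.ofReal (2 * (L * s)) := by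
    rw [← measurePreserving_coords.measure_preimage hBm.nullMeasurableSet]
    have : (fun z : ℝ × ℝ => (!₂[z.1, z.2] : Plane)) ⁻¹' B
        = Icc (-R) R ×ˢ Ioo (y₀ - L * s) (y₀ + L * s) := by
      ext z; simp [hB]
    rw [this, Measure.volume_eq_prod, Measure.prod_prod, Real.volume_Icc, Real.volume_Ioo]
    congr 2 <;> ring
  have hs1 : s ≤ 1 := by nlinarith [sq_nonneg c]
  calc ∫⁻ p in Ω, ‖chain c s L a y₀ N p - outer c s y₀ p‖ₑ
      ≤ ∫⁻ p in Metric.closedBall 0 R, ‖chain c s L a y₀ N p - outer c s y₀ p‖ₑ :=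
        lintegral_mono_set hΩ
    _ ≤ ∫⁻ p, B.indicator (fun _ => ENNReal.ofReal 2) p := by
        rw [← lintegral_indicator measurableSet_closedBall]
        refine lintegral_mono fun p => ?_
        by_cases hp : p ∈ Metric.closedBall (0 : Plane) R
        · rw [indicator_of_mem hp]
          by_cases hpB : p ∈ B
          · rw [indicator_of_mem hpB, ← ofReal_norm]
            refine ENNReal.ofReal_le_ofReal ((norm_sub_le _ _).trans ?_)
            rw [norm_chain hc hs hcs, norm_outer hcs]
            norm_num
          · rw [chain_eq_outer, sub_self, enorm_zero]
            · exact zero_le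
            · intro k _ hk
              refine hpB ⟨?_, ?_⟩
              · exact abs_le.1 ((PiLp.norm_apply_le p 0).trans (mem_closedBall_zero_iff.1 hp))
              · have := abs_lt.1 (abs_lt_of_mem_kite hc hs hcs hk).1
                simp only [node_one] at this
                constructor <;> linarith
        · rw [indicator_of_notMem hp]
          exact zero_le
    _ = ENNReal.ofReal (8 * R * (L * s)) := by
        rw [lintegral_indicator_const hBm, hBv, ← ENNReal.ofReal_mul (by positivity),
          ← ENNReal.ofReal_mul (by positivity)]
        congr 1
        ring
    _ ≤ _ := by
        refine ENNReal.ofReal_le_ofReal ?_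
        have : L * s ≤ L * 1 := by gcongr
        nlinarith

end Chain

/-! ### Jumps of the field near one kite -/

section LocalStructure

variable {c s L a y₀ : ℝ} {N : ℕ}

theorem outer_of_lt {p : Plane} (h : y₀ < p 1) : outer c s y₀ p = !₂[-s, c] := by
  rw [outer, if_pos h]

theorem outer_of_le {p : Plane} (h : p 1 ≤ y₀) : outer c s y₀ p = !₂[s, c] := by
  rw [outer, if_neg (not_lt.2 h)]

theorem tendsto_apply (p : Plane) (i : Fin 2) : Tendsto (fun p : Plane => p i) (𝓝 p) (𝓝 (p i)) :=
  (show ContinuousAt (fun p : Plane => p i) p by fun_prop).tendsto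

theorem outer_eventuallyEq {p : Plane} (h : p 1 ≠ y₀) :
    outer c s y₀ =ᶠ[𝓝 p] fun _ => outer c s y₀ p := by
  rcases lt_or_gt_of_ne h with h | h
  · filter_upwards [(tendsto_apply p 1).eventually_lt_const h] with p' hp'
    rw [outer_of_le h.le, outer_of_le hp'.le]
  · filter_upwards [(tendsto_apply p 1).eventually_const_lt h] with p' hp'
    rw [outer_of_lt h, outer_of_lt hp']

theorem hasDerivAt_apply_line (x z : Plane) (i : Fin 2) :
    HasDerivAt (fun r : ℝ => (x + r • z) i) (z i) 0 := by
  have : (fun r : ℝ => (x + r • z) i) = fun r : ℝ => x i + r * z i := by ext r; simp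
  rw [this]
  simpa using ((hasDerivAt_id (0 : ℝ)).mul_const (z i)).const_add (x i)

theorem not_isJumpPoint_of_outer {m : Plane → Plane} {p : Plane}
    (hm : ∀ᶠ p' in 𝓝 p, m p' = outer c s y₀ p') (h : p 1 ≠ y₀) :
    ¬ ∃ a b ν, IsJumpPoint m p a b ν := by
  refine not_isJumpPoint_of_eventually (A := fun _ => outer c s y₀ p)
    (B := fun _ => outer c s y₀ p) continuousAt_const continuousAt_const rfl ?_
  filter_upwards [hm, outer_eventuallyEq (c := c) (s := s) h] with p' h1 h2
  exact Or.inl (h1.trans h2)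

theorem isJumpPoint_of_outer (hs : 0 < s) {m : Plane → Plane} (hmm : Measurable m)
    (hm1 : ∀ p, ‖m p‖ ≤ 1) {p : Plane}
    (hm : ∀ᶠ p' in 𝓝 p, m p' = outer c s y₀ p') (h : p 1 = y₀) :
    (∃ a b ν, IsJumpPoint m p a b ν) ∧ jumpSize m p = 2 * s := by
  have hne : (!₂[-s, c] : Plane) ≠ !₂[s, c] := fun h => by
    have := congrArg (fun v : Plane => v 0) h
    simp at this
    linarith
  have hj : ∃ a b ν, IsJumpPoint m p a b ν := by
    refine exists_isJumpPoint_of_level hmm hm1 (A := fun _ => !₂[-s, c]) (B := fun _ => !₂[s, c])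
      (g := fun p => p 1 - y₀) (w := EuclideanSpace.single 1 1) ?_ (sub_eq_zero.2 h) ?_
      continuousAt_const continuousAt_const hne ?_ ?_
    · intro h0
      have := congrArg (fun v : Plane => v 1) h0
      simp at this
    · intro z
      have := (hasDerivAt_apply_line p z 1).sub_const y₀
      simpa [EuclideanSpace.inner_single_right] using this
    · filter_upwards [hm] with p' h1 h2
      rw [h1, outer_of_lt (sub_pos.1 h2)]
    · filter_upwards [hm] with p' h1 h2
      rw [h1, outer_of_le (sub_neg.1 h2).le]
  refine ⟨hj, ?_⟩
  rw [jumpSize_eq (A := fun _ => !₂[-s, c]) (B := fun _ => !₂[s, c]) continuousAt_const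
    continuousAt_const ?_ hj, norm_plane_eq]
  · simp
    rw [show -s - s = -(2 * s) by ring, neg_sq, Real.sqrt_sq (by positivity)]
  · filter_upwards [hm] with p' h1
    rcases lt_or_ge y₀ (p' 1) with h | h
    · exact Or.inl (h1.trans (outer_of_lt h))
    · exact Or.inr (h1.trans (outer_of_le h))

/-- The arc of parabola in the kite, across which the vortex meets the constant field. -/
def arc (c s L : ℝ) (q : Plane) : Set Plane :=
  {p | p ∈ kite c s L q ∧ ‖p - q‖ + (p 0 - q 0) = L * (1 + c)}

/-- The open sides of the kite adjacent to the vertex `q + (L, 0)`. -/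
def sides (c s L : ℝ) (q : Plane) : Set Plane :=
  {p | |p 1 - q 1| * c < (p 0 - q 0) * s ∧
    (p 0 - q 0) * (1 + c) + |p 1 - q 1| * s = L * (1 + c)}

def closedKite (c s L : ℝ) (q : Plane) : Set Plane :=
  {p | |p 1 - q 1| * c ≤ (p 0 - q 0) * s ∧ (p 0 - q 0) * (1 + c) + |p 1 - q 1| * s ≤ L * (1 + c)}

theorem continuousAt_fan {q p : Plane} (h : p ≠ q) : ContinuousAt (fan q) p := by
  have hn : ‖p - q‖ ≠ 0 := norm_ne_zero_iff.2 (sub_ne_zero.2 h)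
  have h0 : ContinuousAt (fun p' : Plane => -(p' 1 - q 1) / ‖p' - q‖) p :=
    ContinuousAt.div (by fun_prop) (by fun_prop) hn
  have h1 : ContinuousAt (fun p' : Plane => (p' 0 - q 0) / ‖p' - q‖) p :=
    ContinuousAt.div (by fun_prop) (by fun_prop) hn
  refine (PiLp.continuous_toLp 2 fun _ : Fin 2 => ℝ).continuousAt.comp
    (continuousAt_pi.2 fun i => ?_)
  fin_cases i
  · exact h0
  · exact h1

theorem norm_fan_sub {q p : Plane} (h : p ≠ q) :
    ‖fan q p - !₂[0, -1]‖ = √(2 + 2 * ((p 0 - q 0) / ‖p - q‖)) := by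
  have hn : ‖p - q‖ ≠ 0 := norm_ne_zero_iff.2 (sub_ne_zero.2 h)
  have h2 := norm_sq_plane_eq (p - q)
  simp only [PiLp.sub_apply] at h2
  rw [norm_plane_eq]
  congr 1
  simp [fan]
  field_simp
  linarith

theorem norm_outer_sub (hcs : c ^ 2 + s ^ 2 = 1) (y₀ : ℝ) (p : Plane) :
    ‖outer c s y₀ p - !₂[0, -1]‖ = √(2 + 2 * c) := by
  rw [norm_plane_eq]
  congr 1
  simp only [outer]
  split_ifs <;> simp <;> linarith

theorem eventually_notMem_kite {q p : Plane} (h : p ∉ closedKite c s L q) :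
    ∀ᶠ p' in 𝓝 p, p' ∉ kite c s L q := by
  have hcl : IsClosed (closedKite c s L q) :=
    (isClosed_le (f := fun p : Plane => |p 1 - q 1| * c) (g := fun p => (p 0 - q 0) * s)
      (by fun_prop) (by fun_prop)).inter
    (isClosed_le (f := fun p : Plane => (p 0 - q 0) * (1 + c) + |p 1 - q 1| * s)
      (g := fun _ => L * (1 + c)) (by fun_prop) (by fun_prop))
  filter_upwards [hcl.isOpen_compl.mem_nhds h] with p' hp' hk
  exact hp' ⟨hk.1.le, hk.2.le⟩

theorem eventually_fan_side {q p : Plane} (h : ‖p - q‖ + (p 0 - q 0) < L * (1 + c)) :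
    ∀ᶠ p' : Plane in 𝓝 p, ‖p' - q‖ + (p' 0 - q 0) < L * (1 + c) :=
  (show ContinuousAt (fun p' : Plane => ‖p' - q‖ + (p' 0 - q 0)) p by
    fun_prop).tendsto.eventually_lt_const h

theorem eventually_far_side {q p : Plane} (h : L * (1 + c) < ‖p - q‖ + (p 0 - q 0)) :
    ∀ᶠ p' : Plane in 𝓝 p, L * (1 + c) < ‖p' - q‖ + (p' 0 - q 0) :=
  (show ContinuousAt (fun p' : Plane => ‖p' - q‖ + (p' 0 - q 0)) p by
    fun_prop).tendsto.eventually_const_lt h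

section Local

variable {m : Plane → Plane} {q p : Plane}

theorem eventually_eq_core (hm : ∀ᶠ p' in 𝓝 p, m p' = outer c s (q 1) p' + bump c s L q p')
    (hk : p ∈ kite c s L q) : ∀ᶠ p' in 𝓝 p, m p' = core c L q p' := by
  filter_upwards [hm, (isOpen_kite c s L q).mem_nhds hk] with p' h1 h2
  rw [h1, bump, if_pos h2, add_sub_cancel]

theorem not_isJumpPoint_of_mem_kite (hpq : p ≠ q)
    (hm : ∀ᶠ p' in 𝓝 p, m p' = outer c s (q 1) p' + bump c s L q p')
    (hk : p ∈ kite c s L q) (h : ‖p - q‖ + (p 0 - q 0) ≠ L * (1 + c)) :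
    ¬ ∃ a b ν, IsJumpPoint m p a b ν := by
  rcases lt_or_gt_of_ne h with h | h
  · refine not_isJumpPoint_of_eventually (A := fan q) (B := fan q) (continuousAt_fan hpq)
      (continuousAt_fan hpq) rfl ?_
    filter_upwards [eventually_eq_core hm hk, eventually_fan_side h] with p' h1 h2
    rw [h1, core, if_pos h2]
    exact Or.inl rfl
  · refine not_isJumpPoint_of_eventually (A := fun _ => !₂[0, -1]) (B := fun _ => !₂[0, -1])
      continuousAt_const continuousAt_const rfl ?_
    filter_upwards [eventually_eq_core hm hk, eventually_far_side h] with p' h1 h2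
    rw [h1, core, if_neg (not_lt.2 h2.le)]
    exact Or.inl rfl

theorem hasDerivAt_norm_line (hpq : p ≠ q) (z : Plane) :
    HasDerivAt (fun r : ℝ => ‖p + r • z - q‖) (inner ℝ z (‖p - q‖⁻¹ • (p - q))) 0 := by
  have hn : 0 < ‖p - q‖ := norm_pos_iff.2 (sub_ne_zero.2 hpq)
  have h1 := (((hasFDerivAt_id p).sub_const q).norm_sq.sqrt (by positivity)).hasLineDerivAt z
  simp only [id, Real.sqrt_sq (norm_nonneg _)] at h1
  refine HasDerivAt.congr_deriv h1 ?_
  simp [real_inner_smul_right]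
  field_simp
  rw [← inner_sub_left, real_inner_comm]

/-- The squared jump is 2 + 2 X / |p - q|, and the quotient is at least c in the sector. It reaches
1, hence a jump of exactly 2, only on the axis, which explains the proviso on the second coordinate.
-/
theorem isJumpPoint_of_mem_arc (hc : 0 < c) (hs : 0 < s) (hcs : c ^ 2 + s ^ 2 = 1)
    (hmm : Measurable m) (hm1 : ∀ p, ‖m p‖ ≤ 1)
    (hm : ∀ᶠ p' in 𝓝 p, m p' = outer c s (q 1) p' + bump c s L q p')
    (hp : p ∈ arc c s L q) :
    (∃ a b ν, IsJumpPoint m p a b ν) ∧ (p 1 ≠ q 1 → jumpSize m p ∈ Ico (√(2 + 2 * c)) 2) := by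
  obtain ⟨hk, hC⟩ := hp
  have hpq := ne_of_mem_kite hc hs hcs hk
  have hn : 0 < ‖p - q‖ := norm_pos_iff.2 (sub_ne_zero.2 hpq)
  have hX := (abs_lt_of_mem_kite hc hs hcs hk).2.1
  have hne : fan q p ≠ !₂[0, -1] := by
    intro h
    have := congrArg (fun v : Plane => v 1) h
    simp [fan] at this
    have h2 : 0 < (p 0 - q 0) / ‖p - q‖ := by positivity
    linarith
  have hj : ∃ a b ν, IsJumpPoint m p a b ν := by
    refine exists_isJumpPoint_of_level hmm hm1 (A := fan q) (B := fun _ => !₂[0, -1])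
      (g := fun p => L * (1 + c) - (‖p - q‖ + (p 0 - q 0)))
      (w := -(‖p - q‖⁻¹ • (p - q) + EuclideanSpace.single 0 1)) ?_ (by simp only []; linarith) ?_
      (continuousAt_fan hpq) continuousAt_const hne ?_ ?_
    · intro h0
      have := congrArg (fun v : Plane => v 0) h0
      simp at this
      have h2 : 0 < ‖p - q‖⁻¹ * (p 0 - q 0) := by positivity
      linarith
    · intro z
      have h1 := ((hasDerivAt_norm_line hpq z).add
        ((hasDerivAt_apply_line p z 0).sub_const (q 0))).const_sub (L * (1 + c))
      refine h1.congr_deriv ?_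
      rw [inner_neg_right, inner_add_right]
      simp [EuclideanSpace.inner_single_right]
    · filter_upwards [eventually_eq_core hm hk] with p' h1 h2
      rw [h1, core, if_pos (by linarith)]
    · filter_upwards [eventually_eq_core hm hk] with p' h1 h2
      rw [h1, core, if_neg (by linarith)]
  refine ⟨hj, fun hY => ?_⟩
  rw [jumpSize_eq (A := fan q) (B := fun _ => !₂[0, -1]) (continuousAt_fan hpq)
    continuousAt_const ?_ hj, norm_fan_sub hpq]
  · constructor
    · refine Real.sqrt_le_sqrt ?_
      have := mul_norm_le_of_fan hcs hX.le hk.1.le hc.le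
      rw [← le_div_iff₀ hn] at this
      linarith
    · rw [Real.sqrt_lt' two_pos]
      have h2 := norm_sq_plane_eq (p - q)
      simp only [PiLp.sub_apply] at h2
      have h3 : 0 < (p 1 - q 1) ^ 2 := by
        have := sub_ne_zero.2 hY
        positivity
      have h4 : p 0 - q 0 < ‖p - q‖ := by
        refine lt_of_pow_lt_pow_left₀ 2 hn.le ?_
        linarith
      have : (p 0 - q 0) / ‖p - q‖ < 1 := (div_lt_one hn).2 h4
      linarith
  · filter_upwards [eventually_eq_core hm hk] with p' h1
    rw [h1, core]
    split_ifs
    · exact Or.inl rfl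
    · exact Or.inr rfl

theorem norm_eq_of_ray (hs : 0 < s) (hc : 0 < c) (hcs : c ^ 2 + s ^ 2 = 1)
    (h : |p 1 - q 1| * c = (p 0 - q 0) * s) : ‖p - q‖ * c = p 0 - q 0 := by
  have hX : 0 ≤ p 0 - q 0 := nonneg_of_mul_nonneg_left (by rw [← h]; positivity) hs
  have h2 := norm_sq_plane_eq (p - q)
  simp only [PiLp.sub_apply] at h2
  rw [← sq_eq_sq₀ (by positivity) hX, mul_pow, h2]
  have h3 : (|p 1 - q 1| * c) ^ 2 = ((p 0 - q 0) * s) ^ 2 := by rw [h]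
  rw [mul_pow, sq_abs] at h3
  nlinarith

/-- On the sides through `q` the position vector has direction (c, ±s), so the vortex takes the
outer value (∓s, c) there and the field is continuous across them. -/
theorem not_isJumpPoint_of_ray (hc : 0 < c) (hs : 0 < s) (hcs : c ^ 2 + s ^ 2 = 1)
    (hpq : p ≠ q) (hm : ∀ᶠ p' in 𝓝 p, m p' = outer c s (q 1) p' + bump c s L q p')
    (h1 : |p 1 - q 1| * c = (p 0 - q 0) * s)
    (h2 : (p 0 - q 0) * (1 + c) + |p 1 - q 1| * s < L * (1 + c)) :
    ¬ ∃ a b ν, IsJumpPoint m p a b ν := by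
  have hn : 0 < ‖p - q‖ := norm_pos_iff.2 (sub_ne_zero.2 hpq)
  have hr := norm_eq_of_ray hs hc hcs h1
  have hX : 0 < p 0 - q 0 := by rw [← hr]; positivity
  have hYs : |p 1 - q 1| = ‖p - q‖ * s := by
    have : |p 1 - q 1| * c = ‖p - q‖ * s * c := by rw [h1, ← hr]; ring
    exact mul_right_cancel₀ hc.ne' this
  have hY : p 1 ≠ q 1 := by
    intro h
    rw [h, sub_self, abs_zero] at hYs
    have : 0 < ‖p - q‖ * s := by positivity
    linarith
  have hfan : ‖p - q‖ + (p 0 - q 0) < L * (1 + c) := by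
    refine lt_of_le_of_lt (le_of_eq ?_) h2
    rw [hYs, ← hr]
    linear_combination (-‖p - q‖) * hcs
  have hval : outer c s (q 1) p = fan q p := by
    have e1 : (p 0 - q 0) / ‖p - q‖ = c := by rw [← hr]; field_simp
    rcases lt_or_gt_of_ne hY with h | h
    · have e2 : -(p 1 - q 1) / ‖p - q‖ = s := by
        rw [abs_of_neg (sub_neg.2 h)] at hYs
        rw [hYs]; field_simp
      rw [outer_of_le h.le, fan, e1, e2]
    · have e2 : -(p 1 - q 1) / ‖p - q‖ = -s := by
        rw [abs_of_pos (sub_pos.2 h)] at hYs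
        rw [hYs]; field_simp
      rw [outer_of_lt h, fan, e1, e2]
  refine not_isJumpPoint_of_eventually (A := fun _ => outer c s (q 1) p) (B := fan q)
    continuousAt_const (continuousAt_fan hpq) hval ?_
  filter_upwards [hm, eventually_fan_side hfan, outer_eventuallyEq (c := c) (s := s) hY]
    with p' h3 h4 h5
  by_cases hk : p' ∈ kite c s L q
  · right
    rw [h3, bump, if_pos hk, add_sub_cancel, core, if_pos h4]
  · left
    rw [h3, bump_of_notMem hk, add_zero, h5]

theorem isJumpPoint_of_mem_sides (hc : 0 < c) (hs : 0 < s) (hcs : c ^ 2 + s ^ 2 = 1)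
    (hmm : Measurable m) (hm1 : ∀ p, ‖m p‖ ≤ 1)
    (hm : ∀ᶠ p' in 𝓝 p, m p' = outer c s (q 1) p' + bump c s L q p')
    (hp : p ∈ sides c s L q) (hY : p 1 ≠ q 1) :
    (∃ a b ν, IsJumpPoint m p a b ν) ∧ jumpSize m p ∈ Ico (√(2 + 2 * c)) 2 := by
  obtain ⟨h1, h2⟩ := hp
  have hX : 0 < p 0 - q 0 := pos_of_mul_pos_left (lt_of_le_of_lt (by positivity) h1) hs.le
  -- Strict Cauchy–Schwarz inside the sector: the far sides lie beyond the parabola, so the inner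
  -- trace is the constant (0, -1).
  have hfar : L * (1 + c) < ‖p - q‖ + (p 0 - q 0) := by
    have : (p 0 - q 0) * c + |p 1 - q 1| * s < ‖p - q‖ := by
      rw [norm_plane_eq]
      refine Real.lt_sqrt_of_sq_lt ?_
      simp only [PiLp.sub_apply]
      have h3 : 0 < ((p 0 - q 0) * s - |p 1 - q 1| * c) ^ 2 := by
        have := sub_pos.2 h1
        positivity
      have h4 := sq_abs (p 1 - q 1)
      rw [← h4]
      have h5 : ((p 0 - q 0) * c + |p 1 - q 1| * s) ^ 2 + ((p 0 - q 0) * s - |p 1 - q 1| * c) ^ 2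
          = ((p 0 - q 0) ^ 2 + |p 1 - q 1| ^ 2) * (c ^ 2 + s ^ 2) := by ring
      rw [hcs] at h5
      linarith
    linarith
  have hne : outer c s (q 1) p ≠ !₂[0, -1] := by
    intro h
    have := congrArg (fun v : Plane => v 1) h
    simp [outer] at this
    linarith
  have hcone : ∀ᶠ p' : Plane in 𝓝 p, |p' 1 - q 1| * c < (p' 0 - q 0) * s :=
    ContinuousAt.eventually_lt (x₀ := p) (f := fun p : Plane => |p 1 - q 1| * c)
      (g := fun p : Plane => (p 0 - q 0) * s) (by fun_prop) (by fun_prop) h1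
  -- Away from the axis the absolute value is locally linear, so the side is the zero set of an
  -- affine function and its two halves are treated together.
  obtain ⟨σ, hσ, habs⟩ : ∃ σ : ℝ, (σ = 1 ∨ σ = -1) ∧
      ∀ᶠ p' : Plane in 𝓝 p, |p' 1 - q 1| = σ * (p' 1 - q 1) := by
    rcases lt_or_gt_of_ne hY with h | h
    · refine ⟨-1, Or.inr rfl, ?_⟩
      filter_upwards [(tendsto_apply p 1).eventually_lt_const h] with p' hp'
      rw [abs_of_neg (sub_neg.2 hp')]; ring
    · refine ⟨1, Or.inl rfl, ?_⟩
      filter_upwards [(tendsto_apply p 1).eventually_const_lt h] with p' hp'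
      rw [abs_of_pos (sub_pos.2 hp')]; ring
  have hj : ∃ a b ν, IsJumpPoint m p a b ν := by
    refine exists_isJumpPoint_of_level hmm hm1 (A := fun _ => outer c s (q 1) p)
      (B := fun _ => !₂[0, -1])
      (g := fun p => (p 0 - q 0) * (1 + c) + (p 1 - q 1) * (σ * s) - L * (1 + c))
      (w := !₂[1 + c, σ * s]) ?_ ?_ ?_ continuousAt_const continuousAt_const hne ?_ ?_
    · intro h0
      have := congrArg (fun v : Plane => v 0) h0
      simp at this
      linarith
    · have := habs.self_of_nhds
      rw [this] at h2
      simp only []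
      linarith
    · intro z
      have h3 := ((((hasDerivAt_apply_line p z 0).sub_const (q 0)).mul_const (1 + c)).add
        (((hasDerivAt_apply_line p z 1).sub_const (q 1)).mul_const (σ * s))).sub_const (L * (1 + c))
      refine h3.congr_deriv ?_
      simp [PiLp.inner_apply, Fin.sum_univ_two]
      ring
    · filter_upwards [hm, habs, outer_eventuallyEq (c := c) (s := s) hY] with p' e1 e2 e3 h3
      rw [e1, bump_of_notMem, add_zero, e3]
      intro hk
      have := hk.2
      rw [e2] at this
      linarith
    · filter_upwards [hm, habs, hcone, eventually_far_side hfar] with p' e1 e2 e3 e4 h3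
      have hk : p' ∈ kite c s L q := by
        refine ⟨e3, ?_⟩
        rw [e2]
        linarith
      rw [e1, bump, if_pos hk, add_sub_cancel, core, if_neg (not_lt.2 e4.le)]
  refine ⟨hj, ?_⟩
  rw [jumpSize_eq (A := fun _ => outer c s (q 1) p) (B := fun _ => !₂[0, -1]) continuousAt_const
    continuousAt_const ?_ hj, norm_outer_sub hcs]
  · refine ⟨le_rfl, ?_⟩
    rw [Real.sqrt_lt' two_pos]
    nlinarith [sq_nonneg s, sq_nonneg (1 - c)]
  · filter_upwards [hm, eventually_far_side hfar, outer_eventuallyEq (c := c) (s := s) hY]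
      with p' h3 h4 h5
    by_cases hk : p' ∈ kite c s L q
    · right
      rw [h3, bump, if_pos hk, add_sub_cancel, core, if_neg (not_lt.2 h4.le)]
    · left
      rw [h3, bump_of_notMem hk, add_zero, h5]

end Local

end LocalStructure

/-! ### The jump line of a row of kites -/

section ChainJump

variable {c s L a y₀ : ℝ} {N : ℕ}

theorem arc_subset_closedKite (q : Plane) : arc c s L q ⊆ closedKite c s L q :=
  fun _ h => ⟨h.1.1.le, h.1.2.le⟩

theorem sides_subset_closedKite (q : Plane) : sides c s L q ⊆ closedKite c s L q :=
  fun _ h => ⟨h.1.le, h.2.le⟩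

theorem ext_plane {p q : Plane} (h0 : p 0 = q 0) (h1 : p 1 = q 1) : p = q := by
  ext i
  fin_cases i
  · exact h0
  · exact h1

theorem closedKite_bounds (hc : 0 < c) (hs : 0 < s) {q p : Plane} (h : p ∈ closedKite c s L q) :
    0 ≤ p 0 - q 0 ∧ p 0 - q 0 ≤ L ∧ (p 0 - q 0 = 0 → p = q) ∧ (p 0 - q 0 = L → p 1 = q 1) := by
  obtain ⟨h1, h2⟩ := h
  have h0 := abs_nonneg (p 1 - q 1)
  have hX : 0 ≤ p 0 - q 0 := nonneg_of_mul_nonneg_left (le_trans (by positivity) h1) hs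
  refine ⟨hX, ?_, fun h => ?_, fun h => ?_⟩
  · have : (p 0 - q 0) * (1 + c) ≤ L * (1 + c) := by nlinarith
    exact le_of_mul_le_mul_right this (by positivity)
  · rw [h, zero_mul] at h1
    have : |p 1 - q 1| ≤ 0 := by
      by_contra! hlt
      have := mul_pos hlt hc
      linarith
    exact ext_plane (sub_eq_zero.1 h) (sub_eq_zero.1 (abs_nonpos_iff.1 this))
  · rw [h] at h2
    have : |p 1 - q 1| ≤ 0 := by
      by_contra! hlt
      have := mul_pos hlt hs
      linarith
    exact sub_eq_zero.1 (abs_nonpos_iff.1 this)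

/-- The endpoints of the smooth pieces of the jump line, and the vertices of the parabolas. -/
def exceptional (c s L a y₀ : ℝ) : Set Plane :=
  ⋃ k : ℕ, {node L a y₀ k, !₂[a + k * L + L * c, y₀ + L * s], !₂[a + k * L + L * c, y₀ - L * s],
    !₂[a + k * L + L * (1 + c) / 2, y₀]}

theorem countable_exceptional (c s L a y₀ : ℝ) : (exceptional c s L a y₀).Countable :=
  countable_iUnion fun _ => (toFinite _).countable

theorem corner_mem_exceptional (hc : 0 < c) (hcs : c ^ 2 + s ^ 2 = 1) {p : Plane}
    {k : ℕ} (h1 : |p 1 - y₀| * c = (p 0 - (a + k * L)) * s)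
    (h2 : (p 0 - (a + k * L)) * (1 + c) + |p 1 - y₀| * s = L * (1 + c)) :
    p ∈ exceptional c s L a y₀ := by
  have hX : p 0 - (a + k * L) = L * c := by
    have : (p 0 - (a + k * L)) * (1 + c) = L * c * (1 + c) := by
      linear_combination c * h2 - s * h1 - (p 0 - (a + k * L)) * hcs
    exact mul_right_cancel₀ (by positivity) this
  have hY : |p 1 - y₀| = L * s := by
    rw [hX] at h1
    exact mul_right_cancel₀ hc.ne' (by rw [h1]; ring)
  refine mem_iUnion.2 ⟨k, ?_⟩
  rcases abs_choice (p 1 - y₀) with h | h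
  · right; left
    refine ext_plane ?_ ?_ <;> simp <;> linarith
  · right; right; left
    refine ext_plane ?_ ?_ <;> simp <;> linarith

/-- The part of the line `{p 1 = y₀}` which is not covered by the kites. -/
def freeAxis (L a y₀ : ℝ) (N : ℕ) : Set Plane := {p | p 1 = y₀ ∧ p 0 ∉ Icc a (a + N * L)}

def walls (c s L a y₀ : ℝ) (N : ℕ) : Set Plane :=
  ⋃ k ∈ Finset.range N, (arc c s L (node L a y₀ k) ∪ sides c s L (node L a y₀ k))

theorem mem_walls {p : Plane} : p ∈ walls c s L a y₀ N ↔
    ∃ k < N, p ∈ arc c s L (node L a y₀ k) ∨ p ∈ sides c s L (node L a y₀ k) := by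
  simp [walls]

/-- Two closed kites can meet only when they are consecutive, and then only at the shared vertex,
which is a node and hence exceptional. -/
theorem eq_of_mem_closedKite (hc : 0 < c) (hs : 0 < s) (hL : 0 < L) {p : Plane}
    (hp : p ∉ exceptional c s L a y₀) {j k : ℕ} (hj : p ∈ closedKite c s L (node L a y₀ j))
    (hk : p ∈ closedKite c s L (node L a y₀ k)) : j = k := by
  have key : ∀ i l : ℕ, p ∈ closedKite c s L (node L a y₀ i) →
      p ∈ closedKite c s L (node L a y₀ l) → ¬ i < l := by
    intro i l hi hl hil
    have h1 := closedKite_bounds hc hs hi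
    have h2 := closedKite_bounds hc hs hl
    simp only [node_zero] at h1 h2
    have : (i : ℝ) + 1 ≤ l := by exact_mod_cast hil
    have h3 : p 0 - (a + l * L) = 0 := by nlinarith
    exact hp (mem_iUnion.2 ⟨l, Or.inl (h2.2.2.1 h3)⟩)
  rcases lt_trichotomy j k with h | h | h
  · exact absurd h (key _ _ hj hk)
  · exact h
  · exact absurd h (key _ _ hk hj)

theorem chain_jump_of_mem_closedKite (hc : 0 < c) (hs : 0 < s) (hcs : c ^ 2 + s ^ 2 = 1)
    (hL : 0 < L) {p : Plane} (hp : p ∉ exceptional c s L a y₀) {k : ℕ} (hk : k < N)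
    (hpk : p ∈ closedKite c s L (node L a y₀ k)) :
    ((∃ a' b ν, IsJumpPoint (chain c s L a y₀ N) p a' b ν) ↔ p ∈ walls c s L a y₀ N) ∧
    (p ∈ walls c s L a y₀ N → jumpSize (chain c s L a y₀ N) p ∈ Ico (√(2 + 2 * c)) 2) := by
  have hmm := measurable_chain c s L a y₀ N
  have hm1 : ∀ p, ‖chain c s L a y₀ N p‖ ≤ 1 := fun p => (norm_chain hc hs hcs p).le
  have hm : ∀ᶠ p' in 𝓝 p, chain c s L a y₀ N p'
      = outer c s (node L a y₀ k 1) p' + bump c s L (node L a y₀ k) p' := by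
    have : ∀ᶠ p' in 𝓝 p, ∀ j ∈ Finset.range N, j ≠ k → p' ∉ kite c s L (node L a y₀ j) := by
      rw [Filter.eventually_all_finset]
      intro j _
      by_cases hjk : j = k
      · exact Eventually.of_forall fun _ h => absurd hjk h
      · filter_upwards [eventually_notMem_kite fun h =>
          hjk (eq_of_mem_closedKite hc hs hL hp h hpk)] with p' h _
        exact h
    filter_upwards [this] with p' h
    exact chain_eq_outer_add_bump hk fun j hj => h j (Finset.mem_range.2 hj)
  have hwall : p ∈ walls c s L a y₀ N ↔
      p ∈ arc c s L (node L a y₀ k) ∨ p ∈ sides c s L (node L a y₀ k) := by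
    rw [mem_walls]
    constructor
    · rintro ⟨j, hj, h⟩
      have : p ∈ closedKite c s L (node L a y₀ j) :=
        h.elim (fun h => arc_subset_closedKite _ h) fun h => sides_subset_closedKite _ h
      rw [eq_of_mem_closedKite hc hs hL hp this hpk] at h
      exact h
    · exact fun h => ⟨k, hk, h⟩
  rw [hwall]
  have hpq : p ≠ node L a y₀ k := fun h => hp (mem_iUnion.2 ⟨k, Or.inl h⟩)
  by_cases harc : p ∈ arc c s L (node L a y₀ k)
  -- The parabola crosses the axis at its vertex, where the jump is exactly 2 and no bound on f is
  -- assumed; that point is exceptional.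
  · have hY : p 1 ≠ node L a y₀ k 1 := by
      intro hY
      refine hp (mem_iUnion.2 ⟨k, Or.inr (Or.inr (Or.inr (ext_plane ?_ hY)))⟩)
      have := eq_of_norm_add_eq (by positivity) harc.2
      rw [hY, sub_self] at this
      simp at this ⊢
      field_simp at this ⊢
      linarith
    have := isJumpPoint_of_mem_arc hc hs hcs hmm hm1 hm harc
    exact ⟨⟨fun _ => Or.inl harc, fun _ => this.1⟩, fun _ => this.2 hY⟩
  by_cases hsides : p ∈ sides c s L (node L a y₀ k)
  -- The far sides meet the axis at the tip of the kite, which is the next node.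
  · have hY : p 1 ≠ node L a y₀ k 1 := by
      intro hY
      refine hp (mem_iUnion.2 ⟨k + 1, Or.inl (ext_plane ?_ hY)⟩)
      have := hsides.2
      rw [hY, sub_self, abs_zero, zero_mul, add_zero] at this
      have := mul_right_cancel₀ (by positivity) this
      simp at this ⊢
      linarith
    have := isJumpPoint_of_mem_sides hc hs hcs hmm hm1 hm hsides hY
    exact ⟨⟨fun _ => Or.inr hsides, fun _ => this.1⟩, fun _ => this.2⟩
  refine ⟨⟨fun h => absurd h ?_, fun h => absurd h (by tauto)⟩, fun h => absurd h (by tauto)⟩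
  rcases hpk.1.lt_or_eq with h1 | h1
  · have h2 : p ∈ kite c s L (node L a y₀ k) :=
      ⟨h1, lt_of_le_of_ne hpk.2 fun h => hsides ⟨h1, h⟩⟩
    exact not_isJumpPoint_of_mem_kite hpq hm h2 fun h => harc ⟨h2, h⟩
  · refine not_isJumpPoint_of_ray hc hs hcs hpq hm h1 (lt_of_le_of_ne hpk.2 fun h => hp ?_)
    exact corner_mem_exceptional hc hcs h1 h

theorem exists_mem_closedKite (hs : 0 < s) (hc : 0 < c) (hL : 0 < L) {p : Plane}
    (hp : p ∉ exceptional c s L a y₀) (hY : p 1 = y₀) (hX : p 0 ∈ Icc a (a + N * L)) :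
    ∃ k < N, p ∈ closedKite c s L (node L a y₀ k) := by
  have h0 : 0 ≤ (p 0 - a) / L := div_nonneg (by linarith [hX.1]) hL.le
  have h1 := Nat.floor_le h0
  have h2 := Nat.lt_floor_add_one ((p 0 - a) / L)
  rw [le_div_iff₀ hL] at h1
  rw [div_lt_iff₀ hL] at h2
  refine ⟨⌊(p 0 - a) / L⌋₊, ?_, ?_, ?_⟩
  · rw [Nat.floor_lt h0, div_lt_iff₀ hL]
    -- The right end of the row would give the index `N`, but it is itself a node and so is
    -- excluded.
    refine lt_of_le_of_ne (by linarith [hX.2]) fun h => hp (mem_iUnion.2 ⟨N, Or.inl ?_⟩)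
    exact ext_plane (by simp; linarith) hY
  · rw [hY, node_one, sub_self, abs_zero, zero_mul, node_zero]
    exact mul_nonneg (by linarith) hs.le
  · rw [hY, node_one, sub_self, abs_zero, zero_mul, add_zero, node_zero]
    gcongr
    linarith

theorem notMem_freeAxis_of_mem_closedKite (hc : 0 < c) (hs : 0 < s) (hL : 0 < L) {p : Plane}
    {k : ℕ} (hk : k < N) (h : p ∈ closedKite c s L (node L a y₀ k)) :
    p ∉ freeAxis L a y₀ N := by
  rintro ⟨_, hX⟩
  have h1 := closedKite_bounds hc hs h
  simp only [node_zero] at h1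
  refine hX ⟨?_, ?_⟩
  · have : 0 ≤ (k : ℝ) * L := by positivity
    linarith
  · have : (k : ℝ) + 1 ≤ N := by exact_mod_cast hk
    nlinarith

/-- Off a countable set, the jump line of `chain` consists of the free part of the axis, where the
jump is `2 s`, and of the walls, where it is close to `2`. -/
theorem chain_jump (hc : 0 < c) (hs : 0 < s) (hcs : c ^ 2 + s ^ 2 = 1)
    (hL : 0 < L) {p : Plane} (hp : p ∉ exceptional c s L a y₀) :
    ((∃ a' b ν, IsJumpPoint (chain c s L a y₀ N) p a' b ν) ↔
      p ∈ freeAxis L a y₀ N ∪ walls c s L a y₀ N) ∧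
    (p ∈ freeAxis L a y₀ N → jumpSize (chain c s L a y₀ N) p = 2 * s) ∧
    (p ∈ walls c s L a y₀ N → jumpSize (chain c s L a y₀ N) p ∈ Ico (√(2 + 2 * c)) 2) := by
  by_cases h : ∃ k < N, p ∈ closedKite c s L (node L a y₀ k)
  · obtain ⟨k, hk, hpk⟩ := h
    have h1 := chain_jump_of_mem_closedKite hc hs hcs hL hp hk hpk
    have h2 := notMem_freeAxis_of_mem_closedKite hc hs hL hk hpk
    refine ⟨?_, fun h => absurd h h2, h1.2⟩
    rw [h1.1, mem_union]
    tauto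
  · have hfree : p 1 = y₀ → p ∈ freeAxis L a y₀ N := fun hY =>
      ⟨hY, fun hX => h (exists_mem_closedKite hs hc hL hp hY hX)⟩
    push Not at h
    have hw : p ∉ walls c s L a y₀ N := by
      rw [mem_walls]
      rintro ⟨k, hk, h'⟩
      exact h k hk (h'.elim (fun h => arc_subset_closedKite _ h)
        fun h => sides_subset_closedKite _ h)
    have hm : ∀ᶠ p' in 𝓝 p, chain c s L a y₀ N p' = outer c s y₀ p' := by
      have : ∀ᶠ p' in 𝓝 p, ∀ j ∈ Finset.range N, p' ∉ kite c s L (node L a y₀ j) := by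
        rw [Filter.eventually_all_finset]
        exact fun j hj => eventually_notMem_kite (h j (Finset.mem_range.1 hj))
      filter_upwards [this] with p' h'
      exact chain_eq_outer fun k hk => h' k (Finset.mem_range.2 hk)
    by_cases hY : p 1 = y₀
    · have := isJumpPoint_of_outer hs (measurable_chain c s L a y₀ N)
        (fun p => (norm_chain hc hs hcs p).le) hm hY
      exact ⟨⟨fun _ => Or.inl (hfree hY), fun _ => this.1⟩, fun _ => this.2,
        fun h => absurd h hw⟩
    · have := not_isJumpPoint_of_outer hm hY
      refine ⟨⟨fun h => absurd h this, fun h => absurd h ?_⟩, fun h => absurd h.1 hY,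
        fun h => absurd h hw⟩
      rw [mem_union, not_or]
      exact ⟨fun h => hY h.1, hw⟩

end ChainJump

/-! ### Lengths of the walls and energy estimates -/

section Energy

variable {c s L a y₀ : ℝ} {N : ℕ}

theorem isometry_horizontal (y₀ : ℝ) : Isometry fun x : ℝ => (!₂[x, y₀] : Plane) := by
  refine Isometry.of_dist_eq fun x x' => ?_
  rw [dist_eq_norm, norm_plane_eq, Real.dist_eq]
  simp [Real.sqrt_sq_eq_abs]

theorem hausdorffMeasure_horizontal (y₀ : ℝ) (S : Set ℝ) :
    (Measure.hausdorffMeasure 1 : Measure Plane) {p | p 1 = y₀ ∧ p 0 ∈ S} = volume S := by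
  have : {p : Plane | p 1 = y₀ ∧ p 0 ∈ S} = (fun x : ℝ => (!₂[x, y₀] : Plane)) '' S := by
    ext p
    constructor
    · rintro ⟨h1, h2⟩
      exact ⟨p 0, h2, ext_plane rfl h1.symm⟩
    · rintro ⟨x, hx, rfl⟩
      exact ⟨rfl, hx⟩
  rw [this, (isometry_horizontal y₀).hausdorffMeasure_image (Or.inl zero_le_one),
    hausdorffMeasure_real]

/-- The crude factor 1 + κ suffices in place of √(1 + κ²), since the slope κ = s / (1 + c) used
below tends to 0 with s. -/
theorem hausdorffMeasure_graph_le {g : ℝ → ℝ} {κ u v : ℝ} (hκ : 0 ≤ κ)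
    (hg : ∀ y ∈ Ioo u v, ∀ y' ∈ Ioo u v, |g y - g y'| ≤ κ * |y - y'|) {A : Set Plane}
    (hA : ∀ p ∈ A, p 1 ∈ Ioo u v ∧ p 0 = g (p 1)) :
    (Measure.hausdorffMeasure 1 : Measure Plane) A ≤ ENNReal.ofReal ((1 + κ) * (v - u)) := by
  have hsub : A ⊆ (fun y : ℝ => (!₂[g y, y] : Plane)) '' Ioo u v := fun p hp =>
    ⟨p 1, (hA p hp).1, ext_plane (hA p hp).2.symm rfl⟩
  have hlip : LipschitzOnWith (1 + κ).toNNReal (fun y : ℝ => (!₂[g y, y] : Plane)) (Ioo u v) := by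
    refine LipschitzOnWith.of_dist_le_mul fun y hy y' hy' => ?_
    rw [Real.coe_toNNReal _ (by positivity), Real.dist_eq, dist_eq_norm]
    have e : (!₂[g y, y] : Plane) - !₂[g y', y'] = !₂[g y - g y', 0] + !₂[0, y - y'] := by
      refine ext_plane ?_ ?_ <;> simp
    rw [e]
    refine (norm_add_le _ _).trans ?_
    rw [norm_plane_eq, norm_plane_eq]
    simp [Real.sqrt_sq_eq_abs]
    linarith [hg y hy y' hy']
  refine (measure_mono hsub).trans ((hlip.hausdorffMeasure_image_le zero_le_one).trans ?_)
  rw [hausdorffMeasure_real, Real.volume_Ioo, ENNReal.rpow_one,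
    ENNReal.ofReal_mul (by positivity)]
  rfl

/-- Over the vertical coordinate the parabola has slope |Y| / (L (1 + c)), and |Y| < L s on the
kite. -/
theorem hausdorffMeasure_arc_le (hc : 0 < c) (hs : 0 < s) (hcs : c ^ 2 + s ^ 2 = 1) (hL : 0 < L)
    (q : Plane) : (Measure.hausdorffMeasure 1 : Measure Plane) (arc c s L q)
      ≤ ENNReal.ofReal ((1 + s / (1 + c)) * (2 * (L * s))) := by
  have h := hausdorffMeasure_graph_le (A := arc c s L q) (u := q 1 - L * s) (v := q 1 + L * s)
    (κ := s / (1 + c))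
    (g := fun y => ((L * (1 + c)) ^ 2 - (y - q 1) ^ 2) / (2 * (L * (1 + c))) + q 0)
    (by positivity) ?_ ?_
  · refine h.trans (le_of_eq ?_)
    congr 2
    ring
  · intro y hy y' hy'
    have e : ((L * (1 + c)) ^ 2 - (y - q 1) ^ 2) / (2 * (L * (1 + c))) + q 0
        - (((L * (1 + c)) ^ 2 - (y' - q 1) ^ 2) / (2 * (L * (1 + c))) + q 0)
        = ((y' - q 1) + (y - q 1)) / (2 * (L * (1 + c))) * (y' - y) := by ring
    rw [e, abs_mul, abs_sub_comm y' y]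
    gcongr
    rw [abs_div, abs_of_pos (by positivity : 0 < 2 * (L * (1 + c))),
      div_le_div_iff₀ (by positivity) (by positivity)]
    have : |y' - q 1 + (y - q 1)| ≤ 2 * (L * s) :=
      abs_le.2 ⟨by linarith [hy.1, hy'.1], by linarith [hy.2, hy'.2]⟩
    nlinarith
  · intro p hp
    have h1 := abs_lt.1 (abs_lt_of_mem_kite hc hs hcs hp.1).1
    have h2 := eq_of_norm_add_eq (by positivity) hp.2
    exact ⟨⟨by linarith, by linarith⟩, by linarith⟩

theorem hausdorffMeasure_sides_le (hc : 0 < c) (hs : 0 < s) (hcs : c ^ 2 + s ^ 2 = 1)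
    (q : Plane) : (Measure.hausdorffMeasure 1 : Measure Plane) (sides c s L q)
      ≤ ENNReal.ofReal ((1 + s / (1 + c)) * (2 * (L * s))) := by
  have h := hausdorffMeasure_graph_le (A := sides c s L q) (u := q 1 - L * s) (v := q 1 + L * s)
    (κ := s / (1 + c))
    (g := fun y => L - |y - q 1| * (s / (1 + c)) + q 0)
    (by positivity) ?_ ?_
  · refine h.trans (le_of_eq ?_)
    congr 2
    ring
  · intro y hy y' hy'
    have e : L - |y - q 1| * (s / (1 + c)) + q 0 - (L - |y' - q 1| * (s / (1 + c)) + q 0)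
        = s / (1 + c) * (|y' - q 1| - |y - q 1|) := by ring
    rw [e, abs_mul, abs_of_pos (by positivity : 0 < s / (1 + c))]
    refine mul_le_mul_of_nonneg_left ?_ (by positivity)
    have := abs_abs_sub_abs_le (y' - q 1) (y - q 1)
    rwa [sub_sub_sub_cancel_right, abs_sub_comm y' y] at this
  · rintro p ⟨h1, h2⟩
    have hX : p 0 = L - |p 1 - q 1| * (s / (1 + c)) + q 0 := by
      field_simp
      linarith
    have h3 : |p 1 - q 1| < L * s := by
      have h4 : |p 1 - q 1| * c * (1 + c) < (p 0 - q 0) * s * (1 + c) := by gcongr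
      have h5 : ((p 0 - q 0) * (1 + c) + |p 1 - q 1| * s) * s = L * (1 + c) * s := by rw [h2]
      have h6 : |p 1 - q 1| * (c ^ 2 + s ^ 2) = |p 1 - q 1| := by rw [hcs, mul_one]
      have h7 : |p 1 - q 1| * (1 + c) < L * s * (1 + c) := by linarith
      exact lt_of_mul_lt_mul_right h7 (by positivity)
    have h4 := abs_lt.1 h3
    exact ⟨⟨by linarith, by linarith⟩, hX⟩

theorem measurableSet_norm_add_eq (q : Plane) (C : ℝ) :
    MeasurableSet {p : Plane | ‖p - q‖ + (p 0 - q 0) = C} :=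
  (isClosed_eq (f := fun p : Plane => ‖p - q‖ + (p 0 - q 0)) (g := fun _ => C)
    (by fun_prop) (by fun_prop)).measurableSet

theorem measurableSet_walls (c s L a y₀ : ℝ) (N : ℕ) : MeasurableSet (walls c s L a y₀ N) := by
  refine Finset.measurableSet_biUnion _ fun k _ => MeasurableSet.union ?_ ?_
  · exact (isOpen_kite _ _ _ _).measurableSet.inter (measurableSet_norm_add_eq _ _)
  · set q := node L a y₀ k
    exact (isOpen_lt (f := fun p : Plane => |p 1 - q 1| * c) (g := fun p => (p 0 - q 0) * s)
      (by fun_prop) (by fun_prop)).measurableSet.inter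
      (isClosed_eq (f := fun p : Plane => (p 0 - q 0) * (1 + c) + |p 1 - q 1| * s)
        (g := fun _ => L * (1 + c)) (by fun_prop) (by fun_prop)).measurableSet

theorem measurableSet_horizontal (y₀ : ℝ) {S : Set ℝ} (hS : MeasurableSet S) :
    MeasurableSet {p : Plane | p 1 = y₀ ∧ p 0 ∈ S} :=
  (isClosed_eq (f := fun p : Plane => p 1) (g := fun _ => y₀) (by fun_prop)
    (by fun_prop)).measurableSet.inter
    ((EuclideanSpace.proj (𝕜 := ℝ) (0 : Fin 2)).continuous.measurable hS)

theorem hausdorffMeasure_walls_le (hc : 0 < c) (hs : 0 < s) (hcs : c ^ 2 + s ^ 2 = 1)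
    (hL : 0 < L) (a y₀ : ℝ) (N : ℕ) :
    (Measure.hausdorffMeasure 1 : Measure Plane) (walls c s L a y₀ N)
      ≤ ENNReal.ofReal (4 * (1 + s / (1 + c)) * s * (N * L)) := by
  refine (measure_biUnion_finset_le _ _).trans ?_
  have : ∀ k ∈ Finset.range N, (Measure.hausdorffMeasure 1 : Measure Plane)
      (arc c s L (node L a y₀ k) ∪ sides c s L (node L a y₀ k))
      ≤ ENNReal.ofReal (4 * (1 + s / (1 + c)) * s * L) := fun k _ => by
    refine (measure_union_le _ _).trans ((add_le_add (hausdorffMeasure_arc_le hc hs hcs hL _)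
      (hausdorffMeasure_sides_le hc hs hcs _)).trans (le_of_eq ?_))
    rw [← ENNReal.ofReal_add (by positivity) (by positivity)]
    congr 1
    ring
  refine (Finset.sum_le_sum this).trans (le_of_eq ?_)
  rw [Finset.sum_const, Finset.card_range, nsmul_eq_mul, ← ENNReal.ofReal_natCast,
    ← ENNReal.ofReal_mul (by positivity)]
  congr 1
  ring

theorem lineEnergy_outer (hs : 0 < s) (hcs : c ^ 2 + s ^ 2 = 1) (y₀ : ℝ) (f : ℝ → ℝ≥0∞)
    {Ω : Set Plane} (hΩ : IsOpen Ω) :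
    lineEnergy f Ω (outer c s y₀) = f (2 * s) * volume {x : ℝ | (!₂[x, y₀] : Plane) ∈ Ω} := by
  have hone : ∀ p, ‖outer c s y₀ p‖ ≤ 1 := fun p => (norm_outer hcs y₀ p).le
  have hjump : ∀ p : Plane, p 1 = y₀ → (∃ a b ν, IsJumpPoint (outer c s y₀) p a b ν) ∧
      jumpSize (outer c s y₀) p = 2 * s := fun p hp =>
    isJumpPoint_of_outer hs (measurable_outer c s y₀) hone (Eventually.of_forall fun _ => rfl) hp
  have hset : jumpSet Ω (outer c s y₀)
      = {p | p 1 = y₀ ∧ p 0 ∈ {x : ℝ | (!₂[x, y₀] : Plane) ∈ Ω}} := by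
    ext p
    have hp : p 1 = y₀ → (!₂[p 0, y₀] : Plane) = p := fun h => ext_plane rfl h.symm
    constructor
    · rintro ⟨h1, h2⟩
      have hY : p 1 = y₀ := by
        by_contra hY
        exact not_isJumpPoint_of_outer (Eventually.of_forall fun _ => rfl) hY h2
      exact ⟨hY, by rw [mem_ofPred_eq, hp hY]; exact h1⟩
    · rintro ⟨h1, h2⟩
      rw [mem_ofPred_eq, hp h1] at h2
      exact ⟨h2, (hjump p h1).1⟩
  have hopen : IsOpen {x : ℝ | (!₂[x, y₀] : Plane) ∈ Ω} :=
    hΩ.preimage (isometry_horizontal y₀).continuous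
  rw [lineEnergy, hset, setLIntegral_congr_fun (g := fun _ => f (2 * s))
    (measurableSet_horizontal y₀ hopen.measurableSet), setLIntegral_const,
    hausdorffMeasure_horizontal]
  intro p hp
  simp only [(hjump p hp.1).2]

/-- The exceptional points are countable, hence null for the one-dimensional Hausdorff measure. Only
monotonicity and subadditivity over sets are used, so no measurability of `f` is needed. -/
theorem lineEnergy_chain_le (hc : 0 < c) (hs : 0 < s) (hcs : c ^ 2 + s ^ 2 = 1)
    (hL : 0 < L) (a y₀ : ℝ) (N : ℕ) (f : ℝ → ℝ≥0∞) {Ω : Set Plane} (hΩ : IsOpen Ω) {M : ℝ≥0∞}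
    (hM : ∀ τ ∈ Ico (√(2 + 2 * c)) 2, f τ ≤ M) :
    lineEnergy f Ω (chain c s L a y₀ N) ≤
      f (2 * s) * volume {x : ℝ | (!₂[x, y₀] : Plane) ∈ Ω ∧ x ∉ Icc a (a + N * L)} +
      M * ENNReal.ofReal (4 * (1 + s / (1 + c)) * s * (N * L)) := by
  set μ : Measure Plane := Measure.hausdorffMeasure 1 with hμ
  set E := exceptional c s L a y₀
  have := Measure.nullSingletonClass_hausdorff Plane (d := 1) one_pos
  have hE : μ E = 0 := (countable_exceptional c s L a y₀).measure_zero μ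
  have hEm : MeasurableSet E := (countable_exceptional c s L a y₀).measurableSet
  set S : Set ℝ := {x | (!₂[x, y₀] : Plane) ∈ Ω ∧ x ∉ Icc a (a + N * L)}
  have hS : MeasurableSet S :=
    (hΩ.preimage (isometry_horizontal y₀).continuous).measurableSet.inter measurableSet_Icc.compl
  set T₁ : Set Plane := {p | p 1 = y₀ ∧ p 0 ∈ S} \ E
  set T₂ : Set Plane := (walls c s L a y₀ N) \ E
  have hT₁ : MeasurableSet T₁ := (measurableSet_horizontal y₀ hS).diff hEm
  have hT₂ : MeasurableSet T₂ := (measurableSet_walls c s L a y₀ N).diff hEm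
  have hfree : ∀ p : Plane, p ∈ Ω → p ∈ freeAxis L a y₀ N → p 0 ∈ S := by
    rintro p hp ⟨h1, h2⟩
    have : (!₂[p 0, y₀] : Plane) = p := ext_plane rfl h1.symm
    exact ⟨by rw [this]; exact hp, h2⟩
  have hset : jumpSet Ω (chain c s L a y₀ N) ≤ᵐ[μ] (T₁ ∪ T₂ : Set Plane) := by
    filter_upwards [compl_mem_ae_iff.2 hE] with p hp
    rintro ⟨h1, h2⟩
    rcases (chain_jump hc hs hcs hL hp).1.1 h2 with h | h
    · exact Or.inl ⟨⟨h.1, hfree p h1 h⟩, hp⟩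
    · exact Or.inr ⟨h, hp⟩
  calc lineEnergy f Ω (chain c s L a y₀ N)
      ≤ ∫⁻ p in T₁ ∪ T₂, f (jumpSize (chain c s L a y₀ N) p) ∂μ :=
        lintegral_mono_set' hset
    _ ≤ (∫⁻ p in T₁, f (jumpSize (chain c s L a y₀ N) p) ∂μ) +
        ∫⁻ p in T₂, f (jumpSize (chain c s L a y₀ N) p) ∂μ := lintegral_union_le _ _ _
    _ ≤ f (2 * s) * μ T₁ + M * μ T₂ := by
        rw [← setLIntegral_const, ← setLIntegral_const]
        refine add_le_add (setLIntegral_mono' hT₁ fun p hp => ?_)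
          (setLIntegral_mono' hT₂ fun p hp => hM _ ?_)
        · rw [((chain_jump hc hs hcs hL hp.2).2.1 ⟨hp.1.1, hp.1.2.2⟩)]
        · exact (chain_jump hc hs hcs hL hp.2).2.2 hp.1
    _ ≤ _ := by
        gcongr
        · refine (measure_mono sdiff_subset).trans (le_of_eq ?_)
          rw [hμ, hausdorffMeasure_horizontal]
        · exact (measure_mono sdiff_subset).trans (hausdorffMeasure_walls_le hc hs hcs hL a y₀ N)

end Energy

/-! ### Consequences of lower semicontinuity -/

section Consequences

variable {c s : ℝ} {f : ℝ → ℝ≥0∞} {Ω : Set Plane}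

/-- The total length ℓ is kept while the kites shrink: the L¹ distance is of order ℓ / N, and the
variation of the N kites adds up to a multiple of ℓ. Using n + 1 kites avoids a division by zero. -/
theorem weakBVTendsto_chain (hc : 0 < c) (hs : 0 < s) (hcs : c ^ 2 + s ^ 2 = 1)
    (hΩ : Bornology.IsBounded Ω) (a y₀ : ℝ) {ℓ : ℝ} (hℓ : 0 < ℓ) :
    WeakBVTendsto Ω (fun n : ℕ => chain c s (ℓ / ((n + 1 : ℕ) : ℝ)) a y₀ (n + 1))
      (outer c s y₀) := by
  obtain ⟨R, hR, hΩR⟩ := hΩ.subset_closedBall_lt 0 (0 : Plane)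
  have hL : ∀ n : ℕ, 0 < ℓ / ((n + 1 : ℕ) : ℝ) := fun n => by positivity
  constructor
  · have hlim : Tendsto (fun n : ℕ => ENNReal.ofReal (8 * R * (ℓ / ((n + 1 : ℕ) : ℝ)))) atTop
        (𝓝 0) := by
      have h1 : Tendsto (fun n : ℕ => ℓ / ((n + 1 : ℕ) : ℝ)) atTop (𝓝 0) :=
        (tendsto_const_div_atTop_nhds_zero_nat ℓ).comp (tendsto_add_atTop_nat 1)
      have h2 := ENNReal.tendsto_ofReal (h1.const_mul (8 * R))
      simpa using h2
    exact tendsto_of_tendsto_of_tendsto_of_le_of_le tendsto_const_nhds hlim (fun n => zero_le)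
      fun n => lintegral_chain_sub_outer_le hc hs hcs (hL n) a y₀ (n + 1) hR hΩR
  · refine lt_of_le_of_lt (iSup_le fun n => ?_)
      (ENNReal.ofReal_lt_top (r := 4 * (8 * R + 24 * ℓ)))
    refine (totalVariation_chain_le hc hs hcs (hL n) a y₀ (n + 1) hR hΩR).trans
      (ENNReal.ofReal_le_ofReal (le_of_eq ?_))
    have : ((n + 1 : ℕ) : ℝ) ≠ 0 := by positivity
    field_simp

/-- Lower semicontinuity tested on the replacement of the segment `[a, a + ℓ]` of the jump line by
rows of filled kites. -/
theorem mul_volume_le_of_lsc (hlsc : LineEnergyLSC f Ω) (hΩo : IsOpen Ω)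
    (hΩ : Bornology.IsBounded Ω) (hc : 0 < c) (hs : 0 < s) (hcs : c ^ 2 + s ^ 2 = 1)
    {M : ℝ≥0∞} (hM : ∀ τ ∈ Ico (√(2 + 2 * c)) 2, f τ ≤ M) (a y₀ : ℝ) {ℓ : ℝ} (hℓ : 0 < ℓ) :
    f (2 * s) * volume {x : ℝ | (!₂[x, y₀] : Plane) ∈ Ω} ≤
      f (2 * s) * volume {x : ℝ | (!₂[x, y₀] : Plane) ∈ Ω ∧ x ∉ Icc a (a + ℓ)} +
      M * ENNReal.ofReal (4 * (1 + s / (1 + c)) * s * ℓ) := by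
  have hL : ∀ n : ℕ, 0 < ℓ / ((n + 1 : ℕ) : ℝ) := fun n => by positivity
  have hNL : ∀ n : ℕ, ((n + 1 : ℕ) : ℝ) * (ℓ / ((n + 1 : ℕ) : ℝ)) = ℓ := fun n =>
    mul_div_cancel₀ _ (by positivity)
  rw [← lineEnergy_outer hs hcs y₀ f hΩo]
  refine (hlsc _ _ (fun n => chain_mem_admissible hc hs hcs (hL n) a y₀ (n + 1) hΩ)
    (outer_mem_admissible hcs y₀ hΩ) (weakBVTendsto_chain hc hs hcs hΩ a y₀ hℓ)).trans ?_
  refine (liminf_le_liminf (Eventually.of_forall fun n =>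
    lineEnergy_chain_le hc hs hcs (hL n) a y₀ (n + 1) f hΩo hM)).trans ?_
  simp_rw [hNL]
  rw [liminf_const]

theorem volume_slice_lt_top (hΩ : Bornology.IsBounded Ω) (y₀ : ℝ) :
    volume {x : ℝ | (!₂[x, y₀] : Plane) ∈ Ω} < ⊤ := by
  obtain ⟨R, hΩR⟩ := hΩ.subset_closedBall (0 : Plane)
  refine (measure_mono (t := Icc (-R) R) fun x hx => ?_).trans_lt measure_Icc_lt_top
  have h1 := PiLp.norm_apply_le (!₂[x, y₀] : Plane) 0
  exact abs_le.1 (h1.trans (mem_closedBall_zero_iff.1 (hΩR hx)))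

theorem volume_slice_pos (hΩo : IsOpen Ω) {p : Plane} (hp : p ∈ Ω) :
    0 < volume {x : ℝ | (!₂[x, p 1] : Plane) ∈ Ω} := by
  refine (hΩo.preimage (isometry_horizontal (p 1)).continuous).measure_pos _ ⟨p 0, ?_⟩
  have : (!₂[p 0, p 1] : Plane) = p := ext_plane rfl rfl
  rw [mem_preimage, this]
  exact hp

theorem le_mul_of_lsc (hlsc : LineEnergyLSC f Ω) (hΩo : IsOpen Ω)
    (hΩ : Bornology.IsBounded Ω) (hne : Ω.Nonempty) (hc : 0 < c) (hs : 0 < s)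
    (hcs : c ^ 2 + s ^ 2 = 1) {M : ℝ≥0∞} (hMtop : M ≠ ⊤)
    (hM : ∀ τ ∈ Ico (√(2 + 2 * c)) 2, f τ ≤ M) :
    f (2 * s) ≤ M * ENNReal.ofReal (4 * (1 + s / (1 + c)) * s) := by
  obtain ⟨p, hp⟩ := hne
  set y₀ := p 1
  have key := fun a ℓ => mul_volume_le_of_lsc (ℓ := ℓ) hlsc hΩo hΩ hc hs hcs hM a y₀
  have hVtop := volume_slice_lt_top hΩ y₀
  have hVpos : 0 < volume {x : ℝ | (!₂[x, y₀] : Plane) ∈ Ω} := volume_slice_pos hΩo hp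
  -- Finiteness is needed before the unmodified part of the jump line can be cancelled. It comes
  -- from covering the entire slice by kites, so that nothing remains on the axis inside Ω.
  have hfin : f (2 * s) ≠ ⊤ := by
    obtain ⟨R, hR, hΩR⟩ := hΩ.subset_closedBall_lt 0 (0 : Plane)
    have h := key (-R) (2 * R) (by positivity)
    have hempty : {x : ℝ | (!₂[x, y₀] : Plane) ∈ Ω ∧ x ∉ Icc (-R) (-R + 2 * R)} = ∅ := by
      refine eq_empty_of_forall_notMem fun x hx => hx.2 ?_
      have h1 := PiLp.norm_apply_le (!₂[x, y₀] : Plane) 0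
      have h2 := abs_le.1 (h1.trans (mem_closedBall_zero_iff.1 (hΩR hx.1)))
      simp at h2
      exact ⟨h2.1, by linarith [h2.2]⟩
    rw [hempty, measure_empty, mul_zero, zero_add] at h
    intro htop
    rw [htop, ENNReal.top_mul hVpos.ne', top_le_iff] at h
    exact ENNReal.mul_ne_top hMtop ENNReal.ofReal_ne_top h
  -- For the sharp estimate the replaced segment lies inside Ω, so that its full length is removed
  -- from the slice.
  obtain ⟨ρ, hρ, hball⟩ := Metric.isOpen_iff.1 hΩo p hp
  have hsub : Icc (p 0) (p 0 + ρ / 2) ⊆ {x : ℝ | (!₂[x, y₀] : Plane) ∈ Ω} := by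
    intro x hx
    refine hball ?_
    have e : p = !₂[p 0, y₀] := ext_plane rfl rfl
    rw [Metric.mem_ball]
    conv_lhs => rw [e]
    rw [(isometry_horizontal y₀).dist_eq, Real.dist_eq, abs_of_nonneg (by linarith [hx.1])]
    linarith [hx.2]
  have h := key (p 0) (ρ / 2) (by positivity)
  have hsplit : volume {x : ℝ | (!₂[x, y₀] : Plane) ∈ Ω}
      = volume {x : ℝ | (!₂[x, y₀] : Plane) ∈ Ω ∧ x ∉ Icc (p 0) (p 0 + ρ / 2)}
        + ENNReal.ofReal (ρ / 2) := by
    rw [← measure_inter_add_sdiff {x : ℝ | (!₂[x, y₀] : Plane) ∈ Ω} measurableSet_Icc,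
      inter_eq_self_of_subset_right hsub, Real.volume_Icc, add_sub_cancel_left, add_comm]
    rfl
  have hV'top : volume {x : ℝ | (!₂[x, y₀] : Plane) ∈ Ω ∧ x ∉ Icc (p 0) (p 0 + ρ / 2)} ≠ ⊤ :=
    ((measure_mono fun x hx => hx.1).trans_lt hVtop).ne
  rw [hsplit, mul_add, ENNReal.add_le_add_iff_left (ENNReal.mul_ne_top hfin hV'top),
    ENNReal.ofReal_mul (by positivity), ← mul_assoc] at h
  exact (ENNReal.mul_le_mul_iff_left (by simpa using hρ) ENNReal.ofReal_ne_top).1 h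

theorem sq_sqrt_one_sub_sq_add {s : ℝ} (h0 : 0 ≤ s) (h1 : s ≤ 1) :
    √(1 - s ^ 2) ^ 2 + s ^ 2 = 1 := by
  rw [Real.sq_sqrt (by nlinarith)]
  ring

theorem limsup_div_le_of_lsc (hlsc : LineEnergyLSC f Ω) (hΩo : IsOpen Ω)
    (hΩ : Bornology.IsBounded Ω) (hne : Ω.Nonempty) :
    limsup (fun t : ℝ => f t / ENNReal.ofReal t) (𝓝[>] 0) ≤ 2 * limsup f (𝓝[<] 2) := by
  -- With the right-hand limsup isolated, it can be approximated by numbers `B` above it, which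
  -- bound f on some interval [δ, 2).
  suffices h : limsup (fun t : ℝ => f t / ENNReal.ofReal t) (𝓝[>] 0) / 2 ≤ limsup f (𝓝[<] 2) by
    rwa [ENNReal.div_le_iff' two_ne_zero ENNReal.ofNat_ne_top] at h
  refine le_of_forall_gt_imp_ge_of_dense fun B hB => ?_
  rw [ENNReal.div_le_iff' two_ne_zero ENNReal.ofNat_ne_top]
  rcases eq_or_ne B ⊤ with rfl | hBtop
  · simp
  set C : ℝ → ℝ := fun t => √(1 - (t / 2) ^ 2) with hC
  have hCcont : Continuous C := by fun_prop
  have hC0 : C 0 = 1 := by simp [hC]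
  have hev : ∀ᶠ τ in 𝓝[<] (2 : ℝ), f τ < B := eventually_lt_of_limsup_lt hB
  obtain ⟨δ, hδ, hδB⟩ := mem_nhdsLT_iff_exists_Ico_subset.1 hev
  have h1 : ∀ᶠ t in 𝓝[>] (0 : ℝ), δ < √(2 + 2 * C t) := by
    have hcont : Continuous fun t => √(2 + 2 * C t) := by fun_prop
    have hlim := hcont.tendsto 0
    rw [hC0, show (2 : ℝ) + 2 * 1 = 2 ^ 2 by norm_num, Real.sqrt_sq (by norm_num)] at hlim
    exact (hlim.mono_left nhdsWithin_le_nhds).eventually_const_lt hδ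
  have h2 : ∀ᶠ t in 𝓝[>] (0 : ℝ), f t / ENNReal.ofReal t
      ≤ B * ENNReal.ofReal (2 * (1 + t / 2 / (1 + C t))) := by
    filter_upwards [h1, Ioo_mem_nhdsGT (two_pos (α := ℝ))] with t ht htI
    have hpos : 0 < C t := Real.sqrt_pos.2 (by nlinarith [htI.1, htI.2])
    have hcs := sq_sqrt_one_sub_sq_add (s := t / 2) (by linarith [htI.1]) (by linarith [htI.2])
    -- For t close to 0 all wall jumps lie in [δ, 2), so `B` serves as the bound. With s = t / 2 the
    -- factor 4 s is 2 t, the source of the constant 2.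
    have h := le_mul_of_lsc hlsc hΩo hΩ hne hpos (by linarith [htI.1] : 0 < t / 2) hcs hBtop
      fun τ hτ => (hδB ⟨ht.le.trans hτ.1, hτ.2⟩).le
    rw [mul_div_cancel₀ t two_ne_zero] at h
    have ht0 := htI.1
    refine ENNReal.div_le_of_le_mul (h.trans (le_of_eq ?_))
    rw [mul_assoc B, ← ENNReal.ofReal_mul (by positivity)]
    congr 2
    ring
  refine (limsup_le_limsup h2).trans (le_of_eq ?_)
  have hlim : Tendsto (fun t => B * ENNReal.ofReal (2 * (1 + t / 2 / (1 + C t)))) (𝓝[>] 0)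
      (𝓝 (B * ENNReal.ofReal (2 * (1 + 0 / 2 / (1 + C 0))))) := by
    refine ENNReal.Tendsto.const_mul (ENNReal.tendsto_ofReal ?_) (Or.inr hBtop)
    have : ContinuousAt (fun t => 2 * (1 + t / 2 / (1 + C t))) 0 := by
      have hd : 1 + C 0 ≠ 0 := by rw [hC0]; norm_num
      fun_prop (disch := assumption)
    exact this.tendsto.mono_left nhdsWithin_le_nhds
  rw [hlim.limsup_eq, mul_comm]
  simp

theorem norm_outer_sub_outer_le (c s c' s' y₀ : ℝ) (p : Plane) :
    ‖outer c s y₀ p - outer c' s' y₀ p‖ ≤ |s - s'| + |c - c'| := by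
  have h : ‖outer c s y₀ p - outer c' s' y₀ p‖ = √((s - s') ^ 2 + (c - c') ^ 2) := by
    rw [norm_plane_eq]
    congr 1
    simp only [outer, PiLp.sub_apply]
    split_ifs
    · simp
      ring
    · simp
  rw [h]
  refine Real.sqrt_le_iff.2 ⟨by positivity, ?_⟩
  nlinarith [sq_abs (s - s'), sq_abs (c - c'), abs_nonneg (s - s'), abs_nonneg (c - c'),
    mul_nonneg (abs_nonneg (s - s')) (abs_nonneg (c - c'))]

theorem lowerSemicontinuousOn_of_lsc (hlsc : LineEnergyLSC f Ω) (hΩo : IsOpen Ω)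
    (hΩ : Bornology.IsBounded Ω) (hne : Ω.Nonempty) : LowerSemicontinuousOn f (Ioc 0 2) := by
  intro t ht y hy
  by_contra hcon
  -- A failure at `t` gives jump sizes tending to `t` along which f stays at most `y < f t`; the
  -- outer fields with these jumps across the same line contradict the hypothesis. The value t = 2
  -- (c = 0) is included, since no kite is involved.
  obtain ⟨τ, hτ, hτy⟩ := exists_seq_forall_of_frequently
    ((not_eventually.1 hcon).and_eventually self_mem_nhdsWithin)
  obtain ⟨p, hp⟩ := hne
  obtain ⟨R, hR, hΩR⟩ := hΩ.subset_closedBall_lt 0 (0 : Plane)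
  set y₀ := p 1
  have hlim : Tendsto τ atTop (𝓝 t) := hτ.mono_right nhdsWithin_le_nhds
  set S : ℝ → ℝ := fun t => t / 2
  set C : ℝ → ℝ := fun t => √(1 - S t ^ 2)
  have hcs : ∀ t ∈ Ioc (0 : ℝ) 2, C t ^ 2 + S t ^ 2 = 1 := fun t ht =>
    sq_sqrt_one_sub_sq_add (div_nonneg ht.1.le two_pos.le) (by simp only [S]; linarith [ht.2])
  have hS : ∀ t ∈ Ioc (0 : ℝ) 2, 0 < S t := fun t ht => half_pos ht.1
  have h2S : ∀ t, 2 * S t = t := fun t => mul_div_cancel₀ t two_ne_zero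
  have hconv : WeakBVTendsto Ω (fun n => outer (C (τ n)) (S (τ n)) y₀) (outer (C t) (S t) y₀) := by
    constructor
    · have hd : Tendsto (fun n => |S (τ n) - S t| + |C (τ n) - C t|) atTop (𝓝 0) := by
        have hcont : Continuous fun r => |S r - S t| + |C r - C t| := by fun_prop
        have := (hcont.tendsto t).comp hlim
        simpa [Function.comp_def] using this
      have hd' : Tendsto (fun n => ENNReal.ofReal (|S (τ n) - S t| + |C (τ n) - C t|) * volume Ω)
          atTop (𝓝 0) := by
        have := ENNReal.Tendsto.mul_const (ENNReal.tendsto_ofReal hd)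
          (Or.inr hΩ.measure_lt_top.ne : _ ∨ volume Ω ≠ ⊤)
        simpa using this
      refine tendsto_of_tendsto_of_tendsto_of_le_of_le tendsto_const_nhds hd'
        (fun n => zero_le) fun n => ?_
      rw [← setLIntegral_const]
      refine lintegral_mono fun x => ?_
      rw [← ofReal_norm]
      exact ENNReal.ofReal_le_ofReal (norm_outer_sub_outer_le _ _ _ _ _ _)
    · exact (iSup_le fun n => totalVariation_outer_le (hcs _ (hτy n).2) y₀ hR hΩR).trans_lt
        ENNReal.ofReal_lt_top
  have h := hlsc _ _ (fun n => outer_mem_admissible (hcs _ (hτy n).2) y₀ hΩ)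
    (outer_mem_admissible (hcs _ ht) y₀ hΩ) hconv
  rw [lineEnergy_outer (hS _ ht) (hcs _ ht) y₀ f hΩo, h2S] at h
  have h' : f t * volume {x : ℝ | (!₂[x, y₀] : Plane) ∈ Ω}
      ≤ y * volume {x : ℝ | (!₂[x, y₀] : Plane) ∈ Ω} := by
    refine h.trans ((liminf_le_liminf (v := fun _ => y * volume {x : ℝ | (!₂[x, y₀] : Plane) ∈ Ω})
      (Eventually.of_forall fun n => ?_)).trans (le_of_eq (liminf_const _)))
    rw [lineEnergy_outer (hS _ (hτy n).2) (hcs _ (hτy n).2) y₀ f hΩo, h2S]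
    gcongr
    exact not_lt.1 (hτy n).1
  have h'' := (ENNReal.mul_le_mul_iff_left (volume_slice_pos hΩo hp).ne'
    (volume_slice_lt_top hΩ y₀).ne).1 h'
  exact absurd hy (not_lt.2 h'')

end Consequences

end LineEnergy

theorem theorem1 (f : ℝ → ℝ≥0∞) (Ω : Set LineEnergy.Plane)
    (hΩ_open : IsOpen Ω) (hΩ_bdd : Bornology.IsBounded Ω) (hΩ_ne : Ω.Nonempty)
    (hlsc : LineEnergy.LineEnergyLSC f Ω) :
    LowerSemicontinuousOn f (Ioc 0 2) ∧
    (f 0 = 0 → LowerSemicontinuousOn f (Icc 0 2)) ∧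
    limsup (fun t : ℝ => f t / ENNReal.ofReal t) (𝓝[>] 0) ≤ 2 * limsup f (𝓝[<] 2) := by
  have h := LineEnergy.lowerSemicontinuousOn_of_lsc hlsc hΩ_open hΩ_bdd hΩ_ne
  refine ⟨h, fun h0 t ht y hy => ?_,
    LineEnergy.limsup_div_le_of_lsc hlsc hΩ_open hΩ_bdd hΩ_ne⟩
  rcases ht.1.eq_or_lt with rfl | htpos
  -- At t = 0 there is nothing to prove: no value lies strictly below f 0 = 0.
  · rw [h0] at hy
    exact absurd hy not_lt_zero
  · have h1 := h t ⟨htpos, ht.2⟩ y hy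
    have e : 𝓝[Icc 0 2] t ≤ 𝓝[Ioc 0 2] t := nhdsWithin_le_iff.2 <| by
      filter_upwards [self_mem_nhdsWithin, mem_nhdsWithin_of_mem_nhds (Ioi_mem_nhds htpos)]
        with x hx hx'
      exact ⟨hx', hx.2⟩
    exact h1.filter_mono e
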